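/- **Conventions.** Let $n\geq 0$ and let $\equiv$ denote congruence mod $8$. $C\ell_n$ is the real algebra generated by $e_1,\dots,e_n$ with $e_ke_l+e_le_k=-2\delta_{kl}$, $\omega_n=e_1\cdots e_n$, and $\mathrm{Spin}(n)\subset C\ell_n\subset C\ell_{n+1}$. $\Delta_n$ is an irreducible real representation of $C\ell_n$ with an inner product for which the $e_k$ act orthogonally, where for $n\equiv 3,7$ we take the one with $\omega_n=1$ (written $\Delta_n^+$); $\Sigma_n$ is its restriction to $\mathrm{Spin}(n)$. For $n\equiv 0,4$, $\Sigma_n^\pm$ are the $(\pm1)$-eigenspaces of $\omega_n$. These carry the following structures, all of which exist: for $n\equiv1$, $I=\omega_n$ and a real structure $\sigma_n$ on $\Sigma_n$ ($\sigma_n^2=1$, $\sigma_n I=-I\sigma_n$, commuting with $\mathrm{Spin}(n)$), with $\Sigma_n^\pm$ its $(\pm1)$-eigenspaces; for $n\equiv 2,3,4$, a quaternionic structure $I,J$ ($I^2=J^2=-1$, $IJ=-JI$) commuting with $C\ell_n$, and for $n\equiv2$, $\Sigma_n^\pm=\{\omega_n=\pm I\}$; for $n\equiv 5$, a quaternionic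 structure $I=\omega_n$, $J$ on $\Sigma_n$ commuting with $\mathrm{Spin}(n)$; for $n\equiv6$, the complex structure $I=-\omega_n$ on $\Sigma_n$, commuting with $\mathrm{Spin}(n)$. The structures $\sigma$, $I$, $J$ below are arbitrary ones of this kind on $\Sigma_n$ and $\Sigma_{n+1}$. Clifford multiplication is written as a product. **Proposition B.1.** There are orthogonal isomorphisms, equivariant under $\mathrm{Spin}(n)$, such that for $1\leq k\leq n$: (a) $n\equiv0$: $\Phi:\Sigma_n\otimes_{\mathbb R}\mathbb C\to\Sigma_{n+1}$, $\mathbb C$-linear, $\sigma_{n+1}\Phi=\Phi\circ(\mathrm{id}\otimes\overline{\,\cdot\,})$, $e_k\Phi=\Phi\circ(\omega_ne_k\otimes i)$, $e_{n+1}\Phi=\Phi\circ(\omega_n\otimes i)$. (b) $n\equiv1$: $\Phi:\Sigma_n\oplus\Sigma_n\to\Sigma_{n+1}$, $\mathbb C$-linear, $e_k\Phi=\Phi\begin{pmatrix}e_k&0\\0&-e_k\end{pmatrix}$, $e_{n+1}\Phi=\Phi\begin{pmatrix}0&1\\-1&0\end{pmatrix}$, $J\Phi=\Phi\begin{pmatrix}0&\sigma_n\\-\sigma_n&0\end{pmatrix}$.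 (c) $n\equiv2$: $\Phi:\Sigma_n\to\Sigma_{n+1}$, $\mathbb H$-linear, $e_k\Phi=\Phi e_k$, $e_{n+1}\Phi=-\Phi\omega_n$. (d) $n\equiv3,7$: $\Phi^\pm:\Sigma_n\to\Sigma_{n+1}^\pm$, $\mathbb H$-linear for $n\equiv3$ and $\mathbb R$-linear for $n\equiv7$, $e_k\Phi^\pm=\Phi^\mp e_k$, $e_{n+1}\Phi^\pm=\pm\Phi^\mp$. (e) $n\equiv4$: $\Phi:\Sigma_n\to\Sigma_{n+1}$, $e_k\Phi=\Phi e_k$, $e_{n+1}\Phi=I\Phi\omega_n$, $I\Phi=\Phi I$, $J\Phi=\Phi J\omega_n$ (that is, $\Phi$ is $\mathbb H$-linear on $\Sigma_n^+\oplus(\Sigma_n^-)^\diamond$, where $\diamond$ replaces $J$ by $-J$). (f) $n\equiv5$: $\Phi:\Sigma_n\to\Sigma_{n+1}$, $e_ke_{n+1}\Phi=\Phi e_k$, $\omega_{n+1}\Phi=\Phi I$, $e_{n+1}\Phi=\Phi J$. (g) $n\equiv6$: $\Phi:\Sigma_n\to\Sigma_{n+1}$, $\mathbb R$-linear, $e_k\Phi=\Phi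 e_k$, $e_{n+1}\Phi=\Phi I$. In each case every $\mathbb R$-linear map (in (d): pair of maps) with these properties is a real multiple (in (d): with a common factor) of the given one. **Cylinders.** Let $X$ be a Riemannian spin $n$-manifold, $Y=X\times\mathbb R$ with the product metric and spin structure, $D_X=\sum_k e_k\nabla_{e_k}$ the full Dirac operator on sections of $\Sigma_X$, $D_X^\pm$ its restriction to sections of $\Sigma_X^\pm$, and $D_X^{\rm skew}=-ID_X^+$ for $n\equiv1$, $D_X^{\rm skew}=-JD_X^+$ for $n\equiv2$, on sections of $\Sigma_X^+$; similarly on $Y$. Any orthogonal isomorphism $\Phi$ (pair $\Phi^\pm$) as above induces isomorphisms of bundles over $Y$ under which - $n\equiv0$: $D_Y^{\rm skew}$ is $\begin{pmatrix}\partial_t&D_X^-\\-D_X^+&-\partial_t\end{pmatrix}$ on $\Sigma_X^+\oplus\Sigma_X^-\cong\Sigma_Y^+$, $\phi\mapsto\Phi(\phi\otimes1)$, where $\Sigma_Y^+$ is the fixed bundle of $\sigma_{n+1}$; - $n\equiv1$: $D_Y^{\rm skew}$ is $\overline{\partial_t+i(D_X^{\rm skew})_{\mathbb C}}$ on $\Sigma_X^+\otimes\mathbb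 C\cong\Sigma_Y^+$, $\phi_1+i\phi_2\mapsto\Phi(\phi,\phi)$, $\phi=\phi_1+I\phi_2$; - $n\equiv2$: $D_Y$ is $\begin{pmatrix}-i\partial_t&-\overline{D_X^{\rm skew}}\\D_X^{\rm skew}&i\partial_t\end{pmatrix}$ on $\Sigma_X^+\oplus\overline{\Sigma_X^+}\cong\Sigma_Y$, $(\phi,\chi)\mapsto\Phi(\phi+J\chi)$; - $n\equiv3,7$: $D_Y^+\Phi^+=\Phi^-(\partial_t+D_X)$; - $n\equiv4$: $D_Y$ is $\begin{pmatrix}i\partial_t&D_X^-\\D_X^+&-i\partial_t\end{pmatrix}$ on $\Sigma_X^+\oplus\Sigma_X^-\cong\Sigma_Y$, where $i=I$; - $n\equiv5$: $D_Y\Phi=\Phi J(\partial_t+D_X)$; - $n\equiv6$: $D_Y\Phi=\Phi(I\partial_t+D_X)$. -/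

import Mathlib

universe u v w

open scoped TensorProduct Manifold ContDiff

noncomputable section

namespace RealDirac



/-! ## Clifford algebras -/

/-- The quadratic form `v ↦ -∑ vᵢ²` on `ℝⁿ`. -/
def cliffordForm (n : ℕ) : QuadraticForm ℝ (Fin n → ℝ) :=
  QuadraticMap.weightedSumSquares ℝ (fun _ : Fin n => (-1 : ℝ))

/-- The Clifford algebra `Cℓ_n` with `e_k e_l + e_l e_k = -2 δ_{kl}`. -/
abbrev Cl (n : ℕ) : Type := CliffordAlgebra (cliffordForm n)

/-- The vectors `ℝⁿ ⊆ Cℓ_n`. -/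
def vec (n : ℕ) : (Fin n → ℝ) →ₗ[ℝ] Cl n := CliffordAlgebra.ι (cliffordForm n)

/-- The generators `e_k`. -/
def e {n : ℕ} (k : Fin n) : Cl n := vec n (Pi.single k 1)

/-- The volume element `ω_n = e_1 ⋯ e_n`. -/
def vol (n : ℕ) : Cl n := (List.ofFn (fun k : Fin n => e k)).prod

/-- The group `Spin(n) ⊆ Cℓ_n`. -/
abbrev Spin (n : ℕ) : Submonoid (Cl n) := spinGroup (cliffordForm n)

/-- The inclusion `ℝⁿ → ℝⁿ⁺¹`, `v ↦ (v, 0)`. -/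
def inclVec (n : ℕ) : cliffordForm n →qᵢ cliffordForm (n + 1) where
  toFun v := Fin.snoc (α := fun _ => ℝ) v 0
  map_add' v w := by
    funext i
    refine Fin.lastCases ?_ (fun j => ?_) i <;> simp
  map_smul' c v := by
    funext i
    refine Fin.lastCases ?_ (fun j => ?_) i <;> simp
  map_app' v := by
    simp [cliffordForm, QuadraticMap.weightedSumSquares_apply, Fin.sum_univ_castSucc]

/-- The inclusion `i_n : Cℓ_n → Cℓ_{n+1}`, `e_k ↦ e_k`. -/
def incl (n : ℕ) : Cl n →ₐ[ℝ] Cl (n + 1) := CliffordAlgebra.map (inclVec n)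

theorem incl_vec (n : ℕ) (v : Fin n → ℝ) :
    incl n (vec n v) = vec (n + 1) (Fin.snoc (α := fun _ => ℝ) v 0) :=
  CliffordAlgebra.map_apply_ι _ _

theorem star_incl (n : ℕ) (a : Cl n) : star (incl n a) = incl n (star a) := by
  induction a using CliffordAlgebra.induction with
  | algebraMap r =>
    rw [AlgHom.commutes, CliffordAlgebra.star_algebraMap, CliffordAlgebra.star_algebraMap,
      AlgHom.commutes]
  | ι v =>
    have h := incl_vec n v
    unfold vec at h
    rw [h, CliffordAlgebra.star_ι, CliffordAlgebra.star_ι, map_neg, h]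
  | mul a b ha hb => rw [map_mul, star_mul, star_mul, map_mul, ha, hb]
  | add a b ha hb => rw [map_add, star_add, star_add, map_add, ha, hb]

theorem involute_incl (n : ℕ) (a : Cl n) :
    CliffordAlgebra.involute (incl n a) = incl n (CliffordAlgebra.involute a) := by
  induction a using CliffordAlgebra.induction with
  | algebraMap r => simp only [AlgHom.commutes]
  | ι v =>
    have h := incl_vec n v
    unfold vec at h
    rw [h, CliffordAlgebra.involute_ι, CliffordAlgebra.involute_ι, map_neg, h]
  | mul a b ha hb => simp only [map_mul, ha, hb]
  | add a b ha hb => simp only [map_add, ha, hb]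

theorem incl_mem_spin (n : ℕ) {g : Cl n} (hg : g ∈ Spin n) : incl n g ∈ Spin (n + 1) := by
  have hp := spinGroup.mem_pin hg
  refine spinGroup.mem_iff.2 ⟨pinGroup.mem_iff.2 ⟨?_, ?_⟩, ?_⟩
  · obtain ⟨u, hu, rfl⟩ := pinGroup.mem_lipschitzGroup hp
    refine ⟨Units.map (incl n : Cl n →* Cl (n + 1)) u, ?_, rfl⟩
    have hle : lipschitzGroup (cliffordForm n) ≤
        (lipschitzGroup (cliffordForm (n + 1))).comap
          (Units.map (incl n : Cl n →* Cl (n + 1))) := by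
      refine (Subgroup.closure_le _).2 ?_
      rintro x ⟨v, hv⟩
      refine Subgroup.subset_closure ⟨Fin.snoc (α := fun _ => ℝ) v 0, ?_⟩
      have h := incl_vec n v
      unfold vec at h
      rw [← h, hv]
      rfl
    exact hle hu
  · have := pinGroup.mem_unitary hp
    refine ⟨?_, ?_⟩
    · rw [star_incl, ← map_mul, this.1, map_one]
    · rw [star_incl, ← map_mul, this.2, map_one]
  · have hle : (CliffordAlgebra.even (cliffordForm n)).map (incl n) ≤
        CliffordAlgebra.even (cliffordForm (n + 1)) := by
      rintro _ ⟨x, hx, rfl⟩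
      induction x, hx using CliffordAlgebra.even_induction with
      | algebraMap r => rw [AlgHom.coe_toRingHom, AlgHom.commutes]; exact Subalgebra.algebraMap_mem _ r
      | add x y hx hy ihx ihy => rw [map_add]; exact Subalgebra.add_mem _ ihx ihy
      | ι_mul_ι_mul v w x hx ih =>
        have hv := incl_vec n v
        have hw := incl_vec n w
        unfold vec at hv hw
        rw [map_mul, map_mul]
        refine Subalgebra.mul_mem _ ?_ ih
        simp only [AlgHom.coe_toRingHom]
        rw [hv, hw]
        exact CliffordAlgebra.ι_mul_ι_mem_evenOdd_zero _ _ _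
    exact hle ⟨g, spinGroup.mem_even hg, rfl⟩

theorem vec_last_mul_incl (n : ℕ) (t : ℝ) (a : Cl n) :
    vec (n + 1) (Pi.single (Fin.last n) t) * incl n a =
      incl n (CliffordAlgebra.involute a) * vec (n + 1) (Pi.single (Fin.last n) t) := by
  induction a using CliffordAlgebra.induction with
  | algebraMap r => simp only [AlgHom.commutes]; exact (Algebra.commutes r _).symm
  | ι v =>
    have h := incl_vec n v
    unfold vec at h ⊢
    rw [CliffordAlgebra.involute_ι, map_neg, h, neg_mul, eq_neg_iff_add_eq_zero,
      CliffordAlgebra.ι_mul_ι_add_swap]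
    have : QuadraticMap.polar (cliffordForm (n + 1)) (Pi.single (Fin.last n) t)
        (Fin.snoc (α := fun _ => ℝ) v 0) = 0 := by
      simp [QuadraticMap.polar, cliffordForm, QuadraticMap.weightedSumSquares_apply,
        Fin.sum_univ_castSucc]
    rw [this, map_zero]
  | mul a b ha hb => rw [map_mul, map_mul, map_mul, ← mul_assoc, ha, mul_assoc, hb, mul_assoc]
  | add a b ha hb => rw [map_add, map_add, map_add, mul_add, add_mul, ha, hb]


theorem spin_conj_incl_last (n : ℕ) (t : ℝ) {g : Cl n} (hg : g ∈ Spin n) :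
    incl n g * vec (n + 1) (Pi.single (Fin.last n) t) * star (incl n g) =
      vec (n + 1) (Pi.single (Fin.last n) t) := by
  have h0 := CliffordAlgebra.involute_eq_of_mem_even (spinGroup.mem_even hg)
  have h1 := vec_last_mul_incl n t g
  rw [h0] at h1
  rw [← h1, star_incl, mul_assoc, ← map_mul, spinGroup.mul_star_self_of_mem hg, map_one, mul_one]

/-! ## Riemannian spin manifolds -/

/-- A Riemannian spin `n`-manifold, possibly with boundary or corners. The reduction of the frame
bundle to `Spin(n)` is given by local sections: an open cover `U α`, over each `U α` a smooth local
frame (the metric is the one for which these frames are orthonormal), and smooth transition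
functions `g α β` with values in `Spin(n)` that satisfy the cocycle condition and cover the
transition functions of the frames. -/
structure SpinManifold (n : ℕ) where
  E : Type u
  [normedAddCommGroupE : NormedAddCommGroup E]
  [normedSpaceE : NormedSpace ℝ E]
  [finiteDimensionalE : FiniteDimensional ℝ E]
  H : Type u
  [topologicalSpaceH : TopologicalSpace H]
  I : ModelWithCorners ℝ E H
  X : Type u
  [topologicalSpaceX : TopologicalSpace X]
  [chartedSpaceX : ChartedSpace H X]
  [isManifoldX : IsManifold I ∞ X]
  A : Type u
  U : A → Set X
  isOpen_U : ∀ α, IsOpen (U α)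
  cover : ∀ x, ∃ α, x ∈ U α
  frame : A → Fin n → (x : X) → TangentSpace I x
  frame_smooth : ∀ α k,
    ContMDiffOn I I.tangent ∞ (fun x => (⟨x, frame α k x⟩ : TangentBundle I X)) (U α)
  frame_li : ∀ α, ∀ x ∈ U α, LinearIndependent ℝ (fun k => frame α k x)
  frame_span : ∀ α, ∀ x ∈ U α, ⊤ ≤ Submodule.span ℝ (Set.range (fun k => frame α k x))
  g : A → A → X → Cl n
  g_spin : ∀ α β, ∀ x ∈ U α ∩ U β, g α β x ∈ Spin n
  g_smooth : ∀ α β, ∀ l : Cl n →ₗ[ℝ] ℝ,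
    ContMDiffOn I 𝓘(ℝ, ℝ) ∞ (fun x => l (g α β x)) (U α ∩ U β)
  g_cocycle : ∀ α β γ, ∀ x ∈ U α ∩ U β ∩ U γ, g α β x * g β γ x = g α γ x
  /-- the vector with coordinates `v` in the frame `β` has coordinates `g v g⁻¹` in the frame
  `α` -/
  g_frame : ∀ α β, ∀ x ∈ U α ∩ U β, ∀ v : Fin n → ℝ, ∃ w : Fin n → ℝ,
    vec n w = g α β x * vec n v * star (g α β x) ∧
      ∑ k, v k • frame β k x = ∑ k, w k • frame α k x

attribute [instance] SpinManifold.normedAddCommGroupE SpinManifold.normedSpaceE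
  SpinManifold.finiteDimensionalE SpinManifold.topologicalSpaceH SpinManifold.topologicalSpaceX
  SpinManifold.chartedSpaceX SpinManifold.isManifoldX

namespace SpinManifold

variable {n : ℕ}

/-- The frame `e_1, …, e_n, e_{n+1} = ∂/∂t` of `X × ℝ`. -/
def cylFrame (M : SpinManifold.{u} n) (α : M.A) (k : Fin (n + 1)) (p : M.X × ℝ) :
    TangentSpace (M.I.prod 𝓘(ℝ, ℝ)) p :=
  Fin.lastCases (motive := fun _ => M.E × ℝ) (0, 1) (fun j => (M.frame α j p.1, 0)) k

theorem cylFrame_castSucc (M : SpinManifold.{u} n) (α : M.A) (k : Fin n) (p : M.X × ℝ) :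
    M.cylFrame α k.castSucc p = ((M.frame α k p.1, 0) : M.E × ℝ) :=
  Fin.lastCases_castSucc (motive := fun _ => M.E × ℝ) k

theorem cylFrame_last (M : SpinManifold.{u} n) (α : M.A) (p : M.X × ℝ) :
    M.cylFrame α (Fin.last n) p = ((0, 1) : M.E × ℝ) :=
  Fin.lastCases_last (motive := fun _ => M.E × ℝ)

theorem cylFrame_sum (M : SpinManifold.{u} n) (α : M.A) (p : M.X × ℝ) (v : Fin (n + 1) → ℝ) :
    ∑ k, v k • M.cylFrame α k p =
      ((∑ k : Fin n, v k.castSucc • M.frame α k p.1, v (Fin.last n)) : M.E × ℝ) := by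
  rw [Fin.sum_univ_castSucc, cylFrame_last]
  simp only [cylFrame_castSucc]
  have h : ∀ s : Finset (Fin n), (∑ k ∈ s, v k.castSucc • ((M.frame α k p.1, 0) : M.E × ℝ)) =
      ((∑ k ∈ s, v k.castSucc • (M.frame α k p.1 : M.E), 0) : M.E × ℝ) := by
    intro s
    rw [Prod.ext_iff, Prod.fst_sum, Prod.snd_sum]
    simp
    rfl
  refine (congrArg (fun z : M.E × ℝ => z + v (Fin.last n) • ((0, 1) : M.E × ℝ))
    (h Finset.univ)).trans ?_
  refine Prod.ext ?_ ?_
  · simp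
  · simp

/-- The cylinder `X × ℝ` with the product metric and the product spin structure. -/
def cylinder (M : SpinManifold.{u} n) : SpinManifold.{u} (n + 1) where
  E := M.E × ℝ
  H := ModelProd M.H ℝ
  I := M.I.prod 𝓘(ℝ, ℝ)
  X := M.X × ℝ
  A := M.A
  U α := M.U α ×ˢ Set.univ
  isOpen_U α := (M.isOpen_U α).prod isOpen_univ
  cover p := by
    obtain ⟨α, h⟩ := M.cover p.1
    exact ⟨α, h, trivial⟩
  frame := M.cylFrame
  frame_smooth α k := by
    have key := contMDiff_equivTangentBundleProd_symm (I := M.I) (I' := 𝓘(ℝ, ℝ)) (M := M.X)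
      (M' := ℝ) (n := ∞)
    refine Fin.lastCases ?_ (fun j => ?_) k
    · have h1 : ContMDiff M.I M.I.tangent ∞ (fun x : M.X => (⟨x, 0⟩ : TangentBundle M.I M.X)) :=
        Bundle.contMDiff_zeroSection ℝ _
      have h2 : ContMDiff 𝓘(ℝ, ℝ) 𝓘(ℝ, ℝ).tangent ∞
          (fun t : ℝ => (⟨t, (1 : ℝ)⟩ : TangentBundle 𝓘(ℝ, ℝ) ℝ)) :=
        contMDiff_vectorSpace_iff_contDiff.2 contDiff_const
      have h3 := key.comp (h1.prodMap h2)
      refine (h3.contMDiffOn (s := M.U α ×ˢ Set.univ)).congr ?_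
      intro p _
      rw [cylFrame_last]
      rfl
    · have h1 := M.frame_smooth α j
      have h2 : ContMDiff 𝓘(ℝ, ℝ) 𝓘(ℝ, ℝ).tangent ∞
          (fun t : ℝ => (⟨t, (0 : ℝ)⟩ : TangentBundle 𝓘(ℝ, ℝ) ℝ)) :=
        contMDiff_vectorSpace_iff_contDiff.2 contDiff_const
      have h3 := key.comp_contMDiffOn (h1.prodMap (h2.contMDiffOn (s := Set.univ)))
      refine h3.congr ?_
      intro p _
      rw [cylFrame_castSucc]
      rfl
  frame_li α p hp := by
    rw [Fintype.linearIndependent_iff]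
    intro v hv
    rw [cylFrame_sum] at hv
    have h1 := congrArg (fun z : M.E × ℝ => z.1) hv
    have h2 := congrArg (fun z : M.E × ℝ => z.2) hv
    have h3 := Fintype.linearIndependent_iff.1 (M.frame_li α p.1 hp.1) _ h1
    intro k
    exact Fin.lastCases h2 h3 k
  frame_span α p hp := by
    rintro z -
    have h := M.frame_span α p.1 hp.1
      (Submodule.mem_top (x := (Prod.fst (show M.E × ℝ from z) : TangentSpace M.I p.1)))
    obtain ⟨c, hc⟩ := (Submodule.mem_span_range_iff_exists_fun ℝ).1 h
    refine (Submodule.mem_span_range_iff_exists_fun ℝ).2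
      ⟨Fin.snoc (α := fun _ => ℝ) c (Prod.snd (show M.E × ℝ from z)), ?_⟩
    rw [cylFrame_sum]
    simp only [Fin.snoc_castSucc, Fin.snoc_last]
    exact Prod.ext hc rfl
  g α β p := incl n (M.g α β p.1)
  g_spin α β p hp := incl_mem_spin n (M.g_spin α β p.1 ⟨hp.1.1, hp.2.1⟩)
  g_smooth α β l := by
    have h := M.g_smooth α β (l ∘ₗ (incl n).toLinearMap)
    exact h.comp (contMDiff_fst.contMDiffOn) (fun p hp => ⟨hp.1.1, hp.2.1⟩)
  g_cocycle α β γ p hp := by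
    rw [← map_mul, M.g_cocycle α β γ p.1 ⟨⟨hp.1.1.1, hp.1.2.1⟩, hp.2.1⟩]
  g_frame α β p hp v := by
    have hx : p.1 ∈ M.U α ∩ M.U β := ⟨hp.1.1, hp.2.1⟩
    obtain ⟨w, hw, hs⟩ := M.g_frame α β p.1 hx (fun k => v k.castSucc)
    have hsnoc : ∀ (u : Fin n → ℝ) (t : ℝ), (Fin.snoc (α := fun _ => ℝ) u t) =
        Fin.snoc (α := fun _ => ℝ) u 0 + Pi.single (Fin.last n) t := by
      intro u t
      funext i
      refine Fin.lastCases ?_ (fun j => ?_) i <;> simp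
    have hv : v = Fin.snoc (α := fun _ => ℝ) (fun k => v k.castSucc) (v (Fin.last n)) := by
      funext i
      refine Fin.lastCases ?_ (fun j => ?_) i <;> simp
    refine ⟨Fin.snoc (α := fun _ => ℝ) w (v (Fin.last n)), ?_, ?_⟩
    · conv_rhs => rw [hv]
      rw [hsnoc w, hsnoc (fun k => v k.castSucc), map_add, map_add, ← incl_vec, ← incl_vec, mul_add, add_mul,
        spin_conj_incl_last n _ (M.g_spin α β p.1 hx), hw, map_mul, map_mul, star_incl]
    · rw [cylFrame_sum, cylFrame_sum]
      simp only [Fin.snoc_castSucc, Fin.snoc_last]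
      exact Prod.ext hs rfl

open Classical in
/-- The coefficient of the tangent vector `z` at `x ∈ U α` with respect to the `b`-th element of
the frame `α`; it is `⟨z, e_b⟩` because the frame is orthonormal. -/
def coeff (M : SpinManifold.{u} n) (α : M.A) (b : Fin n) (x : M.X) (z : TangentSpace M.I x) : ℝ :=
  if h : x ∈ M.U α then
    (Module.Basis.mk (M.frame_li α x h) (M.frame_span α x h)).repr z b
  else 0

/-- `⟨[e_k, e_a], e_b⟩` for the frame `α`. -/
def bracketCoeff (M : SpinManifold.{u} n) (α : M.A) (k a b : Fin n) (x : M.X) : ℝ :=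
  M.coeff α b x (VectorField.mlieBracket M.I (M.frame α k) (M.frame α a) x)

/-- The coefficients `⟨∇_{e_k} e_a, e_b⟩` of the Levi-Civita connection in the orthonormal frame
`α`, by the Koszul formula. -/
def christoffel (M : SpinManifold.{u} n) (α : M.A) (k a b : Fin n) (x : M.X) : ℝ :=
  (1 / 2) * (M.bracketCoeff α k a b x - M.bracketCoeff α a b k x + M.bracketCoeff α b k a x)

end SpinManifold

/-! ## Spinor modules and their structures -/

section Modules

variable {n : ℕ} {V : Type v} [NormedAddCommGroup V] [InnerProductSpace ℝ V]

/-- `V` is the irreducible representation `Δ_n` (for `n ≡ 3, 7` mod 8: `Δ_n^+`, on which `ω_n` acts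
as `1`) of `Cℓ_n`, viewed as a real representation, with an invariant metric. Its restriction to
`Spin(n)` is the spinor representation `Σ_n`. -/
structure SpinorModule (n : ℕ) (V : Type v) [NormedAddCommGroup V] [InnerProductSpace ℝ V] where
  ρ : Cl n →ₐ[ℝ] Module.End ℝ V
  nontrivial : Nontrivial V
  irreducible : ∀ U : Submodule ℝ V, (∀ a : Cl n, ∀ v ∈ U, ρ a v ∈ U) → U = ⊥ ∨ U = ⊤
  isometric : ∀ (k : Fin n) (v : V), ‖ρ (e k) v‖ = ‖v‖
  positive : n % 4 = 3 → ρ (vol n) = 1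

namespace SpinorModule

/-- The action of `ω_n`. -/
def om (S : SpinorModule n V) : Module.End ℝ V := S.ρ (vol n)

/-- `f` commutes with the action of `Spin(n)`. -/
def CommutesWithSpin (S : SpinorModule n V) (f : Module.End ℝ V) : Prop :=
  ∀ g ∈ Spin n, f * S.ρ g = S.ρ g * f

/-- For `n ≡ 1`: `σ` is a real structure on the complex representation `(Σ_n, I)` of `Spin(n)`,
where `I = ρ(ω_n)`. -/
structure IsRealStructure (S : SpinorModule n V) (σ : Module.End ℝ V) : Prop where
  involutive : σ * σ = 1
  antilinear : σ * S.om = -(S.om * σ)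
  spin : S.CommutesWithSpin σ

/-- For `n ≡ 2, 3, 4`: `I, J` is a quaternionic structure on the representation `Δ_n`. -/
structure IsQuaternionic (S : SpinorModule n V) (I J : Module.End ℝ V) : Prop where
  I_sq : I * I = -1
  J_sq : J * J = -1
  anticomm : I * J = -(J * I)
  I_clifford : ∀ a : Cl n, I * S.ρ a = S.ρ a * I
  J_clifford : ∀ a : Cl n, J * S.ρ a = S.ρ a * J

/-- `I, J` is a quaternionic structure on the representation `Σ_n` of `Spin(n)`. -/
structure IsSpinQuaternionic (S : SpinorModule n V) (I J : Module.End ℝ V) : Prop where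
  I_sq : I * I = -1
  J_sq : J * J = -1
  anticomm : I * J = -(J * I)
  I_spin : S.CommutesWithSpin I
  J_spin : S.CommutesWithSpin J

/-- `I` is a complex structure on the representation `Σ_n` of `Spin(n)`. -/
structure IsSpinComplex (S : SpinorModule n V) (I : Module.End ℝ V) : Prop where
  I_sq : I * I = -1
  I_spin : S.CommutesWithSpin I

/-- The structures on `Σ_n` depending on `n` modulo 8. For `n ≡ 5` the complex structure is
`I = ρ(ω_n)`, and for `n ≡ 6` it is `I = -ρ(ω_n)`. -/
def HasStructures (S : SpinorModule n V) : Prop :=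
  (n % 8 = 1 → ∃ σ, S.IsRealStructure σ) ∧
  (n % 8 = 2 ∨ n % 8 = 3 ∨ n % 8 = 4 → ∃ I J, S.IsQuaternionic I J) ∧
  (n % 8 = 5 → ∃ J, S.IsSpinQuaternionic S.om J) ∧
  (n % 8 = 6 → S.IsSpinComplex (-S.om))

/-- For `n ≡ 0, 4`: the half-spinors `Σ_n^+`, the `1`-eigenspace of `ω_n`. -/
def pos (S : SpinorModule n V) : Submodule ℝ V := LinearMap.ker (S.om - 1)

/-- For `n ≡ 0, 4`: the half-spinors `Σ_n^-`, the `(-1)`-eigenspace of `ω_n`. -/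
def neg (S : SpinorModule n V) : Submodule ℝ V := LinearMap.ker (S.om + 1)

end SpinorModule

/-! ## The intertwining formulas -/

variable {W : Type w} [NormedAddCommGroup W] [InnerProductSpace ℝ W]

/-- Multiplication by `i` on `ℂ`. -/
def mulI : ℂ →ₗ[ℝ] ℂ := LinearMap.mulLeft ℝ Complex.I

/-- Complex conjugation. -/
def conjC : ℂ →ₗ[ℝ] ℂ := Complex.conjAe.toLinearMap

/-- The endomorphism of `V ⊕ V` (orthogonal direct sum) with block matrix `(a b; c d)`. -/
def block (a b c d : Module.End ℝ V) : Module.End ℝ (WithLp 2 (V × V)) :=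
  (WithLp.linearEquiv 2 ℝ (V × V)).symm.conj
    ((a.coprod b).prod (c.coprod d))

/-- `n ≡ 0`: `Σ_n ⊗ ℂ → Σ_{n+1}`. -/
structure Intertwines0 (S : SpinorModule n V) (T : SpinorModule (n + 1) W) (σ : Module.End ℝ W)
    (Φ : V ⊗[ℝ] ℂ →ₗ[ℝ] W) : Prop where
  spin : ∀ g ∈ Spin n, T.ρ (incl n g) ∘ₗ Φ = Φ ∘ₗ TensorProduct.map (S.ρ g) LinearMap.id
  complex : T.om ∘ₗ Φ = Φ ∘ₗ TensorProduct.map LinearMap.id mulI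
  real : σ ∘ₗ Φ = Φ ∘ₗ TensorProduct.map LinearMap.id conjC
  clifford : ∀ k : Fin n,
    T.ρ (e k.castSucc) ∘ₗ Φ = Φ ∘ₗ TensorProduct.map (S.ρ (vol n * e k)) mulI
  clifford_last :
    T.ρ (e (Fin.last n)) ∘ₗ Φ = Φ ∘ₗ TensorProduct.map (S.ρ (vol n)) mulI

/-- `n ≡ 1`: `Σ_n ⊕ Σ_n → Σ_{n+1}`. -/
structure Intertwines1 (S : SpinorModule n V) (T : SpinorModule (n + 1) W) (σ : Module.End ℝ V)
    (I J : Module.End ℝ W) (Φ : WithLp 2 (V × V) →ₗ[ℝ] W) : Prop where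
  spin : ∀ g ∈ Spin n, T.ρ (incl n g) ∘ₗ Φ = Φ ∘ₗ block (S.ρ g) 0 0 (S.ρ g)
  complex : I ∘ₗ Φ = Φ ∘ₗ block S.om 0 0 S.om
  clifford : ∀ k : Fin n,
    T.ρ (e k.castSucc) ∘ₗ Φ = Φ ∘ₗ block (S.ρ (e k)) 0 0 (-S.ρ (e k))
  clifford_last : T.ρ (e (Fin.last n)) ∘ₗ Φ = Φ ∘ₗ block 0 1 (-1) 0
  quaternionic : J ∘ₗ Φ = Φ ∘ₗ block 0 σ (-σ) 0

/-- `n ≡ 2`: `Σ_n → Σ_{n+1}`. -/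
structure Intertwines2 (S : SpinorModule n V) (T : SpinorModule (n + 1) W)
    (I J : Module.End ℝ V) (I' J' : Module.End ℝ W) (Φ : V →ₗ[ℝ] W) : Prop where
  spin : ∀ g ∈ Spin n, T.ρ (incl n g) ∘ₗ Φ = Φ ∘ₗ S.ρ g
  linear_I : I' ∘ₗ Φ = Φ ∘ₗ I
  linear_J : J' ∘ₗ Φ = Φ ∘ₗ J
  clifford : ∀ k : Fin n, T.ρ (e k.castSucc) ∘ₗ Φ = Φ ∘ₗ S.ρ (e k)
  clifford_last : T.ρ (e (Fin.last n)) ∘ₗ Φ = -(Φ ∘ₗ S.om)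

/-- `n ≡ 7` (and `n ≡ 3`, without quaternionic structures): the pair `Σ_n → Σ_{n+1}^±`. -/
structure Intertwines7 (S : SpinorModule n V) (T : SpinorModule (n + 1) W)
    (Φp : V →ₗ[ℝ] T.pos) (Φm : V →ₗ[ℝ] T.neg) : Prop where
  spin_pos : ∀ g ∈ Spin n, ∀ v, T.ρ (incl n g) (Φp v) = Φp (S.ρ g v)
  spin_neg : ∀ g ∈ Spin n, ∀ v, T.ρ (incl n g) (Φm v) = Φm (S.ρ g v)
  clifford_pos : ∀ (k : Fin n) (v : V), T.ρ (e k.castSucc) (Φp v) = Φm (S.ρ (e k) v)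
  clifford_neg : ∀ (k : Fin n) (v : V), T.ρ (e k.castSucc) (Φm v) = Φp (S.ρ (e k) v)
  clifford_last_pos : ∀ v : V, T.ρ (e (Fin.last n)) (Φp v) = Φm v
  clifford_last_neg : ∀ v : V, T.ρ (e (Fin.last n)) (Φm v) = -(Φp v : W)

/-- `n ≡ 3`: the pair `Σ_n → Σ_{n+1}^±`. -/
structure Intertwines3 (S : SpinorModule n V) (T : SpinorModule (n + 1) W)
    (I J : Module.End ℝ V) (I' J' : Module.End ℝ W)
    (Φp : V →ₗ[ℝ] T.pos) (Φm : V →ₗ[ℝ] T.neg) : Prop extends Intertwines7 S T Φp Φm where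
  linear_I_pos : ∀ v : V, I' (Φp v) = Φp (I v)
  linear_J_pos : ∀ v : V, J' (Φp v) = Φp (J v)
  linear_I_neg : ∀ v : V, I' (Φm v) = Φm (I v)
  linear_J_neg : ∀ v : V, J' (Φm v) = Φm (J v)

/-- `n ≡ 4`: `Σ_n → Σ_{n+1}`. The map is quaternionic for the structure `I, J ∘ ρ(ω_n)` on `Σ_n`,
that is, for `Σ_n^+ ⊕ (Σ_n^-)^⋄`, where `⋄` reverses the sign of `J`. -/
structure Intertwines4 (S : SpinorModule n V) (T : SpinorModule (n + 1) W)
    (I J : Module.End ℝ V) (I' J' : Module.End ℝ W) (Φ : V →ₗ[ℝ] W) : Prop where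
  spin : ∀ g ∈ Spin n, T.ρ (incl n g) ∘ₗ Φ = Φ ∘ₗ S.ρ g
  linear_I : I' ∘ₗ Φ = Φ ∘ₗ I
  linear_J : J' ∘ₗ Φ = Φ ∘ₗ J ∘ₗ S.om
  clifford : ∀ k : Fin n, T.ρ (e k.castSucc) ∘ₗ Φ = Φ ∘ₗ S.ρ (e k)
  clifford_last : T.ρ (e (Fin.last n)) ∘ₗ Φ = I' ∘ₗ Φ ∘ₗ S.om

/-- `n ≡ 5`: `Σ_n → Σ_{n+1}`. -/
structure Intertwines5 (S : SpinorModule n V) (T : SpinorModule (n + 1) W)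
    (I J : Module.End ℝ V) (Φ : V →ₗ[ℝ] W) : Prop where
  spin : ∀ g ∈ Spin n, T.ρ (incl n g) ∘ₗ Φ = Φ ∘ₗ S.ρ g
  clifford : ∀ k : Fin n, T.ρ (e k.castSucc * e (Fin.last n)) ∘ₗ Φ = Φ ∘ₗ S.ρ (e k)
  clifford_vol : T.ρ (vol (n + 1)) ∘ₗ Φ = Φ ∘ₗ I
  clifford_last : T.ρ (e (Fin.last n)) ∘ₗ Φ = Φ ∘ₗ J

/-- `n ≡ 6`: `Σ_n → Σ_{n+1}`. -/
structure Intertwines6 (S : SpinorModule n V) (T : SpinorModule (n + 1) W)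
    (I : Module.End ℝ V) (Φ : V →ₗ[ℝ] W) : Prop where
  spin : ∀ g ∈ Spin n, T.ρ (incl n g) ∘ₗ Φ = Φ ∘ₗ S.ρ g
  clifford : ∀ k : Fin n, T.ρ (e k.castSucc) ∘ₗ Φ = Φ ∘ₗ S.ρ (e k)
  clifford_last : T.ρ (e (Fin.last n)) ∘ₗ Φ = Φ ∘ₗ I

end Modules

/-- There is an orthogonal isomorphism with the property `P`, and each linear map with the property
`P` is a real multiple of it. -/
def OrthogonalUnique {A : Type v} {B : Type w} [NormedAddCommGroup A] [InnerProductSpace ℝ A]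
    [NormedAddCommGroup B] [InnerProductSpace ℝ B] (P : (A →ₗ[ℝ] B) → Prop) : Prop :=
  ∃ Φ : A ≃ₗᵢ[ℝ] B, P Φ.toLinearEquiv.toLinearMap ∧
    ∀ Ψ : A →ₗ[ℝ] B, P Ψ → ∃ c : ℝ, Ψ = c • Φ.toLinearEquiv.toLinearMap

/-- The same for pairs of maps, with a common scalar. -/
def OrthogonalUniquePair {A : Type v} {B C : Type w}
    [NormedAddCommGroup A] [InnerProductSpace ℝ A] [NormedAddCommGroup B] [InnerProductSpace ℝ B]
    [NormedAddCommGroup C] [InnerProductSpace ℝ C]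
    (P : (A →ₗ[ℝ] B) → (A →ₗ[ℝ] C) → Prop) : Prop :=
  ∃ (Φp : A ≃ₗᵢ[ℝ] B) (Φm : A ≃ₗᵢ[ℝ] C),
    P Φp.toLinearEquiv.toLinearMap Φm.toLinearEquiv.toLinearMap ∧
    ∀ Ψp Ψm, P Ψp Ψm → ∃ c : ℝ, Ψp = c • Φp.toLinearEquiv.toLinearMap ∧
      Ψm = c • Φm.toLinearEquiv.toLinearMap

/-! ## Dirac operators -/

namespace SpinManifold

variable {n : ℕ} {K : Type v} {V : Type v} {W : Type w}

/-- A family of functions on `X` with values in `K`, one for each local frame; a section of a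
bundle associated to the spin structure is given by its representatives `ψ α` over `U α`. -/
abbrev Local (M : SpinManifold.{u} n) (K : Type v) : Type (max u v) := M.A → M.X → K

/-- Representatives of sections over `X × ℝ` of a bundle pulled back from `X`. -/
abbrev CylLocal (M : SpinManifold.{u} n) (K : Type v) : Type (max u v) := M.A → M.X × ℝ → K

/-- `ψ` represents a smooth section of the bundle associated to the spin structure and the
representation `r` of `Spin(n)`. -/
def IsSection (M : SpinManifold.{u} n) [NormedAddCommGroup K] [NormedSpace ℝ K]
    (r : Cl n → Module.End ℝ K) (ψ : M.Local K) : Prop :=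
  (∀ α, ContMDiffOn M.I 𝓘(ℝ, K) ∞ (ψ α) (M.U α)) ∧
  ∀ α β, ∀ x ∈ M.U α ∩ M.U β, ψ α x = r (M.g α β x) (ψ β x)

/-- `φ` represents a smooth section over `X × ℝ` of the pullback of the bundle on `X` associated to
the spin structure and the representation `r` of `Spin(n)`. -/
def IsCylSection (M : SpinManifold.{u} n) [NormedAddCommGroup K] [NormedSpace ℝ K]
    (r : Cl n → Module.End ℝ K) (φ : M.CylLocal K) : Prop :=
  (∀ α, ContMDiffOn (M.I.prod 𝓘(ℝ, ℝ)) 𝓘(ℝ, K) ∞ (φ α) (M.U α ×ˢ Set.univ)) ∧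
  ∀ α β, ∀ p : M.X × ℝ, p.1 ∈ M.U α ∩ M.U β → φ α p = r (M.g α β p.1) (φ β p)

variable [NormedAddCommGroup V] [InnerProductSpace ℝ V]
  [NormedAddCommGroup W] [InnerProductSpace ℝ W]

/-- The derivative of (the representative of) a spinor in the direction `e_k`. -/
def dirDeriv (M : SpinManifold.{u} n) (ψ : M.Local V) (α : M.A) (k : Fin n) (x : M.X) : V :=
  mfderiv M.I 𝓘(ℝ, V) (ψ α) x (M.frame α k x)

/-- The covariant derivative `∇_{e_k} ψ` of a spinor in the frame `α`: the connection induced by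
the Levi-Civita connection. -/
def covDeriv (M : SpinManifold.{u} n) (S : SpinorModule n V) (ψ : M.Local V) (α : M.A) (k : Fin n)
    (x : M.X) : V :=
  M.dirDeriv ψ α k x +
    (1 / 4 : ℝ) • ∑ a, ∑ b, M.christoffel α k a b x • S.ρ (e a * e b) (ψ α x)

/-- The full real Dirac operator `∑ ρ(e_k) ∇_{e_k}`. -/
def dirac (M : SpinManifold.{u} n) (S : SpinorModule n V) (ψ : M.Local V) : M.Local V :=
  fun α x => ∑ k, S.ρ (e k) (M.covDeriv S ψ α k x)

/-- The skew-adjoint Dirac operator for `n ≡ 1`, on spinors with values in `Σ_n^+`. -/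
def diracSkew1 (M : SpinManifold.{u} n) (S : SpinorModule n V) (ψ : M.Local V) : M.Local V :=
  fun α x => -S.om (M.dirac S ψ α x)

/-- The skew-adjoint Dirac operator for `n ≡ 2`, on spinors with values in `Σ_n^+`. -/
def diracSkew2 (M : SpinManifold.{u} n) (S : SpinorModule n V) (J : Module.End ℝ V)
    (ψ : M.Local V) : M.Local V :=
  fun α x => -J (M.dirac S ψ α x)

/-- `∂/∂t` on `X × ℝ`. -/
def dt (M : SpinManifold.{u} n) (φ : M.CylLocal V) : M.CylLocal V :=
  fun α p => deriv (fun t : ℝ => φ α (p.1, t)) p.2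

/-- An operator on `X`, acting on each slice `X × {t}`. -/
def slice (M : SpinManifold.{u} n) (D : M.Local V → M.Local V) (φ : M.CylLocal V) :
    M.CylLocal V :=
  fun α p => D (fun β y => φ β (y, p.2)) α p.1

/-- `Cyl(D)` for `ℓ ≡ 0`; `D'` is the adjoint of `D`. -/
def cyl0 (M : SpinManifold.{u} n) (D D' : M.Local V → M.Local V) (φ : M.CylLocal (V × V)) :
    M.CylLocal (V × V) :=
  fun α p =>
    (M.dt (fun β q => (φ β q).1) α p + M.slice D' (fun β q => (φ β q).2) α p,
      -M.slice D (fun β q => (φ β q).1) α p - M.dt (fun β q => (φ β q).2) α p)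

/-- `Cyl(D) = σ(∂/∂t + i D_ℂ)` for `ℓ ≡ 1`; the pair `(φ₁, φ₂)` stands for `φ₁ + i φ₂`. -/
def cyl1 (M : SpinManifold.{u} n) (D : M.Local V → M.Local V) (φ : M.CylLocal (V × V)) :
    M.CylLocal (V × V) :=
  fun α p =>
    (M.dt (fun β q => (φ β q).1) α p - M.slice D (fun β q => (φ β q).2) α p,
      -(M.dt (fun β q => (φ β q).2) α p + M.slice D (fun β q => (φ β q).1) α p))

/-- `Cyl(D)` for `ℓ ≡ 2`; the second component lies in the conjugate bundle, on which the scalar `i`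
acts as `-I`. -/
def cyl2 (M : SpinManifold.{u} n) (I : Module.End ℝ V) (D : M.Local V → M.Local V)
    (φ : M.CylLocal (V × V)) : M.CylLocal (V × V) :=
  fun α p =>
    (-I (M.dt (fun β q => (φ β q).1) α p) - M.slice D (fun β q => (φ β q).2) α p,
      M.slice D (fun β q => (φ β q).1) α p + (-I) (M.dt (fun β q => (φ β q).2) α p))

/-- `Cyl(D) = ∂/∂t + D` for `ℓ ≡ 3, 7`. -/
def cyl3 (M : SpinManifold.{u} n) (D : M.Local V → M.Local V) (φ : M.CylLocal V) : M.CylLocal V :=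
  fun α p => M.dt φ α p + M.slice D φ α p

/-- `Cyl(D)` for `ℓ ≡ 4`; `D'` is the adjoint of `D`. -/
def cyl4 (M : SpinManifold.{u} n) (I : Module.End ℝ V) (D D' : M.Local V → M.Local V)
    (φ : M.CylLocal (V × V)) : M.CylLocal (V × V) :=
  fun α p =>
    (I (M.dt (fun β q => (φ β q).1) α p) + M.slice D' (fun β q => (φ β q).2) α p,
      M.slice D (fun β q => (φ β q).1) α p - I (M.dt (fun β q => (φ β q).2) α p))

/-- `Cyl(D) = J(∂/∂t + D)` for `ℓ ≡ 5`. -/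
def cyl5 (M : SpinManifold.{u} n) (J : Module.End ℝ V) (D : M.Local V → M.Local V)
    (φ : M.CylLocal V) : M.CylLocal V :=
  fun α p => J (M.dt φ α p + M.slice D φ α p)

/-- `Cyl(D) = I ∂/∂t + D` for `ℓ ≡ 6`. -/
def cyl6 (M : SpinManifold.{u} n) (I : Module.End ℝ V) (D : M.Local V → M.Local V)
    (φ : M.CylLocal V) : M.CylLocal V :=
  fun α p => I (M.dt φ α p) + M.slice D φ α p

end SpinManifold

/-- Let `r` be a representation of `Spin(n)` on `K` and `F, F' ⊆ K`, `G, G' ⊆ Σ_{n+1}`. On each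
cylinder `Y = X × ℝ`, the maps `θ : F → G` and `θ' : F' → G'` are bijective and identify sections of the
pullback from `X` with spinors on `Y`, and they take the operator `C` on `X × ℝ` to the operator
`L ∘ D_Y`. -/
def IsCylinderOf {n : ℕ} {K : Type v} {W : Type w} [NormedAddCommGroup K] [NormedSpace ℝ K]
    [NormedAddCommGroup W] [InnerProductSpace ℝ W] (r : Cl n → Module.End ℝ K)
    (T : SpinorModule (n + 1) W) (F F' : Set K) (G G' : Set W) (θ θ' : K →ₗ[ℝ] W)
    (L : Module.End ℝ W)
    (C : (M : SpinManifold.{u} n) → M.CylLocal K → M.CylLocal K) : Prop :=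
  Set.BijOn θ F G ∧ Set.BijOn θ' F' G' ∧
  ∀ (M : SpinManifold.{u} n) (φ : M.CylLocal K), M.IsCylSection r φ →
    (∀ α (p : M.X × ℝ), p.1 ∈ M.U α → φ α p ∈ F) →
    M.cylinder.IsSection T.ρ (fun α p => θ (φ α p)) ∧
    ∀ (α : M.A) (p : M.X × ℝ), p.1 ∈ M.U α →
      C M φ α p ∈ F' ∧
      L (M.cylinder.dirac T (fun α p => θ (φ α p)) α p) = θ' (C M φ α p)

/-! ## Dirac operators on cylinders, by residue of `n` modulo 8 -/

section Cylinders

variable {n : ℕ} {V : Type v} {W : Type w} [NormedAddCommGroup V] [InnerProductSpace ℝ V]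
  [NormedAddCommGroup W] [InnerProductSpace ℝ W]

/-- The representation `Σ_n ⊕ Σ_n`. -/
def double (S : SpinorModule n V) (a : Cl n) : Module.End ℝ (V × V) := (S.ρ a).prodMap (S.ρ a)

/-- `n ≡ 0`: `D_Y^skew ∘ Φ⁺ = Φ⁺ ∘ Cyl(D_X^+)` on `Σ_X^+ ⊕ Σ_X^-`, where `Φ⁺(v) = Φ(v ⊗ 1)` has
values in `Σ_Y^+`. -/
def Cylinder0 (S : SpinorModule n V) (T : SpinorModule (n + 1) W) (σ : Module.End ℝ W)
    (Φ : V ⊗[ℝ] ℂ →ₗ[ℝ] W) : Prop :=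
  let θ := Φ ∘ₗ (TensorProduct.mk ℝ V ℂ).flip 1 ∘ₗ LinearMap.coprod LinearMap.id LinearMap.id
  IsCylinderOf.{u} (double S) T (S.pos ×ˢ S.neg) (S.pos ×ˢ S.neg) {w | σ w = w} {w | σ w = w} θ θ
    (-T.om) (fun M => M.cyl0 (M.dirac S) (M.dirac S))

/-- `n ≡ 1`: `D_Y^skew` corresponds to `Cyl(D_X^skew)` under
`Σ_X^+ ⊗ ℂ ≅ Σ_Y^+`, `φ₁ + i φ₂ ↦ Φ(φ, φ)` with `φ = φ₁ + I φ₂`. -/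
def Cylinder1 (S : SpinorModule n V) (T : SpinorModule (n + 1) W) (σ : Module.End ℝ V)
    (I J : Module.End ℝ W) (Φ : WithLp 2 (V × V) →ₗ[ℝ] W) : Prop :=
  let θ := Φ ∘ₗ (WithLp.linearEquiv 2 ℝ (V × V)).symm.toLinearMap ∘ₗ
    (LinearMap.prod LinearMap.id LinearMap.id) ∘ₗ LinearMap.coprod LinearMap.id S.om
  IsCylinderOf.{u} (double S) T ({v | σ v = v} ×ˢ {v | σ v = v}) ({v | σ v = v} ×ˢ {v | σ v = v})
    {w | T.om w = I w} {w | T.om w = I w} θ θ (-J) (fun M => M.cyl1 (M.diracSkew1 S))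

/-- `n ≡ 2`: `D_Y` corresponds to `Cyl(D_X^skew)` under `Σ_X^+ ⊕ conj(Σ_X^+) ≅ Σ_Y`,
`(φ, χ) ↦ Φ(φ + J χ)`. -/
def Cylinder2 (S : SpinorModule n V) (T : SpinorModule (n + 1) W) (I J : Module.End ℝ V)
    (Φ : V →ₗ[ℝ] W) : Prop :=
  let θ := Φ ∘ₗ LinearMap.coprod LinearMap.id J
  IsCylinderOf.{u} (double S) T ({v | S.om v = I v} ×ˢ {v | S.om v = I v})
    ({v | S.om v = I v} ×ˢ {v | S.om v = I v}) Set.univ Set.univ θ θ 1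
    (fun M => M.cyl2 I (M.diracSkew2 S J))

/-- `n ≡ 3, 7`: `D_Y^+ ∘ Φ⁺ = Φ⁻ ∘ Cyl(D_X)`. -/
def Cylinder3 (S : SpinorModule n V) (T : SpinorModule (n + 1) W)
    (Φp : V →ₗ[ℝ] T.pos) (Φm : V →ₗ[ℝ] T.neg) : Prop :=
  IsCylinderOf.{u} (fun a => S.ρ a) T Set.univ Set.univ T.pos T.neg (T.pos.subtype ∘ₗ Φp)
    (T.neg.subtype ∘ₗ Φm) 1 (fun M => M.cyl3 (M.dirac S))

/-- `n ≡ 4`: `D_Y ∘ Φ = Φ ∘ Cyl(D_X^+)` on `Σ_X^+ ⊕ Σ_X^-`. -/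
def Cylinder4 (S : SpinorModule n V) (T : SpinorModule (n + 1) W) (I : Module.End ℝ V)
    (Φ : V →ₗ[ℝ] W) : Prop :=
  let θ := Φ ∘ₗ LinearMap.coprod LinearMap.id LinearMap.id
  IsCylinderOf.{u} (double S) T (S.pos ×ˢ S.neg) (S.pos ×ˢ S.neg) Set.univ Set.univ θ θ 1
    (fun M => M.cyl4 I (M.dirac S) (M.dirac S))

/-- `n ≡ 5`: `D_Y ∘ Φ = Φ ∘ Cyl(D_X)`. -/
def Cylinder5 (S : SpinorModule n V) (T : SpinorModule (n + 1) W) (J : Module.End ℝ V)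
    (Φ : V →ₗ[ℝ] W) : Prop :=
  IsCylinderOf.{u} (fun a => S.ρ a) T Set.univ Set.univ Set.univ Set.univ Φ Φ 1
    (fun M => M.cyl5 J (M.dirac S))

/-- `n ≡ 6`: `D_Y ∘ Φ = Φ ∘ Cyl(D_X)`. -/
def Cylinder6 (S : SpinorModule n V) (T : SpinorModule (n + 1) W) (I : Module.End ℝ V)
    (Φ : V →ₗ[ℝ] W) : Prop :=
  IsCylinderOf.{u} (fun a => S.ρ a) T Set.univ Set.univ Set.univ Set.univ Φ Φ 1
    (fun M => M.cyl6 I (M.dirac S))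

end Cylinders

end RealDirac
end

/-! The algebra is a dimension count. For modules `A`, `B` over `Cl n`, the space of homomorphisms
is the common fixed space in Hom(A, B) of the commuting involutions T_k φ = -e_k φ e_k. If `A` or
`B` carries a twist, an injective map τ anticommuting with every e_k, then composition with τ and
e_k anticommutes with T_k and commutes with the other T_i. Hence each e_k halves the dimension: 2^n
dim Hom = dim A · dim B. Compatibility with a real or quaternionic structure gives one or two
further halvings.

In each residue class the formulas for Φ say that Φ is a homomorphism, compatible with the given
structures, into Σ_{n+1} from an explicit module built from Σ_n (for n ≡ 2, 6 already a homomorphism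
over `Cl n`); the other conditions follow. If the dimensions are as expected, the space of such Φ is
a line. By irreducibility a nonzero element is bijective. Since the e_k act by skew maps, Φ Φ*
commutes with an irreducible action or is carried to such a map, so it is a scalar and Φ is a
multiple of an isometry. This is existence and uniqueness at once.

The dimensions and structures of irreducible modules come from models (`exists_model`), built
inductively with the same extension formulas. The count identifies the endomorphisms of a model with
ℝ, ℂ or ℍ, so nonzero ones are injective; it also gives nonzero maps both ways between the model and
an irreducible module, which are therefore isomorphic (`IsIrr.isModel`). For n ≡ 3 mod 4 no twist
exists on Δ_n^+, but there e_n = -ω_{n-1}, and everything reduces to `Cl (n - 1)`.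

The geometry is one computation. Frame fields of X do not depend on t, so all Koszul coefficients of
the cylinder with an index n+1 vanish and the others are those of X. Thus D_Y applied to a spinor
θ(φ) is the sum of e_k θ ∇_k φ and e_{n+1} θ ∂_t φ (`dirac_cylinder`). Inserting the formulas for Φ
and splitting by eigenspaces gives the matrices. -/

namespace RealDirac

/-! ### Signs, parity and generators in the Clifford algebra -/

section CliffordFacts

open CliffordAlgebra

theorem vec_mul_vec_add_swap (n : ℕ) (x y : Fin n → ℝ) :
    vec n x * vec n y + vec n y * vec n x = algebraMap ℝ _ (-2 * ∑ i, x i * y i) := by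
  unfold vec
  rw [ι_mul_ι_add_swap]
  congr 1
  simp only [QuadraticMap.polar, cliffordForm, QuadraticMap.weightedSumSquares_apply, Pi.add_apply,
    ← Finset.sum_sub_distrib, Finset.mul_sum, smul_eq_mul]
  exact Finset.sum_congr rfl fun i _ => by ring

theorem e_mul_self {n : ℕ} (k : Fin n) : (e k : Cl n) * e k = -1 := by
  have h := ι_sq_scalar (cliffordForm n) (Pi.single k 1)
  rw [e, vec, h, ← map_one (algebraMap ℝ (Cl n)), ← map_neg]
  congr 1
  simp [cliffordForm, QuadraticMap.weightedSumSquares_apply, Pi.single_apply]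

theorem e_mul_e {n : ℕ} {k l : Fin n} (h : k ≠ l) : (e k : Cl n) * e l = -(e l * e k) := by
  rw [eq_neg_iff_add_eq_zero, e, e, vec_mul_vec_add_swap]
  simp [Pi.single_apply, Ne.symm h]

theorem incl_e {n : ℕ} (k : Fin n) : incl n (e k) = e k.castSucc := by
  rw [e, incl_vec, e]
  congr 1
  funext i
  refine Fin.lastCases ?_ (fun j => ?_) i
  · simp [Fin.ext_iff, k.isLt.ne']
  · simp [Pi.single_apply]

theorem vol_zero : vol 0 = 1 := by simp [vol]

theorem vol_succ (n : ℕ) : vol (n + 1) = incl n (vol n) * e (Fin.last n) := by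
  rw [vol, List.ofFn_succ', List.concat_eq_append, List.prod_append, List.prod_singleton, vol,
    map_list_prod, List.map_ofFn]
  congr 3
  funext k
  exact (incl_e k).symm

theorem e_last_mul_incl (n : ℕ) (a : Cl n) :
    e (Fin.last n) * incl n a = incl n (involute a) * e (Fin.last n) :=
  vec_last_mul_incl n 1 a

theorem involute_e {n : ℕ} (k : Fin n) : involute (e k : Cl n) = -e k := involute_ι _

theorem involute_vol (n : ℕ) : involute (vol n) = (-1 : ℝ) ^ n • vol n := by
  induction n with
  | zero => simp [vol_zero]
  | succ n ih =>
    rw [vol_succ, map_mul, involute_incl, ih, involute_e, map_smul, pow_succ]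
    simp

/-- e_k passes n - 1 factors with a sign and itself without one. The exponent n + 1 has the parity
of n - 1 and avoids truncated subtraction. -/
theorem vol_mul_e (n : ℕ) (k : Fin n) : vol n * e k = (-1 : ℝ) ^ (n + 1) • (e k * vol n) := by
  induction n with
  | zero => exact k.elim0
  | succ n ih =>
    have hs : (-1 : ℝ) ^ n * (-1 : ℝ) ^ n = 1 := by rw [← mul_pow]; simp
    refine Fin.lastCases ?_ (fun j => ?_) k
    · rw [vol_succ, ← mul_assoc (e _), e_last_mul_incl, involute_vol, map_smul, smul_mul_assoc,
        smul_mul_assoc, smul_smul, pow_add, pow_add]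
      simp [hs]
    · rw [← incl_e, vol_succ, mul_assoc, e_last_mul_incl, involute_e, map_neg, neg_mul, mul_neg,
        ← mul_assoc, ← mul_assoc, ← map_mul, ih, map_smul, map_mul, smul_mul_assoc, pow_succ _ (n + 1)]
      simp

/-- In the induction, moving e_{n+1} through ω_n costs (-1)^n and its square gives -1, so the
exponent grows by n + 1. -/
theorem vol_mul_self (n : ℕ) : vol n * vol n = (-1 : ℝ) ^ (n * (n + 1) / 2) • (1 : Cl n) := by
  induction n with
  | zero => simp [vol_zero]
  | succ n ih =>
    have h2 : (n + 1) * (n + 1 + 1) / 2 = n * (n + 1) / 2 + (n + 1) := by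
      rw [show (n + 1) * (n + 1 + 1) = n * (n + 1) + (n + 1) * 2 by ring,
        Nat.add_mul_div_right _ _ two_pos]
    rw [vol_succ, mul_assoc, ← mul_assoc (e _), e_last_mul_incl, involute_vol, mul_assoc,
      e_mul_self, ← mul_assoc, ← map_mul, mul_smul_comm, ih, h2, pow_add, pow_succ, smul_smul,
      map_smul, map_one]
    simp [mul_comm]

theorem vol_mul_e_even {n : ℕ} (hn : Even n) (k : Fin n) : vol n * e k = -(e k * vol n) := by
  rw [vol_mul_e, hn.add_one.neg_one_pow]; simp

theorem vol_mul_e_odd {n : ℕ} (hn : Odd n) (k : Fin n) : vol n * e k = e k * vol n := by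
  rw [vol_mul_e, hn.add_one.neg_one_pow]; simp

theorem vol_sq_pos {n : ℕ} (hn : n % 4 = 0 ∨ n % 4 = 3) : vol n * vol n = 1 := by
  have : Even (n * (n + 1) / 2) := by
    rcases hn with h | h
    · obtain ⟨m, rfl⟩ : ∃ m, n = 4 * m := ⟨n / 4, by omega⟩
      rw [show 4 * m * (4 * m + 1) = (2 * (m * (4 * m + 1))) * 2 by ring, Nat.mul_div_cancel _ two_pos]
      exact even_two_mul _
    · obtain ⟨m, rfl⟩ : ∃ m, n = 4 * m + 3 := ⟨n / 4, by omega⟩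
      rw [show (4 * m + 3) * (4 * m + 3 + 1) = (2 * ((4 * m + 3) * (m + 1))) * 2 by ring,
        Nat.mul_div_cancel _ two_pos]
      exact even_two_mul _
  rw [vol_mul_self, this.neg_one_pow, one_smul]

theorem vol_sq_neg {n : ℕ} (hn : n % 4 = 1 ∨ n % 4 = 2) : vol n * vol n = -1 := by
  have : Odd (n * (n + 1) / 2) := by
    rcases hn with h | h
    · obtain ⟨m, rfl⟩ : ∃ m, n = 4 * m + 1 := ⟨n / 4, by omega⟩
      rw [show (4 * m + 1) * (4 * m + 1 + 1) = ((4 * m + 1) * (2 * m + 1)) * 2 by ring,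
        Nat.mul_div_cancel _ two_pos]
      exact Odd.mul ⟨2 * m, by ring⟩ ⟨m, rfl⟩
    · obtain ⟨m, rfl⟩ : ∃ m, n = 4 * m + 2 := ⟨n / 4, by omega⟩
      rw [show (4 * m + 2) * (4 * m + 2 + 1) = ((2 * m + 1) * (4 * m + 3)) * 2 by ring,
        Nat.mul_div_cancel _ two_pos]
      exact Odd.mul ⟨m, rfl⟩ ⟨2 * m + 1, by ring⟩
  rw [vol_mul_self, this.neg_one_pow, neg_smul, one_smul]

theorem vec_eq_sum {n : ℕ} (x : Fin n → ℝ) : vec n x = ∑ k, x k • e k := by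
  conv_lhs => rw [pi_eq_sum_univ' x]
  rw [map_sum]
  refine Finset.sum_congr rfl fun k _ => ?_
  rw [map_smul, e]

/-- Every element of the Clifford algebra is obtained from the `e_k`. -/
theorem cl_induction {n : ℕ} {P : Cl n → Prop} (h1 : P 1) (he : ∀ k, P (e k))
    (hmul : ∀ a b, P a → P b → P (a * b)) (hadd : ∀ a b, P a → P b → P (a + b))
    (hsmul : ∀ (r : ℝ) a, P a → P (r • a)) (a : Cl n) : P a := by
  induction a using CliffordAlgebra.induction with
  | algebraMap r => rw [Algebra.algebraMap_eq_smul_one]; exact hsmul r 1 h1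
  | ι x =>
    have h0 : P 0 := by simpa using hsmul 0 1 h1
    have hx := vec_eq_sum x
    unfold vec at hx
    rw [hx]
    exact Finset.sum_induction _ P hadd h0 fun k _ => hsmul _ _ (he k)
  | mul a b ha hb => exact hmul a b ha hb
  | add a b ha hb => exact hadd a b ha hb

/-- The products e_k e_l suffice as generators, so equivariance under the even part can be tested on
maps that intertwine no single vector. -/
theorem even_cl_induction {n : ℕ} {P : Cl n → Prop} (h1 : P 1)
    (he : ∀ k l, P (e k * e l))
    (hmul : ∀ a b, P a → P b → P (a * b)) (hadd : ∀ a b, P a → P b → P (a + b))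
    (hsmul : ∀ (r : ℝ) a, P a → P (r • a)) (a : Cl n) (ha : a ∈ even (cliffordForm n)) : P a := by
  have h0 : P 0 := by simpa using hsmul 0 1 h1
  induction a, ha using CliffordAlgebra.even_induction with
  | algebraMap r => rw [Algebra.algebraMap_eq_smul_one]; exact hsmul r 1 h1
  | add x y hx hy ihx ihy => exact hadd _ _ ihx ihy
  | ι_mul_ι_mul x y a ha ih =>
    refine hmul _ _ ?_ ih
    have hx := vec_eq_sum x
    have hy := vec_eq_sum y
    unfold vec at hx hy
    rw [hx, hy, Finset.sum_mul]
    refine Finset.sum_induction _ P hadd h0 fun k _ => ?_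
    rw [Finset.mul_sum]
    refine Finset.sum_induction _ P hadd h0 fun l _ => ?_
    rw [smul_mul_smul_comm]
    exact hsmul _ _ (he k l)

theorem e_mul_e_mem_even {n : ℕ} (k l : Fin n) : (e k * e l : Cl n) ∈ even (cliffordForm n) :=
  ι_mul_ι_mem_evenOdd_zero _ _ _

/-- Any list of indices is allowed, so that the induction stays inside one algebra. -/
theorem list_prod_e_mem_evenOdd {n : ℕ} (l : List (Fin n)) :
    (l.map e).prod ∈ evenOdd (cliffordForm n) (l.length : ZMod 2) := by
  induction l with
  | nil => simpa using Submodule.one_le.1 (one_le_evenOdd_zero (cliffordForm n))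
  | cons k l ih =>
    rw [List.map_cons, List.prod_cons, List.length_cons, Nat.cast_succ, add_comm]
    exact evenOdd_mul_le _ _ _ (Submodule.mul_mem_mul (ι_mem_evenOdd_one _ _) ih)

theorem vol_mem_evenOdd (n : ℕ) : vol n ∈ evenOdd (cliffordForm n) (n : ZMod 2) := by
  have h := list_prod_e_mem_evenOdd (List.ofFn (fun k : Fin n => k))
  rwa [List.map_ofFn, List.length_ofFn] at h

theorem vol_mem_even {n : ℕ} (hn : Even n) : vol n ∈ even (cliffordForm n) := by
  have h := vol_mem_evenOdd n
  rwa [(ZMod.natCast_eq_zero_iff_even).2 hn] at h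

/-- For odd n the volume element is odd, but this product is even. Knowing how a map behaves on the
even part and on ω_n thus determines how it behaves on vectors, and conversely. -/
theorem e_mul_vol_mem_even {n : ℕ} (hn : Odd n) (k : Fin n) :
    e k * vol n ∈ even (cliffordForm n) := by
  have h := evenOdd_mul_le _ _ _
    (Submodule.mul_mem_mul (ι_mem_evenOdd_one (cliffordForm n) (Pi.single k 1)) (vol_mem_evenOdd n))
  rwa [(ZMod.natCast_eq_one_iff_odd).2 hn] at h

/-- `Spin n` contains generators of the even subalgebra, so equivariance under `Spin n` is the same
as equivariance under the even subalgebra. -/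
theorem e_mul_e_mem_spin {n : ℕ} (k l : Fin n) : (e k * e l : Cl n) ∈ Spin n := by
  refine spinGroup.mem_iff.2 ⟨pinGroup.mem_iff.2 ⟨?_, ?_⟩, e_mul_e_mem_even k l⟩
  · let u : Fin n → (Cl n)ˣ := fun k => ⟨e k, -e k, by simp [e_mul_self], by simp [e_mul_self]⟩
    refine ⟨u k * u l, ?_, rfl⟩
    refine Subgroup.mul_mem _ ?_ ?_
    · exact Subgroup.subset_closure ⟨Pi.single k 1, rfl⟩
    · exact Subgroup.subset_closure ⟨Pi.single l 1, rfl⟩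
  · have hs : ∀ k : Fin n, star (e k : Cl n) = -e k := fun k => star_ι _
    refine ⟨?_, ?_⟩
    · rw [star_mul, hs, hs, neg_mul_neg, mul_assoc, ← mul_assoc (e k), e_mul_self]
      simp [e_mul_self]
    · rw [star_mul, hs, hs, neg_mul_neg, mul_assoc, ← mul_assoc (e l), e_mul_self]
      simp [e_mul_self]

end CliffordFacts
-- Dimensions of spaces of intertwiners
section Counting

open Module

/-- If an involution `T` of `E` anticommutes with an injective endomorphism of `E`, its fixed space
has half the dimension. -/
theorem two_mul_finrank_fixed {H : Type*} [AddCommGroup H] [Module ℝ H] [FiniteDimensional ℝ H]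
    (E F : Submodule ℝ H) (T R : End ℝ H) (hF : ∀ x, x ∈ F ↔ T x = x)
    (hT : ∀ x ∈ E, T x ∈ E) (hTT : ∀ x ∈ E, T (T x) = x) (hR : ∀ x ∈ E, R x ∈ E)
    (hinj : Function.Injective R) (hTR : ∀ x ∈ E, T (R x) = -R (T x)) :
    2 * finrank ℝ ↥(E ⊓ F) = finrank ℝ E := by
  let G : Submodule ℝ H := LinearMap.ker (T + 1)
  have hG : ∀ x, x ∈ G ↔ T x = -x := fun x => by
    simp [G, eq_neg_iff_add_eq_zero]
  -- `E` splits into the (+1)- and (-1)-eigenspaces of `T`, with projections (x ± Tx)/2.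
  have h1 : (E ⊓ F) ⊔ (E ⊓ G) = E := by
    refine le_antisymm (sup_le inf_le_left inf_le_left) fun x hx => ?_
    refine Submodule.mem_sup.2 ⟨(1 / 2 : ℝ) • (x + T x), ⟨E.smul_mem _ (E.add_mem hx (hT x hx)), ?_⟩,
      (1 / 2 : ℝ) • (x - T x), ⟨E.smul_mem _ (E.sub_mem hx (hT x hx)), ?_⟩, by module⟩
    · rw [SetLike.mem_coe, hF, map_smul, map_add, hTT x hx, add_comm]
    · rw [SetLike.mem_coe, hG, map_smul, map_sub, hTT x hx]; module
  have h2 : (E ⊓ F) ⊓ (E ⊓ G) = ⊥ := by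
    rw [eq_bot_iff]
    rintro x ⟨⟨-, hx⟩, -, hx'⟩
    have h := ((hF x).1 hx).symm.trans ((hG x).1 hx')
    rw [Submodule.mem_bot]
    have h' : (2 : ℝ) • x = 0 := by rw [two_smul]; nth_rewrite 1 [h]; simp
    simpa using h'
  -- `R` maps each eigenspace injectively into the other, so the two have equal dimension.
  have h3 : ∀ P Q : Submodule ℝ H, P.map R ≤ Q → finrank ℝ P ≤ finrank ℝ Q := fun P Q h =>
    (LinearEquiv.finrank_eq (Submodule.equivMapOfInjective R hinj P)).le.trans
      (Submodule.finrank_mono h)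
  have h4 := h3 (E ⊓ F) (E ⊓ G) (by
    rintro _ ⟨x, ⟨hx, hx'⟩, rfl⟩
    refine ⟨hR x hx, (hG _).2 ?_⟩
    rw [hTR x hx, (hF x).1 hx'])
  have h5 := h3 (E ⊓ G) (E ⊓ F) (by
    rintro _ ⟨x, ⟨hx, hx'⟩, rfl⟩
    refine ⟨hR x hx, (hF _).2 ?_⟩
    rw [hTR x hx, (hG x).1 hx', map_neg, neg_neg])
  have h6 := Submodule.finrank_sup_add_finrank_inf_eq (E ⊓ F) (E ⊓ G)
  rw [h1, h2, finrank_bot] at h6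
  omega

variable {n : ℕ} {A : Type v} {B : Type w} [AddCommGroup A] [Module ℝ A] [AddCommGroup B]
  [Module ℝ B]

/-- The linear maps that intertwine two endomorphisms. -/
def inter (f : End ℝ A) (g : End ℝ B) : Submodule ℝ (A →ₗ[ℝ] B) where
  carrier := {φ | ∀ x, g (φ x) = φ (f x)}
  add_mem' h h' x := by simp [h x, h' x]
  zero_mem' x := by simp
  smul_mem' c φ h x := by simp [h x]

theorem mem_inter {f : End ℝ A} {g : End ℝ B} {φ : A →ₗ[ℝ] B} :
    φ ∈ inter f g ↔ ∀ x, g (φ x) = φ (f x) := Iff.rfl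

/-- The homomorphisms of `Cℓ_n`-modules. -/
def clHom (ρ : Cl n →ₐ[ℝ] End ℝ A) (ρ' : Cl n →ₐ[ℝ] End ℝ B) : Submodule ℝ (A →ₗ[ℝ] B) :=
  ⨅ k, inter (ρ (e k)) (ρ' (e k))

theorem mem_clHom {ρ : Cl n →ₐ[ℝ] End ℝ A} {ρ' : Cl n →ₐ[ℝ] End ℝ B} {φ : A →ₗ[ℝ] B} :
    φ ∈ clHom ρ ρ' ↔ ∀ k x, ρ' (e k) (φ x) = φ (ρ (e k) x) := by
  simp [clHom, mem_inter]

theorem clHom_apply {ρ : Cl n →ₐ[ℝ] End ℝ A} {ρ' : Cl n →ₐ[ℝ] End ℝ B} {φ : A →ₗ[ℝ] B}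
    (h : φ ∈ clHom ρ ρ') (a : Cl n) (x : A) : ρ' a (φ x) = φ (ρ a x) := by
  induction a using cl_induction generalizing x with
  | h1 => simp
  | he k => exact mem_clHom.1 h k x
  | hmul a b ha hb => simp only [map_mul, End.mul_apply, ha, hb]
  | hadd a b ha hb => simp only [map_add, LinearMap.add_apply, ha, hb]
  | hsmul r a ha => simp only [map_smul, LinearMap.smul_apply, ha]

theorem even_apply {ρ : Cl n →ₐ[ℝ] End ℝ A} {ρ' : Cl n →ₐ[ℝ] End ℝ B} {φ : A →ₗ[ℝ] B}
    (h : ∀ k l x, ρ' (e k * e l) (φ x) = φ (ρ (e k * e l) x)) {a : Cl n}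
    (ha : a ∈ CliffordAlgebra.even (cliffordForm n)) (x : A) : ρ' a (φ x) = φ (ρ a x) := by
  refine even_cl_induction (P := fun a => ∀ x, ρ' a (φ x) = φ (ρ a x)) ?_ h ?_ ?_ ?_ a ha x
  · simp
  · intro a b ha hb x
    simp only [map_mul, End.mul_apply, ha, hb]
  · intro a b ha hb x
    simp only [map_add, LinearMap.add_apply, ha, hb]
  · intro r a ha x
    simp only [map_smul, LinearMap.smul_apply, ha]

theorem rho_e_sq (ρ : Cl n →ₐ[ℝ] End ℝ A) (k : Fin n) (x : A) : ρ (e k) (ρ (e k) x) = -x := by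
  rw [← End.mul_apply, ← map_mul, e_mul_self]; simp

theorem rho_e_anti (ρ : Cl n →ₐ[ℝ] End ℝ A) {k l : Fin n} (h : k ≠ l) (x : A) :
    ρ (e k) (ρ (e l) x) = -ρ (e l) (ρ (e k) x) := by
  rw [← End.mul_apply, ← map_mul, e_mul_e h]; simp

/-- `τ` is injective and anticommutes with the action of the vectors. -/
structure IsTwist (ρ : Cl n →ₐ[ℝ] End ℝ A) (τ : End ℝ A) : Prop where
  inj : Function.Injective τ
  anti : ∀ k x, τ (ρ (e k) x) = -ρ (e k) (τ x)

theorem rho_e_injective (ρ : Cl n →ₐ[ℝ] End ℝ A) (k : Fin n) : Function.Injective (ρ (e k)) := by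
  intro x y h
  have := congrArg (ρ (e k)) h
  simpa [rho_e_sq] using this

theorem rho_vol_sq (ρ : Cl n →ₐ[ℝ] End ℝ A) (x : A) :
    ρ (vol n) (ρ (vol n) x) = (-1 : ℝ) ^ (n * (n + 1) / 2) • x := by
  rw [← End.mul_apply, ← map_mul, vol_mul_self]; simp

theorem rho_vol_injective (ρ : Cl n →ₐ[ℝ] End ℝ A) : Function.Injective (ρ (vol n)) := by
  intro x y h
  have := congrArg (ρ (vol n)) h
  rw [rho_vol_sq, rho_vol_sq] at this
  exact smul_right_injective _ (pow_ne_zero _ (by norm_num)) this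

/-- In even dimension a twist comes for free; in odd dimension it has to come from a real or
quaternionic structure. -/
theorem IsTwist.of_vol (hn : Even n) (ρ : Cl n →ₐ[ℝ] End ℝ A) : IsTwist ρ (ρ (vol n)) where
  inj := rho_vol_injective ρ
  anti k x := by
    rw [← End.mul_apply, ← map_mul, vol_mul_e_even hn]; simp

theorem IsTwist.even {ρ : Cl n →ₐ[ℝ] End ℝ A} {τ : End ℝ A} (hτ : IsTwist ρ τ) {a : Cl n}
    (ha : a ∈ CliffordAlgebra.even (cliffordForm n)) (x : A) : τ (ρ a x) = ρ a (τ x) :=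
  (even_apply (fun k l x => by simp [hτ.anti]) ha x).symm

/-- τ changes sign at each of the odd number of factors of ω_n. -/
theorem IsTwist.vol_odd {ρ : Cl n →ₐ[ℝ] End ℝ A} {τ : End ℝ A} (hτ : IsTwist ρ τ) (hn : Odd n)
    (x : A) : τ (ρ (vol n) x) = -ρ (vol n) (τ x) := by
  obtain ⟨m, rfl⟩ : ∃ m, n = m + 1 := ⟨n - 1, by have := hn.pos; omega⟩
  -- One vector is split off: τ anticommutes with e_0 and commutes with the even element e_0 ω.
  have h1 : vol (m + 1) = -(e 0 * (e 0 * vol (m + 1))) := by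
    rw [← mul_assoc, e_mul_self]; simp
  rw [h1, map_neg, map_mul, LinearMap.neg_apply, LinearMap.neg_apply, map_neg, End.mul_apply,
    hτ.anti, hτ.even (e_mul_vol_mem_even hn 0), End.mul_apply]

/-- `I, J` are anticommuting complex structures that commute with the action of the vectors. -/
structure IsQuat (ρ : Cl n →ₐ[ℝ] End ℝ A) (I J : End ℝ A) : Prop where
  I_sq : ∀ x, I (I x) = -x
  J_sq : ∀ x, J (J x) = -x
  anti : ∀ x, I (J x) = -J (I x)
  I_comm : ∀ k x, I (ρ (e k) x) = ρ (e k) (I x)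
  J_comm : ∀ k x, J (ρ (e k) x) = ρ (e k) (J x)

theorem injective_of_sq_neg {I : End ℝ A} (h : ∀ x, I (I x) = -x) : Function.Injective I := by
  intro x y hxy
  have := congrArg I hxy
  simpa [h] using this

variable [FiniteDimensional ℝ A] [FiniteDimensional ℝ B]

/-- The halving argument. The hypotheses on `R k` say that it anticommutes with the involution φ ↦
-e_k φ e_k and commutes with those of the other indices, up to the sign common to both sides. -/
theorem finrank_clHom_aux (ρ : Cl n →ₐ[ℝ] End ℝ A) (ρ' : Cl n →ₐ[ℝ] End ℝ B)
    (R : Fin n → End ℝ (A →ₗ[ℝ] B)) (hinj : ∀ k, Function.Injective (R k))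
    (heq : ∀ k φ x, ρ' (e k) (R k φ (ρ (e k) x)) = -R k (ρ' (e k) ∘ₗ φ ∘ₗ ρ (e k)) x)
    (hne : ∀ i k φ x, i ≠ k → ρ' (e i) (R k φ (ρ (e i) x)) = R k (ρ' (e i) ∘ₗ φ ∘ₗ ρ (e i)) x) :
    2 ^ n * finrank ℝ (clHom ρ ρ') = finrank ℝ A * finrank ℝ B := by
  let T : Fin n → End ℝ (A →ₗ[ℝ] B) := fun k =>
    { toFun := fun φ => -(ρ' (e k) ∘ₗ φ ∘ₗ ρ (e k))
      map_add' := fun φ ψ => by ext; simp [add_comm]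
      map_smul' := fun c φ => by ext; simp }
  have hTa : ∀ k φ x, T k φ x = -ρ' (e k) (φ (ρ (e k) x)) := fun k φ x => rfl
  have hTe : ∀ k φ, T k φ = -(ρ' (e k) ∘ₗ φ ∘ₗ ρ (e k)) := fun k φ => rfl
  have hF : ∀ k φ, φ ∈ inter (ρ (e k)) (ρ' (e k)) ↔ T k φ = φ := by
    intro k φ
    rw [mem_inter, LinearMap.ext_iff]
    refine ⟨fun h x => ?_, fun h x => ?_⟩
    · rw [hTa, h, rho_e_sq, map_neg, neg_neg]
    · conv_lhs => rw [← h x, hTa, map_neg, rho_e_sq, neg_neg]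
  have hTT : ∀ k φ, T k (T k φ) = φ := by
    intro k φ
    ext x
    simp only [hTa, rho_e_sq, map_neg, neg_neg]
  have hcomm : ∀ i k φ, i ≠ k → T i (T k φ) = T k (T i φ) := by
    intro i k φ h
    ext x
    simp only [hTa, map_neg, neg_neg, rho_e_anti ρ h, rho_e_anti ρ' h]
  -- Imposing the conditions one index at a time: the space for `s` is stable under T_k and R_k when
  -- k ∉ s, so the condition for k halves its dimension.
  have key : ∀ s : Finset (Fin n),
      2 ^ s.card * finrank ℝ ↥(⨅ k ∈ s, inter (ρ (e k)) (ρ' (e k))) =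
        finrank ℝ A * finrank ℝ B := by
    intro s
    induction s using Finset.induction_on with
    | empty =>
      have h0 : (⨅ k ∈ (∅ : Finset (Fin n)), inter (ρ (e k)) (ρ' (e k))) = ⊤ := by simp
      rw [h0, finrank_top, Module.finrank_linearMap]
      simp
    | insert k s hk ih =>
      rw [Finset.iInf_insert, inf_comm, Finset.card_insert_of_notMem hk, pow_succ, mul_assoc,
        two_mul_finrank_fixed _ _ (T k) (R k) (hF k) ?_ (fun φ _ => hTT k φ) ?_ (hinj k) ?_, ih]
      · intro φ hφ
        simp only [Submodule.mem_iInf] at hφ ⊢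
        intro i hi
        have hik : i ≠ k := fun h => hk (h ▸ hi)
        rw [hF, hcomm i k φ hik, (hF i φ).1 (hφ i hi)]
      · intro φ hφ
        simp only [Submodule.mem_iInf] at hφ ⊢
        intro i hi
        have hik : i ≠ k := fun h => hk (h ▸ hi)
        rw [hF]
        conv_rhs => rw [← (hF i φ).1 (hφ i hi)]
        ext x
        rw [hTa, hne i k φ x hik, hTe, map_neg, LinearMap.neg_apply]
      · intro φ _
        ext x
        rw [hTa, heq k φ x, hTe, map_neg, LinearMap.neg_apply, LinearMap.neg_apply]
  have h0 : clHom ρ ρ' = ⨅ k ∈ Finset.univ, inter (ρ (e k)) (ρ' (e k)) := by simp [clHom]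
  rw [h0, ← key Finset.univ, Finset.card_univ, Fintype.card_fin]

/-- R_k φ = e_k τ φ anticommutes with T_k because τ does with e_k; for i ≠ k the signs from τ and
from e_k cancel. -/
theorem finrank_clHom_of_target (ρ : Cl n →ₐ[ℝ] End ℝ A) (ρ' : Cl n →ₐ[ℝ] End ℝ B) {τ : End ℝ B}
    (hτ : IsTwist ρ' τ) : 2 ^ n * finrank ℝ (clHom ρ ρ') = finrank ℝ A * finrank ℝ B := by
  refine finrank_clHom_aux ρ ρ' (fun k => LinearMap.compRight ℝ (ρ' (e k) * τ)) ?_ ?_ ?_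
  · intro k φ ψ h
    ext x
    exact hτ.inj (rho_e_injective ρ' k (LinearMap.congr_fun h x))
  · intro k φ x
    simp [hτ.anti]
  · intro i k φ x h
    simp [hτ.anti, rho_e_anti ρ' h]

theorem finrank_clHom_of_source (ρ : Cl n →ₐ[ℝ] End ℝ A) (ρ' : Cl n →ₐ[ℝ] End ℝ B) {τ : End ℝ A}
    (hτ : IsTwist ρ τ) : 2 ^ n * finrank ℝ (clHom ρ ρ') = finrank ℝ A * finrank ℝ B := by
  -- Precomposition is injective only for a surjective map; finite dimension turns injectivity of τ
  -- e_k into surjectivity.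
  have hsurj : ∀ k, Function.Surjective (τ * ρ (e k)) := fun k =>
    LinearMap.injective_iff_surjective.1 (hτ.inj.comp (rho_e_injective ρ k))
  refine finrank_clHom_aux ρ ρ' (fun k => LinearMap.lcomp ℝ B (τ * ρ (e k))) ?_ ?_ ?_
  · intro k φ ψ h
    ext x
    obtain ⟨y, rfl⟩ := hsurj k x
    exact LinearMap.congr_fun h y
  · intro k φ x
    simp [hτ.anti]
  · intro i k φ x h
    simp [hτ.anti, rho_e_anti ρ h]

/-- Imposing a further intertwining condition halves the dimension. -/
theorem two_mul_finrank_inter (E : Submodule ℝ (A →ₗ[ℝ] B)) (f : End ℝ A) (g : End ℝ B) (c : ℝ)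
    (hc : c * c = 1) (hf : ∀ x, f (f x) = c • x) (hg : ∀ x, g (g x) = c • x)
    (hE : ∀ φ ∈ E, g ∘ₗ φ ∘ₗ f ∈ E) (R : End ℝ B) (hR : Function.Injective R)
    (hRE : ∀ φ ∈ E, R ∘ₗ φ ∈ E) (hanti : ∀ x, g (R x) = -R (g x)) :
    2 * finrank ℝ ↥(E ⊓ inter f g) = finrank ℝ E := by
  -- Since f² = g² = c and c² = 1, this is an involution whose fixed points are the φ with gφ = φf.
  -- The value c = 1 serves real structures and c = -1 complex ones.
  let T : End ℝ (A →ₗ[ℝ] B) :=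
    { toFun := fun φ => c • (g ∘ₗ φ ∘ₗ f)
      map_add' := fun φ ψ => by ext; simp
      map_smul' := fun d φ => by ext; simp [smul_smul, mul_comm] }
  have hTa : ∀ φ x, T φ x = c • g (φ (f x)) := fun φ x => rfl
  refine two_mul_finrank_fixed E _ T (LinearMap.compRight ℝ R) ?_ ?_ ?_ hRE ?_ ?_
  · intro φ
    rw [mem_inter, LinearMap.ext_iff]
    refine ⟨fun h x => ?_, fun h x => ?_⟩
    · rw [hTa, h, hf, map_smul, smul_smul, hc, one_smul]
    · conv_lhs => rw [← h x, hTa, map_smul, hg, smul_smul, hc, one_smul]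
  · exact fun φ h => E.smul_mem _ (hE φ h)
  · intro φ _
    ext x
    simp only [hTa, map_smul, hf, hg, smul_smul]
    rw [show c * (c * c * c) = (c * c) * (c * c) by ring, hc, one_mul, one_smul]
  · intro φ ψ h
    ext x
    exact hR (LinearMap.congr_fun h x)
  · intro φ _
    ext x
    simp [hTa, hanti]

/-- The volume element of the target provides the anticommuting map: in odd dimension it commutes
with the vectors and anticommutes with the twist τ'. -/
theorem finrank_clHom_twist (hn : Odd n) (ρ : Cl n →ₐ[ℝ] End ℝ A) (ρ' : Cl n →ₐ[ℝ] End ℝ B)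
    {τ : End ℝ A} {τ' : End ℝ B} (hτ : IsTwist ρ τ) (hτ' : IsTwist ρ' τ') (c : ℝ) (hc : c * c = 1)
    (h : ∀ x, τ (τ x) = c • x) (h' : ∀ x, τ' (τ' x) = c • x) :
    2 ^ (n + 1) * finrank ℝ ↥(clHom ρ ρ' ⊓ inter τ τ') = finrank ℝ A * finrank ℝ B := by
  have hv : ∀ k x, ρ' (vol n) (ρ' (e k) x) = ρ' (e k) (ρ' (vol n) x) := fun k x => by
    rw [← End.mul_apply, ← map_mul, vol_mul_e_odd hn, map_mul, End.mul_apply]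
  rw [← finrank_clHom_of_target ρ ρ' hτ',
    ← two_mul_finrank_inter (clHom ρ ρ') τ τ' c hc h h' ?_ (ρ' (vol n)) ?_ ?_ ?_, pow_succ]
  · ring
  · intro φ hφ
    replace hφ := mem_clHom.1 hφ
    refine mem_clHom.2 fun k x => ?_
    simp only [LinearMap.comp_apply, hτ.anti, map_neg, ← hφ, hτ'.anti, neg_neg]
  · exact rho_vol_injective ρ'
  · intro φ hφ
    replace hφ := mem_clHom.1 hφ
    refine mem_clHom.2 fun k x => ?_
    simp only [LinearMap.comp_apply, ← hφ, hv]
  · exact hτ'.vol_odd hn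

/-- Two more halvings: J' anticommutes with I' and so halves for the condition on I; then I' halves
for the condition on J, as it preserves I-linear maps. -/
theorem finrank_clHom_quat (hn : Even n) (ρ : Cl n →ₐ[ℝ] End ℝ A) (ρ' : Cl n →ₐ[ℝ] End ℝ B)
    {I J : End ℝ A} {I' J' : End ℝ B} (h : IsQuat ρ I J) (h' : IsQuat ρ' I' J') :
    2 ^ (n + 2) * finrank ℝ ↥((clHom ρ ρ' ⊓ inter I I') ⊓ inter J J') =
      finrank ℝ A * finrank ℝ B := by
  rw [← finrank_clHom_of_target ρ ρ' (IsTwist.of_vol hn ρ'),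
    ← two_mul_finrank_inter (clHom ρ ρ') I I' (-1) (by norm_num) (by simp [h.I_sq])
      (by simp [h'.I_sq]) ?_ J' (injective_of_sq_neg h'.J_sq) ?_ h'.anti,
    ← two_mul_finrank_inter (clHom ρ ρ' ⊓ inter I I') J J' (-1) (by norm_num) (by simp [h.J_sq])
      (by simp [h'.J_sq]) ?_ I' (injective_of_sq_neg h'.I_sq) ?_ ?_, pow_add]
  · ring
  · rintro φ ⟨hφ, hφ'⟩
    replace hφ := mem_clHom.1 hφ
    replace hφ' := mem_inter.1 hφ'
    refine ⟨mem_clHom.2 fun k x => ?_, mem_inter.2 fun x => ?_⟩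
    · simp only [LinearMap.comp_apply, h.J_comm, ← hφ, h'.J_comm]
    · simp only [LinearMap.comp_apply, h'.anti, hφ']
      rw [← map_neg, ← map_neg, h.anti, neg_neg]
  · rintro φ ⟨hφ, hφ'⟩
    replace hφ := mem_clHom.1 hφ
    replace hφ' := mem_inter.1 hφ'
    refine ⟨mem_clHom.2 fun k x => ?_, mem_inter.2 fun x => ?_⟩
    · simp only [LinearMap.comp_apply, ← hφ, h'.I_comm]
    · simp only [LinearMap.comp_apply, hφ']
  · intro x
    rw [h'.anti, neg_neg]
  · intro φ hφ
    rw [mem_clHom] at hφ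
    refine mem_clHom.2 fun k x => ?_
    simp only [LinearMap.comp_apply, h.I_comm, ← hφ, h'.I_comm]
  · intro φ hφ
    rw [mem_clHom] at hφ
    refine mem_clHom.2 fun k x => ?_
    simp only [LinearMap.comp_apply, ← hφ, h'.J_comm]

end Counting
-- Extending module structures from `Cl n` to `Cl (n + 1)`
section Extension

open Module

variable {n : ℕ} {A : Type v} [AddCommGroup A] [Module ℝ A]

/-- Anticommuting complex structures define a module over the Clifford algebra. -/
theorem exists_rep (f : Fin n → End ℝ A) (h1 : ∀ k, f k * f k = -1)
    (h2 : ∀ k l, k ≠ l → f k * f l = -(f l * f k)) :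
    ∃ ρ : Cl n →ₐ[ℝ] End ℝ A, ∀ k, ρ (e k) = f k := by
  let m : (Fin n → ℝ) →ₗ[ℝ] End ℝ A := ∑ k, (LinearMap.proj k).smulRight (f k)
  have hm : ∀ x, m x = ∑ k, x k • f k := fun x => by simp [m]
  have hsq : ∀ x, m x * m x = algebraMap ℝ _ (cliffordForm n x) := by
    intro x
    have h3 : ∀ k l, f k * f l + f l * f k = if k = l then (-2 : ℝ) • (1 : End ℝ A) else 0 := by
      intro k l
      split_ifs with h
      · rw [h, h1]; module
      · rw [h2 k l h]; simp
    -- Doubling the square symmetrises the double sum, and only the anticommutators f_k f_l + f_l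
    -- f_k enter.
    have h4 : (2 : ℝ) • (m x * m x) = (2 : ℝ) • (algebraMap ℝ (End ℝ A) (cliffordForm n x)) := by
      calc (2 : ℝ) • (m x * m x) = ∑ k, ∑ l, (x k * x l) • (f k * f l + f l * f k) := by
            simp only [smul_add, Finset.sum_add_distrib, two_smul]
            congr 1
            · simp only [hm, Finset.sum_mul, Finset.mul_sum, smul_mul_smul_comm]
              rw [Finset.sum_comm]
            · simp only [hm, Finset.sum_mul, Finset.mul_sum, smul_mul_smul_comm]
              exact Finset.sum_congr rfl fun k _ => Finset.sum_congr rfl fun l _ => by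
                rw [mul_comm]
        _ = ∑ k, (x k * x k) • ((-2 : ℝ) • (1 : End ℝ A)) := by
            refine Finset.sum_congr rfl fun k _ => ?_
            simp [h3]
        _ = _ := by
            rw [← Finset.sum_smul, Algebra.algebraMap_eq_smul_one, smul_smul, smul_smul]
            congr 1
            simp [cliffordForm, QuadraticMap.weightedSumSquares_apply, mul_comm]
    exact smul_right_injective _ (two_ne_zero : (2 : ℝ) ≠ 0) h4
  refine ⟨CliffordAlgebra.lift (cliffordForm n) ⟨m, hsq⟩, fun k => ?_⟩
  rw [e, vec, CliffordAlgebra.lift_ι_apply, hm]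
  simp [Pi.single_apply]

theorem exists_rep_succ (f : Fin n → End ℝ A) (g : End ℝ A) (h1 : ∀ k, f k * f k = -1)
    (h2 : ∀ k l, k ≠ l → f k * f l = -(f l * f k)) (h3 : g * g = -1)
    (h4 : ∀ k, f k * g = -(g * f k)) :
    ∃ ρ : Cl (n + 1) →ₐ[ℝ] End ℝ A, (∀ k, ρ (e (Fin.castSucc k)) = f k) ∧ ρ (e (Fin.last n)) = g := by
  obtain ⟨ρ, hρ⟩ := exists_rep (Fin.snoc (α := fun _ => End ℝ A) f g)
    (fun k => by refine Fin.lastCases ?_ (fun j => ?_) k <;> simp [h1, h3])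
    (fun k l => by
      refine Fin.lastCases ?_ (fun j => ?_) k <;> refine Fin.lastCases ?_ (fun i => ?_) l
      · simp
      · intro _; simp [h4]
      · intro _; simp [h4]
      · intro h; simpa using h2 j i (fun h' => h (h' ▸ rfl)))
  exact ⟨ρ, fun k => by simp [hρ], by simp [hρ]⟩

theorem mulI_mul_mulI : mulI * mulI = (-1 : End ℝ ℂ) := by
  refine LinearMap.ext fun z => ?_
  simp [mulI, ← mul_assoc]

theorem rho_mul_apply (ρ : Cl n →ₐ[ℝ] End ℝ A) (a b : Cl n) (x : A) :
    ρ (a * b) x = ρ a (ρ b x) := by simp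

theorem rho_vol_sq_pos (hn : n % 4 = 0 ∨ n % 4 = 3) (ρ : Cl n →ₐ[ℝ] End ℝ A) (x : A) :
    ρ (vol n) (ρ (vol n) x) = x := by
  rw [← rho_mul_apply, vol_sq_pos hn]; simp

theorem rho_vol_sq_neg (hn : n % 4 = 1 ∨ n % 4 = 2) (ρ : Cl n →ₐ[ℝ] End ℝ A) (x : A) :
    ρ (vol n) (ρ (vol n) x) = -x := by
  rw [← rho_mul_apply, vol_sq_neg hn]; simp

theorem rho_vol_e_even (hn : Even n) (ρ : Cl n →ₐ[ℝ] End ℝ A) (k : Fin n) (x : A) :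
    ρ (vol n) (ρ (e k) x) = -ρ (e k) (ρ (vol n) x) := by
  rw [← rho_mul_apply, vol_mul_e_even hn]; simp

theorem rho_vol_e_odd (hn : Odd n) (ρ : Cl n →ₐ[ℝ] End ℝ A) (k : Fin n) (x : A) :
    ρ (vol n) (ρ (e k) x) = ρ (e k) (ρ (vol n) x) := by
  rw [← rho_mul_apply, vol_mul_e_odd hn]; simp

/-- The factor ω_n makes the images anticommute with ω_n ⊗ i. Since (ω_n e_k)² = 1, the factor i
restores the square -1. Every generator contains exactly one i, so complex conjugation is a twist.
-/
theorem exists_complexification (hn : n % 4 = 0) (ρ : Cl n →ₐ[ℝ] End ℝ A) :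
    ∃ ρ' : Cl (n + 1) →ₐ[ℝ] End ℝ (A ⊗[ℝ] ℂ),
      (∀ k, ρ' (e (Fin.castSucc k)) = TensorProduct.map (ρ (vol n * e k)) mulI) ∧
      ρ' (e (Fin.last n)) = TensorProduct.map (ρ (vol n)) mulI ∧
      IsTwist ρ' (TensorProduct.map LinearMap.id conjC) := by
  have he : Even n := by rw [Nat.even_iff]; omega
  have hi : ∀ z, mulI (mulI z) = -z := fun z => LinearMap.congr_fun mulI_mul_mulI z
  suffices hex : ∃ ρ' : Cl (n + 1) →ₐ[ℝ] End ℝ (A ⊗[ℝ] ℂ),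
      (∀ k, ρ' (e (Fin.castSucc k)) = TensorProduct.map (ρ (vol n * e k)) mulI) ∧
      ρ' (e (Fin.last n)) = TensorProduct.map (ρ (vol n)) mulI by
    obtain ⟨ρ', h1, h2⟩ := hex
    refine ⟨ρ', h1, h2, ?_, ?_⟩
    · refine Function.LeftInverse.injective (g := TensorProduct.map LinearMap.id conjC) fun x => ?_
      induction x with
      | zero => simp
      | tmul x z => simp [conjC]
      | add x y hx hy => simp only [map_add, hx, hy]
    · have hc : ∀ z, conjC (mulI z) = -mulI (conjC z) := fun z => by simp [conjC, mulI]
      intro k x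
      induction x with
      | zero => simp
      | tmul x z =>
        refine Fin.lastCases ?_ (fun j => ?_) k <;> simp [h1, h2, hc, TensorProduct.tmul_neg]
      | add x y hx hy => simp only [map_add, hx, hy, neg_add]
  refine exists_rep_succ _ _ ?_ ?_ ?_ ?_
  · intro k
    refine TensorProduct.ext' fun x z => ?_
    simp [hi, rho_vol_e_even he, rho_e_sq, rho_vol_sq_pos (Or.inl hn), TensorProduct.tmul_neg,
      TensorProduct.neg_tmul]
  · intro k l h
    refine TensorProduct.ext' fun x z => ?_
    simp [hi, rho_vol_e_even he, rho_e_anti ρ h, rho_vol_sq_pos (Or.inl hn), TensorProduct.tmul_neg,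
      TensorProduct.neg_tmul]
  · refine TensorProduct.ext' fun x z => ?_
    simp [hi, rho_vol_sq_pos (Or.inl hn), TensorProduct.tmul_neg]
  · intro k
    refine TensorProduct.ext' fun x z => ?_
    simp [hi, rho_vol_e_even he, rho_vol_sq_pos (Or.inl hn), TensorProduct.tmul_neg,
      TensorProduct.neg_tmul]

/-- The endomorphism `(x, y) ↦ (g y, -g x)` of `A × A`. -/
def skewSwap (g : End ℝ A) : End ℝ (A × A) :=
  (g ∘ₗ LinearMap.snd ℝ A A).prod (-(g ∘ₗ LinearMap.fst ℝ A A))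

/-- The endomorphism `(x, y) ↦ (g y, g x)` of `A × A`. -/
def swapEnd (g : End ℝ A) : End ℝ (A × A) :=
  (g ∘ₗ LinearMap.snd ℝ A A).prod (g ∘ₗ LinearMap.fst ℝ A A)

@[simp] theorem skewSwap_apply (g : End ℝ A) (x : A × A) : skewSwap g x = (g x.2, -g x.1) := rfl
@[simp] theorem swapEnd_apply (g : End ℝ A) (x : A × A) : swapEnd g x = (g x.2, g x.1) := rfl

theorem exists_double (ρ : Cl n →ₐ[ℝ] End ℝ A) :
    ∃ ρ' : Cl (n + 1) →ₐ[ℝ] End ℝ (A × A),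
      (∀ k, ρ' (e (Fin.castSucc k)) = (ρ (e k)).prodMap (-ρ (e k))) ∧
      ρ' (e (Fin.last n)) = skewSwap 1 := by
  refine exists_rep_succ _ _ (fun k => ?_) (fun k l h => ?_) ?_ (fun k => ?_)
  · refine LinearMap.ext fun x => Prod.ext ?_ ?_ <;> simp [rho_e_sq]
  · refine LinearMap.ext fun x => Prod.ext ?_ ?_ <;> simp [rho_e_anti ρ h]
  · refine LinearMap.ext fun x => Prod.ext ?_ ?_ <;> simp
  · refine LinearMap.ext fun x => Prod.ext ?_ ?_ <;> simp

/-- Vectors interchange the summands, which become the half-spinor spaces: for ω_n = 1 the new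
volume element is 1 on the first and -1 on the second (see `double_swap_vol`). -/
theorem exists_double_swap (ρ : Cl n →ₐ[ℝ] End ℝ A) :
    ∃ ρ' : Cl (n + 1) →ₐ[ℝ] End ℝ (A × A),
      (∀ k, ρ' (e (Fin.castSucc k)) = swapEnd (ρ (e k))) ∧
      ρ' (e (Fin.last n)) = -skewSwap 1 := by
  refine exists_rep_succ _ _ (fun k => ?_) (fun k l h => ?_) ?_ (fun k => ?_)
  · refine LinearMap.ext fun x => Prod.ext ?_ ?_ <;> simp [rho_e_sq]
  · refine LinearMap.ext fun x => Prod.ext ?_ ?_ <;> simp [rho_e_anti ρ h]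
  · refine LinearMap.ext fun x => Prod.ext ?_ ?_ <;> simp
  · refine LinearMap.ext fun x => Prod.ext ?_ ?_ <;> simp

/-- σ anticommutes with e_k; this compensates the opposite signs with which e_k acts on the two
summands. The square of `skewSwap σ` is -σ² = -1. -/
theorem IsQuat.double {ρ : Cl n →ₐ[ℝ] End ℝ A} (hn : n % 8 = 1) {σ : End ℝ A} (hσ : IsTwist ρ σ)
    (hsq : ∀ x, σ (σ x) = x) {ρ' : Cl (n + 1) →ₐ[ℝ] End ℝ (A × A)}
    (h1 : ∀ k, ρ' (e (Fin.castSucc k)) = (ρ (e k)).prodMap (-ρ (e k)))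
    (h2 : ρ' (e (Fin.last n)) = skewSwap 1) :
    IsQuat ρ' ((ρ (vol n)).prodMap (ρ (vol n))) (skewSwap σ) := by
  have ho : Odd n := by rw [Nat.odd_iff]; omega
  have hv := rho_vol_sq_neg (n := n) (by omega) ρ
  refine ⟨fun x => Prod.ext ?_ ?_, fun x => Prod.ext ?_ ?_, fun x => Prod.ext ?_ ?_,
    fun k x => Fin.lastCases (Prod.ext ?_ ?_) (fun j => Prod.ext ?_ ?_) k,
    fun k x => Fin.lastCases (Prod.ext ?_ ?_) (fun j => Prod.ext ?_ ?_) k⟩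
  all_goals simp [h1, h2, hv, hsq, hσ.anti, hσ.vol_odd ho, rho_vol_e_odd ho]

theorem IsQuat.double_swap {ρ : Cl n →ₐ[ℝ] End ℝ A} {I J : End ℝ A} (h : IsQuat ρ I J)
    {ρ' : Cl (n + 1) →ₐ[ℝ] End ℝ (A × A)}
    (h1 : ∀ k, ρ' (e (Fin.castSucc k)) = swapEnd (ρ (e k)))
    (h2 : ρ' (e (Fin.last n)) = -skewSwap 1) :
    IsQuat ρ' (I.prodMap I) (J.prodMap J) := by
  refine ⟨fun x => Prod.ext ?_ ?_, fun x => Prod.ext ?_ ?_, fun x => Prod.ext ?_ ?_,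
    fun k x => Fin.lastCases (Prod.ext ?_ ?_) (fun j => Prod.ext ?_ ?_) k,
    fun k x => Fin.lastCases (Prod.ext ?_ ?_) (fun j => Prod.ext ?_ ?_) k⟩
  all_goals simp [h1, h2, h.I_sq, h.J_sq, h.anti, h.I_comm, h.J_comm]

/-- For n ≡ 2 mod 4, ±ω_n are complex structures anticommuting with all vectors. The minus sign
gives ω_{n+1} = ω_n · (-ω_n) = 1. -/
theorem exists_vol_extension (hn : n % 4 = 2) (ρ : Cl n →ₐ[ℝ] End ℝ A) :
    ∃ ρ' : Cl (n + 1) →ₐ[ℝ] End ℝ A,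
      (∀ k, ρ' (e (Fin.castSucc k)) = ρ (e k)) ∧ ρ' (e (Fin.last n)) = -ρ (vol n) := by
  have he : Even n := by rw [Nat.even_iff]; omega
  refine exists_rep_succ _ _ (fun k => ?_) (fun k l h => ?_) ?_ (fun k => ?_)
  all_goals refine LinearMap.ext fun x => ?_
  · simp [rho_e_sq]
  · simp [rho_e_anti ρ h]
  · simp [rho_vol_sq_neg (Or.inr hn)]
  · simp [rho_vol_e_even he]

/-- ω_n anticommutes with the vectors and has square 1; multiplying it by I makes the square -1. The
map Jω_n anticommutes with e_k because of ω_n, and with Iω_n because IJ = -JI. -/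
theorem exists_quat_extension (hn : n % 4 = 0) {ρ : Cl n →ₐ[ℝ] End ℝ A} {I J : End ℝ A}
    (h : IsQuat ρ I J) :
    ∃ ρ' : Cl (n + 1) →ₐ[ℝ] End ℝ A,
      (∀ k, ρ' (e (Fin.castSucc k)) = ρ (e k)) ∧ ρ' (e (Fin.last n)) = I * ρ (vol n) ∧
      IsTwist ρ' (J * ρ (vol n)) ∧ ∀ x, (J * ρ (vol n)) ((J * ρ (vol n)) x) = -x := by
  have he : Even n := by rw [Nat.even_iff]; omega
  have hI : ∀ x, I (ρ (vol n) x) = ρ (vol n) (I x) := fun x =>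
    (clHom_apply (mem_clHom.2 fun k x => (h.I_comm k x).symm) _ x).symm
  have hJ : ∀ x, J (ρ (vol n) x) = ρ (vol n) (J x) := fun x =>
    (clHom_apply (mem_clHom.2 fun k x => (h.J_comm k x).symm) _ x).symm
  have hv := rho_vol_sq_pos (Or.inl hn) ρ
  have hs : ∀ x, (J * ρ (vol n)) ((J * ρ (vol n)) x) = -x := fun x => by simp [hJ, hv, h.J_sq]
  suffices hex : ∃ ρ' : Cl (n + 1) →ₐ[ℝ] End ℝ A,
      (∀ k, ρ' (e (Fin.castSucc k)) = ρ (e k)) ∧ ρ' (e (Fin.last n)) = I * ρ (vol n) by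
    obtain ⟨ρ', h1, h2⟩ := hex
    refine ⟨ρ', h1, h2, ⟨injective_of_sq_neg hs, fun k x => ?_⟩, hs⟩
    refine Fin.lastCases ?_ (fun j => ?_) k
    · simp [h2, hI, hJ, h.anti]
    · simp [h1, rho_vol_e_even he, h.J_comm]
  refine exists_rep_succ _ _ (fun k => ?_) (fun k l h => ?_) ?_ (fun k => ?_)
  all_goals refine LinearMap.ext fun x => ?_
  · simp [rho_e_sq]
  · simp [rho_e_anti ρ h]
  · simp [hI, hv, h.I_sq]
  · simp [rho_vol_e_even he, h.I_comm]

/-- With e_{n+1} = J the image -e_k J of e_k satisfies (-e_k J)J = e_k, so the product of the new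
generators is the old action of e_k. -/
theorem exists_twist_extension {ρ : Cl n →ₐ[ℝ] End ℝ A} {J : End ℝ A} (h : IsTwist ρ J)
    (hsq : ∀ x, J (J x) = -x) :
    ∃ ρ' : Cl (n + 1) →ₐ[ℝ] End ℝ A,
      (∀ k, ρ' (e (Fin.castSucc k)) = -(ρ (e k) * J)) ∧ ρ' (e (Fin.last n)) = J := by
  refine exists_rep_succ _ _ (fun k => ?_) (fun k l h' => ?_) ?_ (fun k => ?_)
  all_goals refine LinearMap.ext fun x => ?_
  · simp [rho_e_sq, h.anti, hsq]
  · simp [rho_e_anti ρ h', h.anti]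
  · simp [hsq]
  · simp [h.anti]

end Extension

/-! ### Finite dimension of the Clifford algebra -/

section Finite

open Module

theorem exists_eq_incl_add_incl_mul (n : ℕ) (a : Cl (n + 1)) :
    ∃ b c : Cl n, a = incl n b + incl n c * e (Fin.last n) := by
  -- The elements b + c e_{n+1} are shown to be stable under left multiplication. This property of a
  -- multiplier is inherited by products, and applying it to 1 gives the claim.
  suffices h : ∀ a : Cl (n + 1), ∀ b c : Cl n, ∃ b' c' : Cl n,
      a * (incl n b + incl n c * e (Fin.last n)) = incl n b' + incl n c' * e (Fin.last n) by
    obtain ⟨b, c, h⟩ := h a 1 0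
    exact ⟨b, c, by simpa using h⟩
  intro a
  induction a using cl_induction with
  | h1 => exact fun b c => ⟨b, c, one_mul _⟩
  | he k =>
    intro b c
    refine Fin.lastCases ?_ (fun j => ?_) k
    · refine ⟨-CliffordAlgebra.involute c, CliffordAlgebra.involute b, ?_⟩
      rw [mul_add, ← mul_assoc, e_last_mul_incl, e_last_mul_incl, mul_assoc, e_mul_self]
      simp [add_comm]
    · exact ⟨e j * b, e j * c, by rw [mul_add, ← incl_e, ← mul_assoc, map_mul, map_mul]⟩
  | hmul a b ha hb =>
    intro c d
    obtain ⟨c', d', h⟩ := hb c d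
    obtain ⟨c'', d'', h'⟩ := ha c' d'
    exact ⟨c'', d'', by rw [mul_assoc, h, h']⟩
  | hadd a b ha hb =>
    intro c d
    obtain ⟨c', d', h⟩ := ha c d
    obtain ⟨c'', d'', h'⟩ := hb c d
    exact ⟨c' + c'', d' + d'', by rw [add_mul, h, h']; simp only [map_add, add_mul]; abel⟩
  | hsmul r a ha =>
    intro c d
    obtain ⟨c', d', h⟩ := ha c d
    exact ⟨r • c', r • d', by rw [smul_mul_assoc, h]; simp [smul_add]⟩

theorem finiteDimensional_cl (n : ℕ) : FiniteDimensional ℝ (Cl n) := by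
  induction n with
  | zero =>
    refine Module.Finite.of_surjective (Algebra.linearMap ℝ (Cl 0)) fun a => ?_
    induction a using cl_induction with
    | h1 => exact ⟨1, by simp⟩
    | he k => exact k.elim0
    | hmul a b ha hb =>
      obtain ⟨r, rfl⟩ := ha
      obtain ⟨s, rfl⟩ := hb
      exact ⟨r * s, by simp⟩
    | hadd a b ha hb =>
      obtain ⟨r, rfl⟩ := ha
      obtain ⟨s, rfl⟩ := hb
      exact ⟨r + s, by simp⟩
    | hsmul r a ha =>
      obtain ⟨s, rfl⟩ := ha
      exact ⟨r * s, by simp [Algebra.smul_def]⟩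
  | succ n ih =>
    refine Module.Finite.of_surjective ((incl n).toLinearMap.coprod
      ((LinearMap.mulRight ℝ (e (Fin.last n))) ∘ₗ (incl n).toLinearMap)) fun a => ?_
    obtain ⟨b, c, h⟩ := exists_eq_incl_add_incl_mul n a
    exact ⟨(b, c), by simp [h]⟩

end Finite

/-! ### Models of the irreducible modules -/

section Models

open Module

variable {n : ℕ}

/-- The dimension of the irreducible modules over `Cℓ_n` and the structures on them. -/
inductive IsModel {A : Type v} [AddCommGroup A] [Module ℝ A] (ρ : Cl n →ₐ[ℝ] End ℝ A) : Prop
  -- Dimensions are stored squared, so that no half-integer exponents occur. Outside n ≡ 3 mod 4 the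
  -- square is 2^n times the dimension of ℝ, ℂ or ℍ, whichever is the endomorphism algebra; for n ≡
  -- 3 mod 4 the factor is 2^(n-1), because ω_n acts as a scalar.
  | real (h : n % 8 = 0 ∨ n % 8 = 6) (hd : finrank ℝ A ^ 2 = 2 ^ n)
  | complexReal (h : n % 8 = 1) (hd : finrank ℝ A ^ 2 = 2 ^ (n + 1)) (σ : End ℝ A)
      (hσ : IsTwist ρ σ) (hs : ∀ x, σ (σ x) = x)
  | complexQuat (h : n % 8 = 5) (hd : finrank ℝ A ^ 2 = 2 ^ (n + 1)) (J : End ℝ A)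
      (hJ : IsTwist ρ J) (hs : ∀ x, J (J x) = -x)
  | quat (h : n % 8 = 2 ∨ n % 8 = 4) (hd : finrank ℝ A ^ 2 = 2 ^ (n + 2)) (I J : End ℝ A)
      (hIJ : IsQuat ρ I J)
  | quatVol (h : n % 8 = 3) (hd : finrank ℝ A ^ 2 = 2 ^ (n + 1)) (hv : ρ (vol n) = 1)
      (I J : End ℝ A) (hIJ : IsQuat ρ I J)
  | realVol (h : n % 8 = 7) (hd : 2 * finrank ℝ A ^ 2 = 2 ^ n) (hv : ρ (vol n) = 1)

theorem incl_vol_apply {A : Type v} [AddCommGroup A] [Module ℝ A] {ρ : Cl n →ₐ[ℝ] End ℝ A}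
    {ρ' : Cl (n + 1) →ₐ[ℝ] End ℝ A} (h : ∀ k, ρ' (e (Fin.castSucc k)) = ρ (e k)) (a : Cl n)
    (x : A) : ρ' (incl n a) x = ρ a x :=
  clHom_apply (ρ := ρ) (ρ' := ρ'.comp (incl n)) (φ := LinearMap.id)
    (mem_clHom.2 fun k x => by simp [incl_e, h]) a x

/-- The extension constructions form a cycle of length eight, each producing the structure that a
later one needs. The dimension doubles on leaving n ≡ 0, 1, 3, 7 and otherwise stays, a factor 16
per period. -/
theorem exists_model (n : ℕ) : ∃ (A : Type) (_ : AddCommGroup A) (_ : Module ℝ A)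
    (_ : FiniteDimensional ℝ A) (_ : Nontrivial A) (ρ : Cl n →ₐ[ℝ] End ℝ A), IsModel ρ := by
  induction n with
  | zero =>
    obtain ⟨ρ, -⟩ := exists_rep (A := ℝ) (n := 0) (fun k => k.elim0) (fun k => k.elim0)
      (fun k => k.elim0)
    exact ⟨ℝ, inferInstance, inferInstance, inferInstance, inferInstance, ρ,
      .real (Or.inl rfl) (by simp)⟩
  | succ n ih =>
    obtain ⟨A, _, _, _, _, ρ, hρ⟩ := ih
    have hd2 : finrank ℝ (A × A) ^ 2 = 2 ^ 2 * finrank ℝ A ^ 2 := by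
      rw [finrank_prod]; ring
    cases hρ with
    | real h hd =>
      rcases h with h | h
      · obtain ⟨ρ', h1, h2, h3⟩ := exists_complexification (by omega) ρ
        refine ⟨A ⊗[ℝ] ℂ, inferInstance, inferInstance, inferInstance, ?_, ρ',
          .complexReal (by omega) ?_ _ h3 ?_⟩
        · refine Module.nontrivial_of_finrank_pos (R := ℝ) ?_
          rw [finrank_tensorProduct, Complex.finrank_real_complex]
          exact Nat.mul_pos finrank_pos two_pos
        · rw [finrank_tensorProduct, Complex.finrank_real_complex, mul_pow, hd]; ring
        · intro x
          induction x with
          | zero => simp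
          | tmul x z => simp [conjC]
          | add x y hx hy => simp only [map_add, hx, hy]
      · obtain ⟨ρ', h1, h2⟩ := exists_vol_extension (by omega) ρ
        refine ⟨A, inferInstance, inferInstance, inferInstance, inferInstance, ρ',
          .realVol (by omega) (by rw [hd]; ring) ?_⟩
        refine LinearMap.ext fun x => ?_
        rw [vol_succ, rho_mul_apply, incl_vol_apply h1, h2]
        simp [rho_vol_sq_neg (n := n) (by omega) ρ]
    | complexReal h hd σ hσ hs =>
      obtain ⟨ρ', h1, h2⟩ := exists_double ρ
      exact ⟨A × A, inferInstance, inferInstance, inferInstance, inferInstance, ρ',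
        .quat (by omega) (by rw [hd2, hd]; ring) _ _ (IsQuat.double h hσ hs h1 h2)⟩
    | complexQuat h hd J hJ hs =>
      obtain ⟨ρ', h1, h2⟩ := exists_twist_extension hJ hs
      exact ⟨A, inferInstance, inferInstance, inferInstance, inferInstance, ρ',
        .real (by omega) hd⟩
    | quat h hd I J hIJ =>
      rcases h with h | h
      · obtain ⟨ρ', h1, h2⟩ := exists_vol_extension (by omega) ρ
        refine ⟨A, inferInstance, inferInstance, inferInstance, inferInstance, ρ',
          .quatVol (by omega) hd ?_ I J ?_⟩
        · refine LinearMap.ext fun x => ?_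
          rw [vol_succ, rho_mul_apply, incl_vol_apply h1, h2]
          simp [rho_vol_sq_neg (n := n) (by omega) ρ]
        · have hI : ∀ x, I (ρ (vol n) x) = ρ (vol n) (I x) := fun x =>
            (clHom_apply (mem_clHom.2 fun k x => (hIJ.I_comm k x).symm) _ x).symm
          have hJ : ∀ x, J (ρ (vol n) x) = ρ (vol n) (J x) := fun x =>
            (clHom_apply (mem_clHom.2 fun k x => (hIJ.J_comm k x).symm) _ x).symm
          exact ⟨hIJ.I_sq, hIJ.J_sq, hIJ.anti,
            fun k x => Fin.lastCases (by simp [h2, hI]) (fun j => by simp [h1, hIJ.I_comm]) k,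
            fun k x => Fin.lastCases (by simp [h2, hJ]) (fun j => by simp [h1, hIJ.J_comm]) k⟩
      · obtain ⟨ρ', h1, h2, h3, h4⟩ := exists_quat_extension (by omega) hIJ
        exact ⟨A, inferInstance, inferInstance, inferInstance, inferInstance, ρ',
          .complexQuat (by omega) hd _ h3 h4⟩
    | quatVol h hd hv I J hIJ =>
      obtain ⟨ρ', h1, h2⟩ := exists_double_swap ρ
      exact ⟨A × A, inferInstance, inferInstance, inferInstance, inferInstance, ρ',
        .quat (by omega) (by rw [hd2, hd]; ring) _ _ (hIJ.double_swap h1 h2)⟩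
    | realVol h hd hv =>
      obtain ⟨ρ', h1, h2⟩ := exists_double_swap ρ
      exact ⟨A × A, inferInstance, inferInstance, inferInstance, inferInstance, ρ',
        .real (by omega) (by rw [hd2, pow_succ 2 n, ← hd]; ring)⟩

variable {A : Type v} [AddCommGroup A] [Module ℝ A] {B : Type w} [AddCommGroup B] [Module ℝ B]

theorem IsModel.congr {ρ : Cl n →ₐ[ℝ] End ℝ A} {ρ' : Cl n →ₐ[ℝ] End ℝ B} (φ : A ≃ₗ[ℝ] B)
    (hφ : φ.toLinearMap ∈ clHom ρ ρ') (h : IsModel ρ') : IsModel ρ := by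
  have hf := φ.finrank_eq
  have h1 : ∀ a x, φ (ρ a x) = ρ' a (φ x) := fun a x => (clHom_apply hφ a x).symm
  have h2 : ∀ a x, φ.symm (ρ' a x) = ρ a (φ.symm x) := fun a x => by
    rw [LinearEquiv.symm_apply_eq, h1, LinearEquiv.apply_symm_apply]
  have ht : ∀ τ, IsTwist ρ' τ → IsTwist ρ (φ.symm.toLinearMap ∘ₗ τ ∘ₗ φ.toLinearMap) :=
    fun τ hτ => ⟨φ.symm.injective.comp (hτ.inj.comp φ.injective), fun k x => by
      simp [h1, h2, hτ.anti]⟩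
  have hq : ∀ I J, IsQuat ρ' I J → IsQuat ρ (φ.symm.toLinearMap ∘ₗ I ∘ₗ φ.toLinearMap)
      (φ.symm.toLinearMap ∘ₗ J ∘ₗ φ.toLinearMap) := fun I J h =>
    ⟨fun x => by simp [h.I_sq], fun x => by simp [h.J_sq], fun x => by simp [h.anti],
      fun k x => by simp [h1, h2, h.I_comm], fun k x => by simp [h1, h2, h.J_comm]⟩
  have hv : ρ' (vol n) = 1 → ρ (vol n) = 1 := fun hv => LinearMap.ext fun x => by
    apply φ.injective; rw [h1, hv]; rfl
  cases h with
  | real h hd => exact .real h (hf ▸ hd)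
  | complexReal h hd σ hσ hs => exact .complexReal h (hf ▸ hd) _ (ht σ hσ) (fun x => by simp [hs])
  | complexQuat h hd J hJ hs => exact .complexQuat h (hf ▸ hd) _ (ht J hJ) (fun x => by simp [hs])
  | quat h hd I J hIJ => exact .quat h (hf ▸ hd) _ _ (hq I J hIJ)
  | quatVol h hd hv' I J hIJ => exact .quatVol h (hf ▸ hd) (hv hv') _ _ (hq I J hIJ)
  | realVol h hd hv' => exact .realVol h (hf ▸ hd) (hv hv')

theorem mem_span_of_finrank_eq {H : Type*} [AddCommGroup H] [Module ℝ H] [FiniteDimensional ℝ H]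
    {E : Submodule ℝ H} {m : ℕ} {b : Fin m → H} (hb : LinearIndependent ℝ b) (hE : ∀ i, b i ∈ E)
    (hm : finrank ℝ E = m) {x : H} (hx : x ∈ E) : ∃ c : Fin m → ℝ, x = ∑ i, c i • b i := by
  have h1 : Submodule.span ℝ (Set.range b) = E :=
    Submodule.eq_of_le_of_finrank_eq (Submodule.span_le.2 (by rintro _ ⟨i, rfl⟩; exact hE i))
      (by rw [finrank_span_eq_card hb, hm, Fintype.card_fin])
  rw [← h1] at hx
  obtain ⟨c, hc⟩ := (Submodule.mem_span_range_iff_exists_fun ℝ).1 hx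
  exact ⟨c, hc.symm⟩

/-- Applying the conjugate a - bI to the relation yields (a² + b²)x = 0. -/
theorem complex_coeff_eq_zero {I : End ℝ A} (h : ∀ x, I (I x) = -x) {a b : ℝ} {x : A}
    (hx : x ≠ 0) (h0 : a • x + b • I x = 0) : a = 0 ∧ b = 0 := by
  have h1 : (a * a + b * b) • x = 0 := by
    have : (a * a + b * b) • x = a • (a • x + b • I x) - b • I (a • x + b • I x) := by
      simp only [map_add, map_smul, h]; module
    rw [this, h0]; simp
  have h2 := (smul_eq_zero.1 h1).resolve_right hx
  constructor <;> nlinarith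

/-- As in the complex case, with the quaternionic conjugate and norm. -/
theorem quat_coeff_eq_zero {I J : End ℝ A} (hI : ∀ x, I (I x) = -x) (hJ : ∀ x, J (J x) = -x)
    (hIJ : ∀ x, I (J x) = -J (I x)) {a b c d : ℝ} {x : A}
    (hx : x ≠ 0) (h0 : a • x + b • I x + c • J x + d • I (J x) = 0) :
    a = 0 ∧ b = 0 ∧ c = 0 ∧ d = 0 := by
  have h1 : (a * a + b * b + c * c + d * d) • x = 0 := by
    have hJI : ∀ x, J (I x) = -I (J x) := fun x => by rw [hIJ, neg_neg]
    have : ∀ y, y = a • x + b • I x + c • J x + d • I (J x) →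
        (a * a + b * b + c * c + d * d) • x = a • y - b • I y - c • J y - d • I (J y) := by
      rintro y rfl
      simp only [map_add, map_smul, hI, hJ, hJI, map_neg]; module
    rw [this 0 h0.symm]; simp
  have h2 := (smul_eq_zero.1 h1).resolve_right hx
  refine ⟨?_, ?_, ?_, ?_⟩ <;> nlinarith [mul_self_nonneg a, mul_self_nonneg b, mul_self_nonneg c,
    mul_self_nonneg d]

theorem one_mem_clHom (ρ : Cl n →ₐ[ℝ] End ℝ A) : (1 : End ℝ A) ∈ clHom ρ ρ :=
  mem_clHom.2 fun _ _ => rfl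

/-- The residues n ≡ 3 mod 4 are excluded for a reason: there ω_n acts as 1 on the models, while a
twist would anticommute with it. -/
theorem IsModel.exists_twist {ρ : Cl n →ₐ[ℝ] End ℝ A} (h : IsModel ρ) (hn : n % 4 ≠ 3) :
    ∃ τ, IsTwist ρ τ := by
  cases h with
  | real h _ => exact ⟨_, IsTwist.of_vol (by rw [Nat.even_iff]; omega) ρ⟩
  | complexReal _ _ σ hσ _ => exact ⟨σ, hσ⟩
  | complexQuat _ _ σ hσ _ => exact ⟨σ, hσ⟩
  | quat h _ _ _ _ => exact ⟨_, IsTwist.of_vol (by rw [Nat.even_iff]; omega) ρ⟩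
  | quatVol h _ _ _ _ _ => omega
  | realVol h _ _ => omega

/-- There are no nontrivial submodules. -/
def IsIrr (ρ : Cl n →ₐ[ℝ] End ℝ A) : Prop :=
  ∀ U : Submodule ℝ A, (∀ k, ∀ x ∈ U, ρ (e k) x ∈ U) → U = ⊥ ∨ U = ⊤

theorem IsIrr.injective {ρ : Cl n →ₐ[ℝ] End ℝ A} (h : IsIrr ρ) {ρ' : Cl n →ₐ[ℝ] End ℝ B}
    {φ : A →ₗ[ℝ] B} (hφ : φ ∈ clHom ρ ρ') (h0 : φ ≠ 0) : Function.Injective φ := by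
  rw [← LinearMap.ker_eq_bot]
  refine (h (LinearMap.ker φ) fun k x hx => ?_).resolve_right fun h1 => h0 (LinearMap.ker_eq_top.1 h1)
  rw [LinearMap.mem_ker] at hx ⊢
  rw [← mem_clHom.1 hφ, hx, map_zero]

theorem IsIrr.surjective {ρ' : Cl n →ₐ[ℝ] End ℝ B} (h : IsIrr ρ') {ρ : Cl n →ₐ[ℝ] End ℝ A}
    {φ : A →ₗ[ℝ] B} (hφ : φ ∈ clHom ρ ρ') (h0 : φ ≠ 0) : Function.Surjective φ := by
  rw [← LinearMap.range_eq_top]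
  refine (h (LinearMap.range φ) ?_).resolve_left fun h1 => h0 (LinearMap.range_eq_bot.1 h1)
  rintro k _ ⟨x, rfl⟩
  exact ⟨_, (mem_clHom.1 hφ k x).symm⟩

theorem exists_ne_zero_of_finrank_pos {H : Type*} [AddCommGroup H] [Module ℝ H]
    {E : Submodule ℝ H} (h : 0 < finrank ℝ E) : ∃ x ∈ E, x ≠ 0 := by
  by_contra! h'
  rw [(Submodule.eq_bot_iff E).2 h', finrank_bot] at h
  exact h.false

variable [FiniteDimensional ℝ A] [FiniteDimensional ℝ B]

/-- By the count, the endomorphisms have dimension 1, 2 or 4 and are spanned by 1, by 1 and ω_n, or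
by 1, I, J, IJ. Evaluating such a combination at a nonzero kernel vector makes all coefficients
vanish. -/
theorem IsModel.injective [Nontrivial A] {ρ : Cl n →ₐ[ℝ] End ℝ A} (h : IsModel ρ)
    (hn : n % 4 ≠ 3) {φ : End ℝ A} (hφ : φ ∈ clHom ρ ρ) (h0 : φ ≠ 0) : Function.Injective φ := by
  rw [injective_iff_map_eq_zero]
  intro x hx
  by_contra hx0
  apply h0
  -- The argument common to n ≡ 1 and n ≡ 5, where ω_n is the complex structure.
  have complex : n % 4 = 1 → finrank ℝ A ^ 2 = 2 ^ (n + 1) →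
      2 ^ n * finrank ℝ (clHom ρ ρ) = finrank ℝ A * finrank ℝ A → φ = 0 := by
    intro hn1 hd hc
    have hv := rho_vol_sq_neg (Or.inl hn1) ρ
    have hm : finrank ℝ (clHom ρ ρ) = 2 := by
      rw [← sq, hd, pow_succ] at hc
      exact Nat.eq_of_mul_eq_mul_left (by positivity) hc
    have hb : LinearIndependent ℝ ![(1 : End ℝ A), ρ (vol n)] := by
      rw [Fintype.linearIndependent_iff]
      intro c hc
      have := LinearMap.congr_fun hc x
      simp only [Fin.sum_univ_two] at this
      obtain ⟨h1, h2⟩ := complex_coeff_eq_zero hv hx0 this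
      exact Fin.forall_fin_two.2 ⟨h1, h2⟩
    obtain ⟨c, rfl⟩ := mem_span_of_finrank_eq hb (Fin.forall_fin_two.2 ⟨one_mem_clHom ρ,
      mem_clHom.2 fun k x => (rho_vol_e_odd (by rw [Nat.odd_iff]; omega) ρ k x).symm⟩) hm hφ
    simp only [Fin.sum_univ_two] at hx ⊢
    obtain ⟨h1, h2⟩ := complex_coeff_eq_zero hv hx0 hx
    simp [h1, h2]
  cases h with
  | real h hd =>
    have hc := finrank_clHom_of_target ρ ρ (IsTwist.of_vol (by rw [Nat.even_iff]; omega) ρ)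
    have hm : finrank ℝ (clHom ρ ρ) = 1 := by
      rw [← sq, hd] at hc
      exact Nat.eq_of_mul_eq_mul_left (by positivity) (hc.trans (mul_one _).symm)
    have hb : LinearIndependent ℝ ![(1 : End ℝ A)] := by
      rw [Fintype.linearIndependent_iff]
      intro c hc i
      have := LinearMap.congr_fun hc x
      rw [Subsingleton.elim i 0]
      simpa [hx0] using this
    obtain ⟨c, rfl⟩ := mem_span_of_finrank_eq hb (fun i => by
      rw [Subsingleton.elim i 0]; exact one_mem_clHom ρ) hm hφ
    have : c 0 = 0 := by simpa [hx0] using hx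
    simp [this]
  | complexReal h hd σ hσ hs => exact complex (by omega) hd (finrank_clHom_of_target ρ ρ hσ)
  | complexQuat h hd σ hσ hs => exact complex (by omega) hd (finrank_clHom_of_target ρ ρ hσ)
  | quat h hd I J hIJ =>
    have hc := finrank_clHom_of_target ρ ρ (IsTwist.of_vol (by rw [Nat.even_iff]; omega) ρ)
    have hm : finrank ℝ (clHom ρ ρ) = 4 := by
      rw [← sq, hd, pow_add] at hc
      exact Nat.eq_of_mul_eq_mul_left (by positivity) hc
    have hb : LinearIndependent ℝ ![(1 : End ℝ A), I, J, I * J] := by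
      rw [Fintype.linearIndependent_iff]
      intro c hc
      have := LinearMap.congr_fun hc x
      simp only [Fin.sum_univ_four] at this
      obtain ⟨h1, h2, h3, h4⟩ := quat_coeff_eq_zero hIJ.I_sq hIJ.J_sq hIJ.anti hx0 this
      simp [Fin.forall_fin_succ, h1, h2, h3, h4]
    obtain ⟨c, rfl⟩ := mem_span_of_finrank_eq hb (by
      simp only [Fin.forall_fin_succ]
      refine ⟨one_mem_clHom ρ, mem_clHom.2 fun k x => (hIJ.I_comm k x).symm,
        mem_clHom.2 fun k x => (hIJ.J_comm k x).symm, mem_clHom.2 fun k x => ?_, fun i => i.elim0⟩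
      simp [hIJ.I_comm, hIJ.J_comm]) hm hφ
    simp only [Fin.sum_univ_four] at hx ⊢
    obtain ⟨h1, h2, h3, h4⟩ := quat_coeff_eq_zero hIJ.I_sq hIJ.J_sq hIJ.anti hx0 hx
    simp [h1, h2, h3, h4]
  | quatVol h _ _ _ _ _ => omega
  | realVol h _ _ => omega

/-- The count gives nonzero homomorphisms ι from the module to the model and π back. Irreducibility
makes ι injective and π surjective, so ι ∘ π is a nonzero endomorphism of the model, hence
injective, and π is an isomorphism. Only the model needs a twist: it is the target for ι and the
source for π. -/
theorem IsIrr.isModel [Nontrivial A] {ρ : Cl n →ₐ[ℝ] End ℝ A} (h : IsIrr ρ) (hn : n % 4 ≠ 3) :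
    IsModel ρ := by
  obtain ⟨M, _, _, _, _, ρM, hM⟩ := exists_model n
  obtain ⟨τ, hτ⟩ := hM.exists_twist hn
  have hpos : 0 < finrank ℝ A * finrank ℝ M := Nat.mul_pos finrank_pos finrank_pos
  obtain ⟨ι, hι, hι0⟩ := exists_ne_zero_of_finrank_pos (E := clHom ρ ρM) (by
    rw [← finrank_clHom_of_target ρ ρM hτ] at hpos
    exact Nat.pos_of_mul_pos_left hpos)
  obtain ⟨π, hπ, hπ0⟩ := exists_ne_zero_of_finrank_pos (E := clHom ρM ρ) (by
    rw [mul_comm, ← finrank_clHom_of_source ρM ρ hτ] at hpos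
    exact Nat.pos_of_mul_pos_left hpos)
  have h1 := h.injective hι hι0
  have h2 := h.surjective hπ hπ0
  have h3 : ι ∘ₗ π ∈ clHom ρM ρM := mem_clHom.2 fun k x => by
    simp [mem_clHom.1 hι, mem_clHom.1 hπ]
  have h4 : ι ∘ₗ π ≠ 0 := fun h0 => hπ0 (LinearMap.ext fun x => h1 (by
    simpa using LinearMap.congr_fun h0 x))
  have h5 : Function.Injective π := Function.Injective.of_comp (f := ι) (hM.injective hn h3 h4)
  refine IsModel.congr (LinearEquiv.ofBijective π ⟨h5, h2⟩).symm (mem_clHom.2 fun k x => ?_) hM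
  obtain ⟨y, rfl⟩ := h2 x
  apply h5
  have hs : ∀ z, π ((LinearEquiv.ofBijective π ⟨h5, h2⟩).symm z) = z := fun z =>
    (LinearEquiv.ofBijective π ⟨h5, h2⟩).apply_symm_apply z
  simp [← mem_clHom.1 hπ, hs]

end Models

/-! ### Structures and metrics on the spinor modules -/

section SpinorFacts

open Module

variable {n : ℕ} {V : Type v} [NormedAddCommGroup V] [InnerProductSpace ℝ V]

/-- An irreducible module is cyclic, hence a quotient of the finite-dimensional algebra `Cl n`. -/
theorem SpinorModule.finiteDimensional (S : SpinorModule n V) : FiniteDimensional ℝ V := by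
  have := S.nontrivial
  have := finiteDimensional_cl n
  obtain ⟨v, hv⟩ := exists_ne (0 : V)
  let f : Cl n →ₗ[ℝ] V := (LinearMap.applyₗ v) ∘ₗ S.ρ.toLinearMap
  have hf : ∀ a, f a = S.ρ a v := fun a => rfl
  refine Module.Finite.of_surjective f (LinearMap.range_eq_top.1 ?_)
  refine (S.irreducible (LinearMap.range f) ?_).resolve_left ?_
  · rintro a _ ⟨b, rfl⟩
    exact ⟨a * b, by simp [hf]⟩
  · intro h
    apply hv
    have := LinearMap.congr_fun (LinearMap.range_eq_bot.1 h) 1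
    simpa [hf] using this

theorem SpinorModule.isIrr (S : SpinorModule n V) : IsIrr S.ρ := by
  intro U hU
  refine S.irreducible U fun a => ?_
  induction a using cl_induction with
  | h1 => exact fun x hx => by simpa using hx
  | he k => exact hU k
  | hmul a b ha hb => exact fun x hx => by simpa using ha _ (hb x hx)
  | hadd a b ha hb => exact fun x hx => by simpa using U.add_mem (ha x hx) (hb x hx)
  | hsmul r a ha => exact fun x hx => by simpa using U.smul_mem r (ha x hx)

/-- From ω_n e_{n+1} = 1 and ω_n² = -1. Hence the last generator acts through `Cl n`, and nothing is
lost on restricting to it. -/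
theorem e_last_eq_neg_vol {A : Type v} [AddCommGroup A] [Module ℝ A] {ρ : Cl (n + 1) →ₐ[ℝ] End ℝ A}
    (hn : n % 4 = 2) (h : ρ (vol (n + 1)) = 1) (x : A) :
    ρ (e (Fin.last n)) x = -ρ (incl n (vol n)) x := by
  have h1 : ρ (incl n (vol n)) (ρ (e (Fin.last n)) x) = x := by
    rw [← rho_mul_apply, ← vol_succ, h]; rfl
  have h2 := congrArg (ρ (incl n (vol n))) h1
  rw [← rho_mul_apply, ← map_mul, vol_sq_neg (Or.inr hn)] at h2
  rw [← h2]
  simp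

theorem SpinorModule.isModel (S : SpinorModule n V) : IsModel S.ρ := by
  have := S.nontrivial
  have := S.finiteDimensional
  by_cases hn : n % 4 = 3
  · obtain ⟨m, rfl⟩ : ∃ m, n = m + 1 := ⟨n - 1, by omega⟩
    have hv := S.positive hn
    have hl := e_last_eq_neg_vol (by omega) hv
    -- The last generator is -ω_m, so submodules for `Cl m` are submodules for the whole algebra;
    -- likewise, maps commuting with the first m generators commute with all.
    have hirr : IsIrr (S.ρ.comp (incl m)) := by
      intro U hU
      have h1 : ∀ a, ∀ x ∈ U, S.ρ (incl m a) x ∈ U := by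
        intro a
        induction a using cl_induction with
        | h1 => exact fun x hx => by simpa using hx
        | he k => exact hU k
        | hmul a b ha hb => exact fun x hx => by simpa using ha _ (hb x hx)
        | hadd a b ha hb => exact fun x hx => by simpa using U.add_mem (ha x hx) (hb x hx)
        | hsmul r a ha => exact fun x hx => by simpa using U.smul_mem r (ha x hx)
      refine S.isIrr U fun k => ?_
      refine Fin.lastCases ?_ (fun j => ?_) k
      · intro x hx
        rw [hl]
        exact U.neg_mem (h1 _ x hx)
      · rw [← incl_e]
        exact h1 _
    have hc : ∀ I : End ℝ V, (∀ k x, I (S.ρ (e (Fin.castSucc k)) x) = S.ρ (e (Fin.castSucc k)) (I x)) →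
        ∀ k x, I (S.ρ (e k) x) = S.ρ (e k) (I x) := by
      intro I hI k x
      refine Fin.lastCases ?_ (fun j => hI j x) k
      rw [hl, hl, map_neg]
      congr 1
      exact (clHom_apply (ρ := S.ρ.comp (incl m)) (ρ' := S.ρ.comp (incl m)) (φ := I)
        (mem_clHom.2 fun k x => by simp [incl_e, hI]) _ x).symm
    cases hirr.isModel (by omega) with
    | real h hd => exact .realVol (by omega) (by rw [hd]; ring) hv
    | complexReal h _ _ _ _ => omega
    | complexQuat h _ _ _ _ => omega
    | quat h hd I J hIJ =>
      refine .quatVol (by omega) hd hv I J ⟨hIJ.I_sq, hIJ.J_sq, hIJ.anti, hc I fun k x => ?_,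
        hc J fun k x => ?_⟩
      · simpa [incl_e] using hIJ.I_comm k x
      · simpa [incl_e] using hIJ.J_comm k x
    | quatVol h _ _ _ _ _ => omega
    | realVol h _ _ => omega
  · exact S.isIrr.isModel hn

theorem isQuaternionic_iff (S : SpinorModule n V) (I J : End ℝ V) :
    S.IsQuaternionic I J ↔ IsQuat S.ρ I J := by
  constructor
  · intro h
    exact ⟨fun x => LinearMap.congr_fun h.I_sq x, fun x => LinearMap.congr_fun h.J_sq x,
      fun x => LinearMap.congr_fun h.anticomm x, fun k x => LinearMap.congr_fun (h.I_clifford _) x,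
      fun k x => LinearMap.congr_fun (h.J_clifford _) x⟩
  · intro h
    exact ⟨LinearMap.ext h.I_sq, LinearMap.ext h.J_sq, LinearMap.ext h.anti,
      fun a => LinearMap.ext fun x =>
        (clHom_apply (mem_clHom.2 fun k x => (h.I_comm k x).symm) a x).symm,
      fun a => LinearMap.ext fun x =>
        (clHom_apply (mem_clHom.2 fun k x => (h.J_comm k x).symm) a x).symm⟩

theorem IsTwist.commutesWithSpin {S : SpinorModule n V} {τ : End ℝ V} (h : IsTwist S.ρ τ) :
    S.CommutesWithSpin τ := fun _ hg =>
  LinearMap.ext fun x => h.even (spinGroup.mem_even hg) x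

/-- τ commutes with the even element e_k ω_n and anticommutes with ω_n; as ω_n is invertible, τ
anticommutes with e_k. -/
theorem SpinorModule.CommutesWithSpin.isTwist {S : SpinorModule n V} (hn : Odd n) {τ : End ℝ V}
    (h : S.CommutesWithSpin τ) (hω : τ * S.om = -(S.om * τ)) (hinj : Function.Injective τ) :
    IsTwist S.ρ τ := by
  refine ⟨hinj, fun k x => ?_⟩
  have h1 : ∀ a ∈ CliffordAlgebra.even (cliffordForm n), ∀ x, τ (S.ρ a x) = S.ρ a (τ x) :=
    fun a ha x => (even_apply (fun k l x =>
      (LinearMap.congr_fun (h _ (e_mul_e_mem_spin k l)) x).symm) ha x).symm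
  have h2 : ∀ x, τ (S.ρ (vol n) x) = -S.ρ (vol n) (τ x) := fun x => LinearMap.congr_fun hω x
  obtain ⟨y, rfl⟩ : ∃ y, S.ρ (vol n) y = x := by
    refine ⟨((-1 : ℝ) ^ (n * (n + 1) / 2)) • S.ρ (vol n) x, ?_⟩
    rw [map_smul, rho_vol_sq, smul_smul, ← mul_pow]
    simp
  rw [← rho_mul_apply, h1 _ (e_mul_vol_mem_even hn k), h2, map_neg, neg_neg, rho_mul_apply]

theorem SpinorModule.IsRealStructure.isTwist {S : SpinorModule n V} (hn : n % 8 = 1) {σ : End ℝ V}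
    (h : S.IsRealStructure σ) : IsTwist S.ρ σ :=
  SpinorModule.CommutesWithSpin.isTwist (by rw [Nat.odd_iff]; omega) h.spin h.antilinear
    (Function.LeftInverse.injective (g := σ) fun x => LinearMap.congr_fun h.involutive x)

theorem SpinorModule.IsSpinQuaternionic.isTwist {S : SpinorModule n V} (hn : n % 8 = 5)
    {J : End ℝ V} (h : S.IsSpinQuaternionic S.om J) : IsTwist S.ρ J :=
  SpinorModule.CommutesWithSpin.isTwist (by rw [Nat.odd_iff]; omega) h.J_spin
    (by rw [h.anticomm, neg_neg]) (injective_of_sq_neg fun x => LinearMap.congr_fun h.J_sq x)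

/-- Everything is carried by the models, except for n ≡ 6, where -ω_n serves by itself. -/
theorem SpinorModule.hasStructures (S : SpinorModule n V) : S.HasStructures := by
  refine ⟨fun hn => ?_, fun hn => ?_, fun hn => ?_, fun hn => ?_⟩
  · cases S.isModel with
    | complexReal h hd σ hσ hs =>
      exact ⟨σ, LinearMap.ext hs,
        LinearMap.ext fun x => hσ.vol_odd (by rw [Nat.odd_iff]; omega) x, hσ.commutesWithSpin⟩
    | _ => omega
  · cases S.isModel with
    | quat h hd I J hIJ => exact ⟨I, J, (isQuaternionic_iff S I J).2 hIJ⟩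
    | quatVol h hd hv I J hIJ => exact ⟨I, J, (isQuaternionic_iff S I J).2 hIJ⟩
    | _ => omega
  · have ho : Odd n := by rw [Nat.odd_iff]; omega
    cases S.isModel with
    | complexQuat h hd J hJ hs =>
      refine ⟨J, LinearMap.ext fun x => rho_vol_sq_neg (by omega) S.ρ x, LinearMap.ext hs,
        LinearMap.ext fun x => ?_, fun g _ => LinearMap.ext fun x => ?_, hJ.commutesWithSpin⟩
      · exact (neg_eq_iff_eq_neg.2 (hJ.vol_odd ho x)).symm
      · exact clHom_apply (mem_clHom.2 fun k x => (rho_vol_e_odd ho S.ρ k x).symm) g x |>.symm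
    | _ => omega
  · have he : Even n := by rw [Nat.even_iff]; omega
    refine ⟨LinearMap.ext fun x => ?_, fun g hg => ?_⟩
    · simp [SpinorModule.om, rho_vol_sq_neg (n := n) (by omega) S.ρ]
    · rw [neg_mul, mul_neg]
      exact congrArg _ ((IsTwist.of_vol he S.ρ).commutesWithSpin g hg)

/-- An isometry with square -1 is skew-adjoint. -/
theorem SpinorModule.inner_e (S : SpinorModule n V) (k : Fin n) (x y : V) :
    inner ℝ (S.ρ (e k) x) y = -inner ℝ x (S.ρ (e k) y) := by
  let f : V →ₗᵢ[ℝ] V := ⟨S.ρ (e k), S.isometric k⟩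
  have h := f.inner_map_map x (S.ρ (e k) y)
  have h1 : ∀ z, f z = S.ρ (e k) z := fun z => rfl
  rw [h1, h1, rho_e_sq, inner_neg_right] at h
  rw [← h, neg_neg]

variable {W : Type w} [NormedAddCommGroup W] [InnerProductSpace ℝ W]

/-- A bijective intertwiner of skew-symmetric irreducible actions is a multiple of an isometry. -/
theorem exists_norm_eq_mul [FiniteDimensional ℝ V] [FiniteDimensional ℝ W] [Nontrivial W]
    {ι : Type*} {f : ι → End ℝ V} {g : ι → End ℝ W}
    (hf : ∀ i x y, inner ℝ (f i x) y = -inner ℝ x (f i y))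
    (hg : ∀ i x y, inner ℝ (g i x) y = -inner ℝ x (g i y))
    (hirr : ∀ U : Submodule ℝ W, (∀ i, ∀ x ∈ U, g i x ∈ U) → U = ⊥ ∨ U = ⊤)
    (φ : V →ₗ[ℝ] W) (hφ : ∀ i x, g i (φ x) = φ (f i x)) (hinj : Function.Injective φ)
    (hs : Function.Surjective φ) :
    ∃ r : ℝ, 0 < r ∧ ∀ x, ‖φ x‖ = r * ‖x‖ := by
  let ψ := LinearMap.adjoint φ
  -- Since both actions are skew, the adjoint intertwines them in the other direction; so φψ
  -- commutes with the action on `W`.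
  have hψ : ∀ i x, f i (ψ x) = ψ (g i x) := by
    intro i x
    refine ext_inner_right ℝ fun y => ?_
    rw [hf, LinearMap.adjoint_inner_left, LinearMap.adjoint_inner_left, ← hφ, hg]
  obtain ⟨c, hc⟩ : ∃ c : ℝ, End.HasEigenvalue (φ ∘ₗ ψ) c :=
    ⟨_, (LinearMap.isSymmetric_self_comp_adjoint φ).hasEigenvalue_iSup_of_finiteDimensional⟩
  -- The symmetric map φψ has an eigenvalue; its eigenspace is invariant, hence everything.
  have htop : End.eigenspace (φ ∘ₗ ψ) c = ⊤ := by
    refine (hirr _ fun i x hx => ?_).resolve_left hc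
    rw [End.mem_eigenspace_iff] at hx ⊢
    rw [← map_smul, ← hx, LinearMap.comp_apply, LinearMap.comp_apply, ← hψ, hφ]
  have h1 : ∀ x, ψ (φ x) = c • x := fun x => hinj (by
    have : φ x ∈ End.eigenspace (φ ∘ₗ ψ) c := htop ▸ Submodule.mem_top
    rw [map_smul]
    exact End.mem_eigenspace_iff.1 this)
  have h2 : ∀ x, ‖φ x‖ ^ 2 = c * ‖x‖ ^ 2 := fun x => by
    rw [← real_inner_self_eq_norm_sq, ← real_inner_self_eq_norm_sq,
      ← LinearMap.adjoint_inner_left, ← real_inner_smul_left, ← h1]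
  have hc0 : 0 < c := by
    obtain ⟨y, hy⟩ := exists_ne (0 : W)
    obtain ⟨x, rfl⟩ := hs y
    have h3 : 0 < ‖φ x‖ ^ 2 := by positivity
    rw [h2] at h3
    exact pos_of_mul_pos_left h3 (by positivity)
  refine ⟨Real.sqrt c, Real.sqrt_pos.2 hc0, fun x => ?_⟩
  rw [← Real.sqrt_sq (norm_nonneg (φ x)), h2, Real.sqrt_mul hc0.le, Real.sqrt_sq (norm_nonneg x)]

/-- Invariant subspaces of the target pull back along the bijection φ. This is used where the
operators on the target come only from e_1, …, e_n, whose irreducibility is known on Σ_n. -/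
theorem exists_norm_eq_mul_of_source [FiniteDimensional ℝ V] [FiniteDimensional ℝ W] [Nontrivial W]
    {ι : Type*} {f : ι → End ℝ V} {g : ι → End ℝ W}
    (hf : ∀ i x y, inner ℝ (f i x) y = -inner ℝ x (f i y))
    (hg : ∀ i x y, inner ℝ (g i x) y = -inner ℝ x (g i y))
    (hirr : ∀ U : Submodule ℝ V, (∀ i, ∀ x ∈ U, f i x ∈ U) → U = ⊥ ∨ U = ⊤)
    (φ : V →ₗ[ℝ] W) (hφ : ∀ i x, g i (φ x) = φ (f i x)) (hinj : Function.Injective φ)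
    (hs : Function.Surjective φ) :
    ∃ r : ℝ, 0 < r ∧ ∀ x, ‖φ x‖ = r * ‖x‖ := by
  refine exists_norm_eq_mul hf hg (fun U hU => ?_) φ hφ hinj hs
  have h := Submodule.map_comap_eq_of_surjective hs U
  refine (hirr (U.comap φ) fun i x hx => ?_).imp (fun h' => ?_) (fun h' => ?_)
  · rw [Submodule.mem_comap] at hx ⊢
    rw [← hφ]
    exact hU i _ hx
  · rw [← h, h', Submodule.map_bot]
  · rw [← h, h', Submodule.map_top, LinearMap.range_eq_top.2 hs]

/-- A property of linear maps that defines a line spanned by a multiple of an isometry. -/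
theorem orthogonalUnique_of_finrank (P : (V →ₗ[ℝ] W) → Prop) (H : Submodule ℝ (V →ₗ[ℝ] W))
    (hP : ∀ φ, P φ ↔ φ ∈ H) (hH : finrank ℝ H = 1)
    (hiso : ∀ φ ∈ H, φ ≠ 0 → Function.Surjective φ ∧ ∃ r : ℝ, 0 < r ∧ ∀ x, ‖φ x‖ = r * ‖x‖) :
    OrthogonalUnique P := by
  obtain ⟨φ, hφ, hφ0⟩ := exists_ne_zero_of_finrank_pos (E := H) (by rw [hH]; exact one_pos)
  obtain ⟨hs, r, hr, hn⟩ := hiso φ hφ hφ0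
  let ψ : V →ₗᵢ[ℝ] W := ⟨r⁻¹ • φ, fun x => by
    rw [LinearMap.smul_apply, norm_smul, hn, norm_inv, Real.norm_of_nonneg hr.le,
      inv_mul_cancel_left₀ hr.ne']⟩
  have hψs : Function.Surjective ψ := fun y => by
    obtain ⟨x, rfl⟩ := hs y
    exact ⟨r • x, by simp [ψ, hr.ne']⟩
  have hψ : (LinearIsometryEquiv.ofSurjective ψ hψs).toLinearEquiv.toLinearMap = r⁻¹ • φ := rfl
  refine ⟨LinearIsometryEquiv.ofSurjective ψ hψs, ?_, fun χ hχ => ?_⟩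
  · rw [hψ, hP]
    exact H.smul_mem _ hφ
  · rw [hψ]
    obtain ⟨c, hc⟩ := (finrank_eq_one_iff_of_nonzero' (⟨φ, hφ⟩ : H)
      (fun h => hφ0 (congrArg Subtype.val h))).1 hH ⟨χ, (hP χ).1 hχ⟩
    refine ⟨c * r, ?_⟩
    rw [smul_smul, mul_assoc, mul_inv_cancel₀ hr.ne', mul_one]
    exact (congrArg Subtype.val hc).symm

end SpinorFacts

/-! ### Existence and uniqueness of Φ for n ≡ 0, 2, 4, 5, 6 -/

section Existence

open Module

variable {n : ℕ} {V : Type v} [NormedAddCommGroup V] [InnerProductSpace ℝ V]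
  {W : Type w} [NormedAddCommGroup W] [InnerProductSpace ℝ W]

namespace SpinorModule

theorem finrank_sq_real (S : SpinorModule n V) (h : n % 8 = 0 ∨ n % 8 = 6) :
    finrank ℝ V ^ 2 = 2 ^ n := by
  cases S.isModel with
  | real _ hd => exact hd
  | _ => omega

theorem finrank_sq_complex (S : SpinorModule n V) (h : n % 8 = 1 ∨ n % 8 = 5 ∨ n % 8 = 3) :
    finrank ℝ V ^ 2 = 2 ^ (n + 1) := by
  cases S.isModel with
  | complexReal _ hd => exact hd
  | complexQuat _ hd => exact hd
  | quatVol _ hd => exact hd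
  | _ => omega

theorem finrank_sq_quat (S : SpinorModule n V) (h : n % 8 = 2 ∨ n % 8 = 4) :
    finrank ℝ V ^ 2 = 2 ^ (n + 2) := by
  cases S.isModel with
  | quat _ hd => exact hd
  | _ => omega

theorem two_mul_finrank_sq_realVol (S : SpinorModule n V) (h : n % 8 = 7) :
    2 * finrank ℝ V ^ 2 = 2 ^ n := by
  cases S.isModel with
  | realVol _ hd => exact hd
  | _ => omega

theorem inner_rho (S : SpinorModule n V) (a : Cl n) (x y : V) :
    inner ℝ (S.ρ a x) y = inner ℝ x (S.ρ (star a) y) := by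
  induction a using cl_induction generalizing x y with
  | h1 => simp
  | he k =>
    have : star (e k : Cl n) = -e k := CliffordAlgebra.star_ι _
    rw [this, S.inner_e]; simp
  | hmul a b ha hb => simp [ha, hb]
  | hadd a b ha hb => simp [ha, hb, inner_add_left, inner_add_right]
  | hsmul r a ha => simp [ha, CliffordAlgebra.star_smul, inner_smul_left, inner_smul_right]

end SpinorModule

theorem star_vol_mul_vol (n : ℕ) : star (vol n) * vol n = 1 := by
  have hs : ∀ k : Fin n, star (e k : Cl n) = -e k := fun k => CliffordAlgebra.star_ι _
  have : vol n ∈ unitary (Cl n) := by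
    refine Submonoid.list_prod_mem _ fun x hx => ?_
    obtain ⟨k, rfl⟩ := List.mem_ofFn.1 hx
    exact ⟨by simp [hs, e_mul_self], by simp [hs, e_mul_self]⟩
  exact this.1

theorem star_vol_of_sq {n : ℕ} (h : vol n * vol n = 1) : star (vol n) = vol n := by
  have := star_vol_mul_vol n
  calc star (vol n) = star (vol n) * (vol n * vol n) := by rw [h, mul_one]
    _ = vol n := by rw [← mul_assoc, this, one_mul]

theorem inner_mulI (z w : ℂ) : inner ℝ (mulI z) w = -inner ℝ z (mulI w) := by
  simp [Complex.inner, mulI]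
  ring

theorem inner_map_skew {a : End ℝ V} {b : End ℝ W} (ha : ∀ x y, inner ℝ (a x) y = inner ℝ x (a y))
    (hb : ∀ x y, inner ℝ (b x) y = -inner ℝ x (b y)) (x y : V ⊗[ℝ] W) :
    inner ℝ (TensorProduct.map a b x) y = -inner ℝ x (TensorProduct.map a b y) := by
  induction x with
  | zero => simp
  | tmul x z =>
    induction y with
    | zero => simp
    | tmul y w => simp [TensorProduct.inner_tmul, ha, hb]
    | add y y' h h' => rw [map_add, inner_add_right, inner_add_right, h, h', neg_add]
  | add x x' h h' => rw [map_add, inner_add_left, inner_add_left, h, h', neg_add]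

theorem surjective_of_injective_of_sq [FiniteDimensional ℝ V] [FiniteDimensional ℝ W]
    {φ : V →ₗ[ℝ] W} (h : Function.Injective φ) (hd : finrank ℝ V ^ 2 = finrank ℝ W ^ 2) :
    Function.Surjective φ :=
  (LinearMap.injective_iff_surjective_of_finrank_eq_finrank
    (Nat.pow_left_injective two_ne_zero hd)).1 h

/-- Here k is the total number of halvings, and a² = b² = 2^k says that they use up dim A · dim B
exactly. -/
theorem finrank_eq_one_of {k a b f : ℕ} (h : 2 ^ k * f = a * b) (ha : a ^ 2 = 2 ^ k)
    (hab : a ^ 2 = b ^ 2) : f = 1 := by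
  have hb : a = b := Nat.pow_left_injective two_ne_zero hab
  rw [← hb, ← sq, ha] at h
  exact Nat.eq_of_mul_eq_mul_left (by positivity) (h.trans (mul_one _).symm)

/-- The action of the even part on the complexification. -/
theorem complexification_even {A : Type v} [AddCommGroup A] [Module ℝ A] (hn : n % 4 = 0)
    {ρ : Cl n →ₐ[ℝ] End ℝ A} {ρ' : Cl (n + 1) →ₐ[ℝ] End ℝ (A ⊗[ℝ] ℂ)}
    (h1 : ∀ k, ρ' (e (Fin.castSucc k)) = TensorProduct.map (ρ (vol n * e k)) mulI) {a : Cl n}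
    (ha : a ∈ CliffordAlgebra.even (cliffordForm n)) (x : A ⊗[ℝ] ℂ) :
    ρ' (incl n a) x = TensorProduct.map (ρ a) LinearMap.id x := by
  have he : Even n := by rw [Nat.even_iff]; omega
  have hi : ∀ z, mulI (mulI z) = -z := fun z => LinearMap.congr_fun mulI_mul_mulI z
  refine even_apply (ρ := (End.rTensorAlgHom ℝ A ℂ).comp ρ) (ρ' := ρ'.comp (incl n))
    (φ := LinearMap.id) (fun k l x => ?_) ha x
  suffices h : ρ' (incl n (e k * e l)) = TensorProduct.map (ρ (e k * e l)) LinearMap.id from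
    LinearMap.congr_fun h x
  refine TensorProduct.ext' fun x z => ?_
  simp [incl_e, h1, hi, rho_vol_e_even he, rho_vol_sq_pos (Or.inl hn), TensorProduct.tmul_neg,
    TensorProduct.neg_tmul]

/-- Φ is a `Cl (n + 1)`-homomorphism from the complexified module that matches conjugation with σ: n
+ 1 halvings and one more, against the squared dimension 4 · 2^n. -/
theorem orthogonalUnique_intertwines0 (S : SpinorModule n V) (T : SpinorModule (n + 1) W)
    (hn : n % 8 = 0) {σ : End ℝ W} (hσ : T.IsRealStructure σ) :
    OrthogonalUnique (Intertwines0 S T σ) := by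
  have := S.finiteDimensional
  have := T.finiteDimensional
  have := T.nontrivial
  obtain ⟨ρ', h1, h2, h3⟩ := exists_complexification (by omega) S.ρ
  have hc := finrank_clHom_twist (by rw [Nat.odd_iff]; omega) ρ' T.ρ h3 (hσ.isTwist (by omega)) 1
    (one_mul 1) (fun x => by
      rw [one_smul]
      induction x with
      | zero => simp
      | tmul x z => simp [conjC]
      | add x y hx hy => simp only [map_add, hx, hy])
    (fun x => by rw [one_smul]; exact LinearMap.congr_fun hσ.involutive x)
  have hd : finrank ℝ (V ⊗[ℝ] ℂ) ^ 2 = 2 ^ (n + 1 + 1) := by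
    rw [finrank_tensorProduct, Complex.finrank_real_complex, mul_pow,
      S.finrank_sq_real (Or.inl hn)]
    ring
  have hd' : finrank ℝ (V ⊗[ℝ] ℂ) ^ 2 = finrank ℝ W ^ 2 := by
    rw [hd, T.finrank_sq_complex (by omega)]
  refine orthogonalUnique_of_finrank _ _ (fun φ => ⟨fun h => ?_, fun h => ?_⟩)
    (finrank_eq_one_of hc hd hd') ?_
  · refine ⟨mem_clHom.2 fun k x => ?_, mem_inter.2 fun x => LinearMap.congr_fun h.real x⟩
    refine Fin.lastCases ?_ (fun j => ?_) k
    · rw [h2]; exact LinearMap.congr_fun h.clifford_last x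
    · rw [h1]; exact LinearMap.congr_fun (h.clifford j) x
  · have h4 := clHom_apply h.1
    have h5 : ∀ a ∈ CliffordAlgebra.even (cliffordForm n), ∀ x, T.ρ (incl n a) (φ x) =
        φ (TensorProduct.map (S.ρ a) LinearMap.id x) := fun a ha x => by
      rw [h4, complexification_even (by omega) h1 ha]
    refine ⟨fun g hg => LinearMap.ext fun x => h5 g (spinGroup.mem_even hg) x,
      LinearMap.ext fun x => ?_, LinearMap.ext h.2, fun k => LinearMap.ext fun x => ?_,
      LinearMap.ext fun x => ?_⟩
    -- ω_{n+1} = ω_n e_{n+1} acts on the source as ω_n² ⊗ i = 1 ⊗ i, which is complex linearity.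
    · rw [LinearMap.comp_apply, LinearMap.comp_apply, SpinorModule.om, vol_succ, rho_mul_apply, h4,
        h2, h5 _ (vol_mem_even (by rw [Nat.even_iff]; omega))]
      congr 1
      induction x with
      | zero => simp
      | tmul x z => simp [rho_vol_sq_pos (n := n) (by omega)]
      | add x y hx hy => simp only [map_add, hx, hy]
    · rw [LinearMap.comp_apply, LinearMap.comp_apply, h4, h1]
    · rw [LinearMap.comp_apply, LinearMap.comp_apply, h4, h2]
  · intro φ hφ h0
    -- Only the target is known to be irreducible, so surjectivity comes first and injectivity
    -- follows by dimension.
    have hs := T.isIrr.surjective hφ.1 h0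
    have hinj := (LinearMap.injective_iff_surjective_of_finrank_eq_finrank
      (Nat.pow_left_injective two_ne_zero hd')).2 hs
    refine ⟨hs, exists_norm_eq_mul (f := fun k => ρ' (e k)) (fun k => ?_) T.inner_e T.isIrr φ
      (mem_clHom.1 hφ.1) hinj hs⟩
    have hv := star_vol_of_sq (vol_sq_pos (n := n) (by omega))
    have hstar : ∀ k : Fin n, star (e k : Cl n) = -e k := fun k => CliffordAlgebra.star_ι _
    refine Fin.lastCases ?_ (fun j => ?_) k
    · rw [h2]
      exact inner_map_skew (fun x y => by rw [S.inner_rho, hv]) inner_mulI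
    · rw [h1]
      refine inner_map_skew (fun x y => ?_) inner_mulI
      rw [S.inner_rho, star_mul, hv, hstar, vol_mul_e_even (by rw [Nat.even_iff]; omega), neg_mul]

/-- Only e_1, …, e_n and I, J are imposed, n + 2 halvings in all. The formula for e_{n+1} is
automatic because ω_{n+1} = 1 on the target. -/
theorem orthogonalUnique_intertwines2 (S : SpinorModule n V) (T : SpinorModule (n + 1) W)
    (hn : n % 8 = 2) {I J : End ℝ V} (hS : S.IsQuaternionic I J) {I' J' : End ℝ W}
    (hT : T.IsQuaternionic I' J') : OrthogonalUnique (Intertwines2 S T I J I' J') := by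
  have := S.finiteDimensional
  have := T.finiteDimensional
  have := T.nontrivial
  rw [isQuaternionic_iff] at hS hT
  have hq : IsQuat (T.ρ.comp (incl n)) I' J' := ⟨hT.I_sq, hT.J_sq, hT.anti,
    fun k x => by simp [incl_e, hT.I_comm], fun k x => by simp [incl_e, hT.J_comm]⟩
  have hc := finrank_clHom_quat (by rw [Nat.even_iff]; omega) S.ρ (T.ρ.comp (incl n)) hS hq
  have hd := S.finrank_sq_quat (Or.inl hn)
  have hd' : finrank ℝ V ^ 2 = finrank ℝ W ^ 2 := by
    rw [hd, T.finrank_sq_complex (by omega)]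
  refine orthogonalUnique_of_finrank _ _ (fun φ => ⟨fun h => ?_, fun h => ?_⟩)
    (finrank_eq_one_of hc hd hd') ?_
  · refine ⟨⟨mem_clHom.2 fun k x => ?_, fun x => LinearMap.congr_fun h.linear_I x⟩,
      fun x => LinearMap.congr_fun h.linear_J x⟩
    rw [AlgHom.comp_apply, incl_e]
    exact LinearMap.congr_fun (h.clifford k) x
  · have h4 : ∀ a x, T.ρ (incl n a) (φ x) = φ (S.ρ a x) := clHom_apply h.1.1
    refine ⟨fun g _ => LinearMap.ext (h4 g), LinearMap.ext h.1.2, LinearMap.ext h.2,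
      fun k => LinearMap.ext fun x => ?_, LinearMap.ext fun x => ?_⟩
    · rw [← incl_e]; exact h4 _ x
    · rw [LinearMap.comp_apply, e_last_eq_neg_vol (by omega) (T.positive (by omega)), h4]; rfl
  · intro φ hφ h0
    have hinj := S.isIrr.injective hφ.1.1 h0
    have hs := surjective_of_injective_of_sq hinj hd'
    exact ⟨hs, exists_norm_eq_mul_of_source S.inner_e (g := fun k => T.ρ (e (Fin.castSucc k)))
      (fun k => T.inner_e _) S.isIrr φ (fun k x => by
        rw [← incl_e]; exact clHom_apply hφ.1.1 _ x) hinj hs⟩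

/-- The n Clifford conditions alone give a line; ω_{n+1} = 1 forces e_{n+1} = -ω_n, which is I. -/
theorem orthogonalUnique_intertwines6 (S : SpinorModule n V) (T : SpinorModule (n + 1) W)
    (hn : n % 8 = 6) : OrthogonalUnique (Intertwines6 S T (-S.om)) := by
  have := S.finiteDimensional
  have := T.finiteDimensional
  have := T.nontrivial
  have he : Even n := by rw [Nat.even_iff]; omega
  have hc := finrank_clHom_of_source S.ρ (T.ρ.comp (incl n)) (IsTwist.of_vol he S.ρ)
  have hd := S.finrank_sq_real (Or.inr hn)
  have hd' : finrank ℝ V ^ 2 = finrank ℝ W ^ 2 := by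
    have := T.two_mul_finrank_sq_realVol (by omega)
    rw [pow_succ 2 n] at this
    omega
  refine orthogonalUnique_of_finrank _ _ (fun φ => ⟨fun h => ?_, fun h => ?_⟩)
    (finrank_eq_one_of hc hd hd') ?_
  · refine mem_clHom.2 fun k x => ?_
    rw [AlgHom.comp_apply, incl_e]
    exact LinearMap.congr_fun (h.clifford k) x
  · have h4 : ∀ a x, T.ρ (incl n a) (φ x) = φ (S.ρ a x) := clHom_apply h
    refine ⟨fun g _ => LinearMap.ext (h4 g), fun k => LinearMap.ext fun x => ?_,
      LinearMap.ext fun x => ?_⟩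
    · rw [← incl_e]; exact h4 _ x
    · rw [LinearMap.comp_apply, e_last_eq_neg_vol (by omega) (T.positive (by omega)), h4]
      simp [SpinorModule.om]
  · intro φ hφ h0
    have hinj := S.isIrr.injective hφ h0
    have hs := surjective_of_injective_of_sq hinj hd'
    exact ⟨hs, exists_norm_eq_mul_of_source S.inner_e (g := fun k => T.ρ (e (Fin.castSucc k)))
      (fun k => T.inner_e _) S.isIrr φ (fun k x => by
        rw [← incl_e]; exact clHom_apply hφ _ x) hinj hs⟩

/-- On the source e_{n+1} is Iω_n and the quaternionic twist is Jω_n, to be matched with J'.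
Linearity over I then follows, as ω_{n+1} = ω_n e_{n+1} acts as ω_n I ω_n = I. -/
theorem orthogonalUnique_intertwines4 (S : SpinorModule n V) (T : SpinorModule (n + 1) W)
    (hn : n % 8 = 4) {I J : End ℝ V} (hS : S.IsQuaternionic I J) {J' : End ℝ W}
    (hT : T.IsSpinQuaternionic T.om J') : OrthogonalUnique (Intertwines4 S T I J T.om J') := by
  have := S.finiteDimensional
  have := T.finiteDimensional
  have := T.nontrivial
  rw [isQuaternionic_iff] at hS
  obtain ⟨ρ', h1, h2, h3, h3'⟩ := exists_quat_extension (by omega) hS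
  have hc := finrank_clHom_twist (by rw [Nat.odd_iff]; omega) ρ' T.ρ h3 (hT.isTwist (by omega)) (-1)
    (by norm_num) (by simpa using h3') (fun x => by simpa using LinearMap.congr_fun hT.J_sq x)
  have hd := S.finrank_sq_quat (Or.inr hn)
  have hd' : finrank ℝ V ^ 2 = finrank ℝ W ^ 2 := by
    rw [hd, T.finrank_sq_complex (by omega)]
  have hv := rho_vol_sq_pos (n := n) (by omega) S.ρ
  have hI : ∀ a x, I (S.ρ a x) = S.ρ a (I x) := fun a x =>
    (clHom_apply (mem_clHom.2 fun k x => (hS.I_comm k x).symm) a x).symm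
  have h4 : ∀ φ ∈ clHom ρ' T.ρ, ∀ a x, T.ρ (incl n a) (φ x) = φ (S.ρ a x) := fun φ hφ a x => by
    rw [clHom_apply hφ, incl_vol_apply h1]
  have h5 : ∀ φ ∈ clHom ρ' T.ρ, ∀ x, T.om (φ x) = φ (I x) := fun φ hφ x => by
    rw [SpinorModule.om, vol_succ, rho_mul_apply, clHom_apply hφ, h2, h4 φ hφ]
    simp [hI, hv]
  refine orthogonalUnique_of_finrank _ _ (fun φ => ⟨fun h => ?_, fun h => ?_⟩)
    (finrank_eq_one_of hc hd hd') ?_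
  · refine ⟨mem_clHom.2 fun k x => ?_, fun x => LinearMap.congr_fun h.linear_J x⟩
    refine Fin.lastCases ?_ (fun j => ?_) k
    · rw [h2]
      exact (LinearMap.congr_fun h.clifford_last x).trans (LinearMap.congr_fun h.linear_I _)
    · rw [h1]
      exact LinearMap.congr_fun (h.clifford j) x
  · refine ⟨fun g _ => LinearMap.ext (h4 φ h.1 g), LinearMap.ext (h5 φ h.1), LinearMap.ext h.2,
      fun k => LinearMap.ext fun x => ?_, LinearMap.ext fun x => ?_⟩
    · rw [← incl_e]; exact h4 φ h.1 _ x
    · rw [LinearMap.comp_apply, mem_clHom.1 h.1, h2]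
      exact (h5 φ h.1 _).symm
  · intro φ hφ h0
    have hφ' : φ ∈ clHom S.ρ (T.ρ.comp (incl n)) := mem_clHom.2 fun k => h4 φ hφ.1 _
    have hinj := S.isIrr.injective hφ' h0
    have hs := surjective_of_injective_of_sq hinj hd'
    exact ⟨hs, exists_norm_eq_mul_of_source S.inner_e (g := fun k => T.ρ (e (Fin.castSucc k)))
      (fun k => T.inner_e _) S.isIrr φ (fun k x => by
        rw [← incl_e]; exact clHom_apply hφ' _ x) hinj hs⟩

/-- The source is Σ_n with e_k acting as -e_k J and e_{n+1} as J. As n + 1 is even, the volume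
element is a twist, and the n + 1 Clifford conditions suffice. -/
theorem orthogonalUnique_intertwines5 (S : SpinorModule n V) (T : SpinorModule (n + 1) W)
    (hn : n % 8 = 5) {J : End ℝ V} (hS : S.IsSpinQuaternionic S.om J) :
    OrthogonalUnique (Intertwines5 S T S.om J) := by
  have := S.finiteDimensional
  have := T.finiteDimensional
  have := T.nontrivial
  have ho : Odd n := by rw [Nat.odd_iff]; omega
  have hJ := hS.isTwist hn
  have hJJ : ∀ x, J (J x) = -x := fun x => LinearMap.congr_fun hS.J_sq x
  obtain ⟨ρ', h1, h2⟩ := exists_twist_extension hJ hJJ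
  have hc := finrank_clHom_of_source ρ' T.ρ (IsTwist.of_vol ho.add_one ρ')
  have hd := S.finrank_sq_complex (Or.inr (Or.inl hn))
  have hd' : finrank ℝ V ^ 2 = finrank ℝ W ^ 2 := by
    rw [hd, T.finrank_sq_real (by omega)]
  have hev : ∀ a ∈ CliffordAlgebra.even (cliffordForm n), ∀ x, ρ' (incl n a) x = S.ρ a x :=
    fun a ha x => even_apply (ρ := S.ρ) (ρ' := ρ'.comp (incl n)) (φ := LinearMap.id)
      (fun k l x => by simp [incl_e, h1, hJ.anti, hJJ]) ha x
  have h4 : ∀ φ ∈ clHom ρ' T.ρ, ∀ k x,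
      T.ρ (e (Fin.castSucc k) * e (Fin.last n)) (φ x) = φ (S.ρ (e k) x) := fun φ hφ k x => by
    rw [rho_mul_apply, clHom_apply hφ, clHom_apply hφ, h1, h2]
    simp [hJJ]
  -- ω_n is odd, so only its even factor acts as before; the remaining vector acts as -e_0 J, and J
  -- then meets e_{n+1} = J.
  have hvol : ∀ x, ρ' (vol (n + 1)) x = S.om x := fun x => by
    obtain ⟨m, rfl⟩ : ∃ m, n = m + 1 := ⟨n - 1, by omega⟩
    have hz : vol (m + 1) = e 0 * -(e 0 * vol (m + 1)) := by
      rw [mul_neg, ← mul_assoc, e_mul_self]; simp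
    rw [vol_succ, rho_mul_apply, h2, hz, map_mul, rho_mul_apply, map_neg, map_neg, incl_e, h1,
      LinearMap.neg_apply, LinearMap.neg_apply, hev _ (e_mul_vol_mem_even ho 0)]
    simp [hJ.anti, hJ.vol_odd ho, hJJ, rho_e_sq, SpinorModule.om]
  refine orthogonalUnique_of_finrank _ _ (fun φ => ⟨fun h => ?_, fun h => ?_⟩)
    (finrank_eq_one_of hc hd hd') ?_
  · have hl : ∀ x, T.ρ (e (Fin.last n)) (φ x) = φ (J x) :=
      fun x => LinearMap.congr_fun h.clifford_last x
    refine mem_clHom.2 fun k x => ?_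
    refine Fin.lastCases ?_ (fun j => ?_) k
    · rw [h2, hl]
    -- Evaluating the formula for e_k e_{n+1} at Jx removes e_{n+1}, since e_{n+1} Φ J = Φ J² = -Φ.
    · have h6 := LinearMap.congr_fun (h.clifford j) (J x)
      rw [LinearMap.comp_apply, LinearMap.comp_apply, rho_mul_apply, hl, hJJ, map_neg, map_neg] at h6
      rw [h1, LinearMap.neg_apply, map_neg, End.mul_apply, ← h6, neg_neg]
  · refine ⟨fun g hg => LinearMap.ext fun x => ?_, fun k => LinearMap.ext (h4 φ h k),
      LinearMap.ext fun x => ?_, LinearMap.ext fun x => ?_⟩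
    · rw [LinearMap.comp_apply, clHom_apply h, hev _ (spinGroup.mem_even hg)]; rfl
    · rw [LinearMap.comp_apply, clHom_apply h, hvol]; rfl
    · rw [LinearMap.comp_apply, clHom_apply h, h2]; rfl
  · intro φ hφ h0
    -- The original e_k corresponds to e_k e_{n+1} on the target, so the kernel is stable under the
    -- irreducible action on Σ_n. These products are also skew, which yields the isometry below.
    have hinj : Function.Injective φ := by
      rw [← LinearMap.ker_eq_bot]
      refine (S.isIrr (LinearMap.ker φ) fun k x hx => ?_).resolve_right
        fun h1 => h0 (LinearMap.ker_eq_top.1 h1)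
      rw [LinearMap.mem_ker] at hx ⊢
      rw [← h4 φ hφ, hx, map_zero]
    have hs := surjective_of_injective_of_sq hinj hd'
    refine ⟨hs, exists_norm_eq_mul_of_source S.inner_e
      (g := fun k => T.ρ (e (Fin.castSucc k) * e (Fin.last n))) (fun k x y => ?_) S.isIrr φ
      (h4 φ hφ) hinj hs⟩
    rw [rho_mul_apply, T.inner_e, T.inner_e, neg_neg, rho_mul_apply,
      rho_e_anti T.ρ (Fin.castSucc_lt_last k).ne, inner_neg_right, neg_neg]

end Existence

/-! ### Existence and uniqueness for n ≡ 1, 3, 7, on the doubled module -/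

section Doubling

open Module

variable {n : ℕ}

variable {V : Type v} [NormedAddCommGroup V] [InnerProductSpace ℝ V]
  {W : Type w} [NormedAddCommGroup W] [InnerProductSpace ℝ W]

theorem block_apply (a b c d : End ℝ V) (x : WithLp 2 (V × V)) :
    block a b c d x = WithLp.toLp 2 (a x.fst + b x.snd, c x.fst + d x.snd) := rfl

theorem withLp_ext {A : Type v} {x y : WithLp 2 (A × A)} (h1 : x.fst = y.fst) (h2 : x.snd = y.snd) : x = y :=
  WithLp.ofLp_injective 2 (Prod.ext h1 h2)

/-- The formulas of `exists_double`, on the orthogonal direct sum, since the maps from it are to be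
isometries. -/
theorem exists_double_block (ρ : Cl n →ₐ[ℝ] End ℝ V) :
    ∃ ρ' : Cl (n + 1) →ₐ[ℝ] End ℝ (WithLp 2 (V × V)),
      (∀ k, ρ' (e (Fin.castSucc k)) = block (ρ (e k)) 0 0 (-ρ (e k))) ∧
      ρ' (e (Fin.last n)) = block 0 1 (-1) 0 := by
  refine exists_rep_succ _ _ (fun k => ?_) (fun k l h => ?_) ?_ (fun k => ?_)
  · refine LinearMap.ext fun x => withLp_ext ?_ ?_ <;> simp [rho_e_sq, block_apply]
  · refine LinearMap.ext fun x => withLp_ext ?_ ?_ <;> simp [rho_e_anti ρ h, block_apply]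
  · refine LinearMap.ext fun x => withLp_ext ?_ ?_ <;> simp [block_apply]
  · refine LinearMap.ext fun x => withLp_ext ?_ ?_ <;> simp [block_apply]

theorem exists_double_swap_block (ρ : Cl n →ₐ[ℝ] End ℝ V) :
    ∃ ρ' : Cl (n + 1) →ₐ[ℝ] End ℝ (WithLp 2 (V × V)),
      (∀ k, ρ' (e (Fin.castSucc k)) = block 0 (ρ (e k)) (ρ (e k)) 0) ∧
      ρ' (e (Fin.last n)) = block 0 (-1) 1 0 := by
  refine exists_rep_succ _ _ (fun k => ?_) (fun k l h => ?_) ?_ (fun k => ?_)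
  · refine LinearMap.ext fun x => withLp_ext ?_ ?_ <;> simp [rho_e_sq, block_apply]
  · refine LinearMap.ext fun x => withLp_ext ?_ ?_ <;> simp [rho_e_anti ρ h, block_apply]
  · refine LinearMap.ext fun x => withLp_ext ?_ ?_ <;> simp [block_apply]
  · refine LinearMap.ext fun x => withLp_ext ?_ ?_ <;> simp [block_apply]

/-- On the even part this agrees with both doubled actions of `Cl (n + 1)`, because in a product of
two generators the signs or the swaps cancel. -/
theorem exists_diagonal (ρ : Cl n →ₐ[ℝ] End ℝ V) :
    ∃ ρ' : Cl n →ₐ[ℝ] End ℝ (WithLp 2 (V × V)), ∀ a, ρ' a = block (ρ a) 0 0 (ρ a) := by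
  refine ⟨AlgHom.ofLinearMap
    { toFun := fun a => block (ρ a) 0 0 (ρ a)
      map_add' := fun a b => ?_
      map_smul' := fun c a => ?_ } ?_ fun a b => ?_, fun a => rfl⟩
  all_goals refine LinearMap.ext fun x => withLp_ext ?_ ?_ <;> simp [block_apply]

theorem finrank_withLp_sq [FiniteDimensional ℝ V] :
    finrank ℝ (WithLp 2 (V × V)) ^ 2 = 2 ^ 2 * finrank ℝ V ^ 2 := by
  rw [(WithLp.linearEquiv 2 ℝ (V × V)).finrank_eq, finrank_prod]; ring

/-- A block matrix is skew if its diagonal blocks are and its off-diagonal blocks are negative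
adjoints of each other, which is `hb`. -/
theorem inner_block_skew {a b c d : End ℝ V}
    (ha : ∀ x y, inner ℝ (a x) y = -inner ℝ x (a y))
    (hb : ∀ x y, inner ℝ (b x) y = -inner ℝ x (c y))
    (hd : ∀ x y, inner ℝ (d x) y = -inner ℝ x (d y)) (x y : WithLp 2 (V × V)) :
    inner ℝ (block a b c d x) y = -inner ℝ x (block a b c d y) := by
  have hc : ∀ x y, inner ℝ (c x) y = -inner ℝ x (b y) := fun x y => by
    rw [real_inner_comm, real_inner_comm (b y), hb, neg_neg]
  have hp : ∀ x y : WithLp 2 (V × V), inner ℝ x y = inner ℝ x.fst y.fst + inner ℝ x.snd y.snd :=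
    fun x y => WithLp.prod_inner_apply x y
  have h1 : ∀ x, (block a b c d x).fst = a x.fst + b x.snd := fun _ => rfl
  have h2 : ∀ x, (block a b c d x).snd = c x.fst + d x.snd := fun _ => rfl
  simp only [hp, h1, h2, inner_add_left, inner_add_right, ha, hb, hc, hd]
  ring

/-- There are (n + 1) + 2 halvings, and the squared dimension of Σ_n ⊕ Σ_n is 4 · 2^(n+1). -/
theorem orthogonalUnique_intertwines1 (S : SpinorModule n V) (T : SpinorModule (n + 1) W)
    (hn : n % 8 = 1) {σ : End ℝ V} (hσ : S.IsRealStructure σ) {I J : End ℝ W}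
    (hT : T.IsQuaternionic I J) : OrthogonalUnique (Intertwines1 S T σ I J) := by
  have := S.finiteDimensional
  have := T.finiteDimensional
  have := T.nontrivial
  have : FiniteDimensional ℝ (WithLp 2 (V × V)) :=
    (WithLp.linearEquiv 2 ℝ (V × V)).symm.finiteDimensional
  have ho : Odd n := by rw [Nat.odd_iff]; omega
  rw [isQuaternionic_iff] at hT
  have hτ := hσ.isTwist hn
  have hsq : ∀ x, σ (σ x) = x := fun x => LinearMap.congr_fun hσ.involutive x
  have hv := rho_vol_sq_neg (n := n) (by omega) S.ρ
  obtain ⟨ρ', h1, h2⟩ := exists_double_block S.ρ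
  have hq : IsQuat ρ' (block S.om 0 0 S.om) (block 0 σ (-σ) 0) := by
    refine ⟨fun x => withLp_ext ?_ ?_, fun x => withLp_ext ?_ ?_, fun x => withLp_ext ?_ ?_,
      fun k x => Fin.lastCases (withLp_ext ?_ ?_) (fun j => withLp_ext ?_ ?_) k,
      fun k x => Fin.lastCases (withLp_ext ?_ ?_) (fun j => withLp_ext ?_ ?_) k⟩
    all_goals simp [h1, h2, hv, hsq, hτ.anti, hτ.vol_odd ho, rho_vol_e_odd ho, block_apply,
      SpinorModule.om]
  have hc := finrank_clHom_quat ho.add_one ρ' T.ρ hq hT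
  have hd : finrank ℝ (WithLp 2 (V × V)) ^ 2 = 2 ^ (n + 1 + 2) := by
    rw [finrank_withLp_sq, S.finrank_sq_complex (Or.inl hn)]; ring
  have hd' : finrank ℝ (WithLp 2 (V × V)) ^ 2 = finrank ℝ W ^ 2 := by
    rw [hd, T.finrank_sq_quat (by omega)]
  obtain ⟨δ, hδ⟩ := exists_diagonal S.ρ
  refine orthogonalUnique_of_finrank _ _ (fun φ => ⟨fun h => ?_, fun h => ?_⟩)
    (finrank_eq_one_of hc hd hd') ?_
  · refine ⟨⟨mem_clHom.2 fun k x => ?_, fun x => LinearMap.congr_fun h.complex x⟩,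
      fun x => LinearMap.congr_fun h.quaternionic x⟩
    refine Fin.lastCases ?_ (fun j => ?_) k
    · rw [h2]; exact LinearMap.congr_fun h.clifford_last x
    · rw [h1]; exact LinearMap.congr_fun (h.clifford j) x
  · have h4 := clHom_apply h.1.1
    refine ⟨fun g hg => LinearMap.ext fun x => ?_, LinearMap.ext h.1.2,
      fun k => LinearMap.ext fun x => ?_, LinearMap.ext fun x => ?_, LinearMap.ext h.2⟩
    · rw [LinearMap.comp_apply, LinearMap.comp_apply, ← hδ]
      refine even_apply (ρ := δ) (ρ' := T.ρ.comp (incl n)) (fun k l x => ?_)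
        (spinGroup.mem_even hg) x
      rw [AlgHom.comp_apply, h4, hδ, map_mul, map_mul, incl_e, incl_e, h1, h1]
      congr 1
      refine withLp_ext ?_ ?_ <;> simp [block_apply]
    · rw [LinearMap.comp_apply, h4, h1]; rfl
    · rw [LinearMap.comp_apply, h4, h2]; rfl
  · intro φ hφ h0
    have hs := T.isIrr.surjective hφ.1.1 h0
    have hinj := (LinearMap.injective_iff_surjective_of_finrank_eq_finrank
      (Nat.pow_left_injective two_ne_zero hd')).2 hs
    refine ⟨hs, exists_norm_eq_mul (f := fun k => ρ' (e k)) (fun k => ?_) T.inner_e T.isIrr φ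
      (mem_clHom.1 hφ.1.1) hinj hs⟩
    refine Fin.lastCases ?_ (fun j => ?_) k
    · rw [h2]
      exact inner_block_skew (by simp) (by simp) (by simp)
    · rw [h1]
      exact inner_block_skew (S.inner_e j) (by simp) (by simp [S.inner_e])

/-- The properties that pairs of maps `Σ_n → Σ_{n+1}^±` inherit from `P`, if `P` describes the
corresponding maps `Σ_n ⊕ Σ_n → Σ_{n+1}`. -/
theorem orthogonalUniquePair_of_finrank (T : SpinorModule (n + 1) W)
    (P : (V →ₗ[ℝ] T.pos) → (V →ₗ[ℝ] T.neg) → Prop)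
    (H : Submodule ℝ (WithLp 2 (V × V) →ₗ[ℝ] W))
    (hP : ∀ p q, P p q ↔ (LinearMap.coprod (T.pos.subtype ∘ₗ p) (T.neg.subtype ∘ₗ q)) ∘ₗ
      (WithLp.linearEquiv 2 ℝ (V × V)).toLinearMap ∈ H)
    (hvol : ∀ φ ∈ H, ∀ x, T.om (φ x) = φ (block 1 0 0 (-1) x)) (hH : finrank ℝ H = 1)
    (hiso : ∀ φ ∈ H, φ ≠ 0 → Function.Surjective φ ∧ ∃ r : ℝ, 0 < r ∧ ∀ x, ‖φ x‖ = r * ‖x‖) :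
    OrthogonalUniquePair P := by
  obtain ⟨Φ, hΦ, huniq⟩ := orthogonalUnique_of_finrank (· ∈ H) H (fun _ => Iff.rfl) hH hiso
  have hv : ∀ x, T.om (Φ x) = Φ (block 1 0 0 (-1) x) := hvol _ hΦ
  have hpos : ∀ w, w ∈ T.pos ↔ T.om w = w := fun w => by
    rw [SpinorModule.pos, LinearMap.mem_ker, LinearMap.sub_apply, sub_eq_zero]; rfl
  have hneg : ∀ w, w ∈ T.neg ↔ T.om w = -w := fun w => by
    rw [SpinorModule.neg, LinearMap.mem_ker, LinearMap.add_apply, eq_neg_iff_add_eq_zero]; rfl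
  -- The restrictions of Φ to the two summands. As ω_{n+1} corresponds to diag(1, -1), they land in
  -- the half-spinor spaces.
  let p : V →ₗᵢ[ℝ] T.pos :=
    ⟨LinearMap.codRestrict T.pos (Φ.toLinearEquiv.toLinearMap ∘ₗ
      (WithLp.linearEquiv 2 ℝ (V × V)).symm.toLinearMap ∘ₗ LinearMap.inl ℝ V V)
      (fun x => (hpos _).2 ((hv _).trans (congrArg Φ (withLp_ext (by simp [block_apply])
        (by simp [block_apply]))))),
      fun x => (Φ.norm_map _).trans (WithLp.norm_toLp_fst 2 V V x)⟩
  let q : V →ₗᵢ[ℝ] T.neg :=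
    ⟨LinearMap.codRestrict T.neg (Φ.toLinearEquiv.toLinearMap ∘ₗ
      (WithLp.linearEquiv 2 ℝ (V × V)).symm.toLinearMap ∘ₗ LinearMap.inr ℝ V V)
      (fun x => (hneg _).2 ((hv _).trans ((congrArg Φ (withLp_ext (by simp [block_apply])
        (by simp [block_apply]))).trans (Φ.map_neg _)))),
      fun x => (Φ.norm_map _).trans (WithLp.norm_toLp_snd 2 V V x)⟩
  have hp : ∀ x, (p x : W) = Φ (WithLp.toLp 2 (x, 0)) := fun x => rfl
  have hq : ∀ x, (q x : W) = Φ (WithLp.toLp 2 (0, x)) := fun x => rfl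
  have hsurj : ∀ w, ∃ x y, w = Φ (WithLp.toLp 2 (x, y)) := fun w => by
    obtain ⟨z, rfl⟩ := Φ.surjective w
    exact ⟨z.fst, z.snd, rfl⟩
  -- If Φ(x, y) is a positive half-spinor then y = -y by injectivity, so y = 0; similarly x = 0 for
  -- a negative one.
  have hps : Function.Surjective p := by
    rintro ⟨w, hw⟩
    obtain ⟨x, y, rfl⟩ := hsurj w
    rw [hpos, hv] at hw
    have h1 : -y = y := by
      simpa [block_apply] using congrArg (fun z : WithLp 2 (V × V) => z.snd) (Φ.injective hw)
    have h2 : y = 0 := by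
      have : (2 : ℝ) • y = 0 := by rw [two_smul]; nth_rewrite 1 [← h1]; simp
      simpa using this
    subst h2
    exact ⟨x, Subtype.ext (hp x)⟩
  have hqs : Function.Surjective q := by
    rintro ⟨w, hw⟩
    obtain ⟨x, y, rfl⟩ := hsurj w
    rw [hneg, hv, ← map_neg Φ] at hw
    have h1 : x = -x := by
      simpa [block_apply] using congrArg (fun z : WithLp 2 (V × V) => z.fst) (Φ.injective hw)
    have h2 : x = 0 := by
      have : (2 : ℝ) • x = 0 := by rw [two_smul]; nth_rewrite 1 [h1]; simp
      simpa using this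
    subst h2
    exact ⟨y, Subtype.ext (hq y)⟩
  refine ⟨LinearIsometryEquiv.ofSurjective p hps, LinearIsometryEquiv.ofSurjective q hqs, ?_,
    fun p' q' h => ?_⟩
  · rw [hP]
    convert hΦ
    refine LinearMap.ext fun x => ?_
    change (p x.fst : W) + (q x.snd : W) = Φ x
    rw [hp, hq, ← map_add]
    congr 1
    refine withLp_ext ?_ ?_ <;> simp
  · rw [hP] at h
    obtain ⟨c, hc⟩ := huniq _ h
    refine ⟨c, LinearMap.ext fun x => Subtype.ext ?_, LinearMap.ext fun x => Subtype.ext ?_⟩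
    · change (p' x : W) = c • (p x : W)
      have := LinearMap.congr_fun hc (WithLp.toLp 2 (x, 0))
      rw [hp]
      simpa using this
    · change (q' x : W) = c • (q x : W)
      have := LinearMap.congr_fun hc (WithLp.toLp 2 (0, x))
      rw [hq]
      simpa using this

/-- The pair of maps that corresponds to a map `Σ_n ⊕ Σ_n → Σ_{n+1}`. -/
theorem intertwines7_iff (S : SpinorModule n V) (T : SpinorModule (n + 1) W)
    {ρ' : Cl (n + 1) →ₐ[ℝ] End ℝ (WithLp 2 (V × V))}
    (h1 : ∀ k, ρ' (e (Fin.castSucc k)) = block 0 (S.ρ (e k)) (S.ρ (e k)) 0)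
    (h2 : ρ' (e (Fin.last n)) = block 0 (-1) 1 0) (p : V →ₗ[ℝ] T.pos) (q : V →ₗ[ℝ] T.neg) :
    Intertwines7 S T p q ↔ (LinearMap.coprod (T.pos.subtype ∘ₗ p) (T.neg.subtype ∘ₗ q)) ∘ₗ
      (WithLp.linearEquiv 2 ℝ (V × V)).toLinearMap ∈ clHom ρ' T.ρ := by
  set φ := (LinearMap.coprod (T.pos.subtype ∘ₗ p) (T.neg.subtype ∘ₗ q)) ∘ₗ
      (WithLp.linearEquiv 2 ℝ (V × V)).toLinearMap with hφ
  have hφa : ∀ x, φ x = (p x.fst : W) + (q x.snd : W) := fun x => rfl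
  constructor
  · intro h
    refine mem_clHom.2 fun k x => ?_
    refine Fin.lastCases ?_ (fun j => ?_) k
    · rw [h2, hφa, hφa, map_add, h.clifford_last_pos, h.clifford_last_neg]
      simp [block_apply, add_comm]
    · rw [h1, hφa, hφa, map_add, h.clifford_pos, h.clifford_neg]
      simp [block_apply, add_comm]
  · intro h
    have h3 := mem_clHom.1 h
    have hp : ∀ x, (p x : W) = φ (WithLp.toLp 2 (x, 0)) := fun x => by simp [hφa]
    have hq : ∀ x, (q x : W) = φ (WithLp.toLp 2 (0, x)) := fun x => by simp [hφa]
    obtain ⟨δ, hδ⟩ := exists_diagonal S.ρ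
    have h4 : ∀ a ∈ CliffordAlgebra.even (cliffordForm n), ∀ x,
        T.ρ (incl n a) (φ x) = φ (δ a x) := fun a ha x => by
      refine even_apply (ρ := δ) (ρ' := T.ρ.comp (incl n)) (fun k l x => ?_) ha x
      rw [AlgHom.comp_apply, clHom_apply h, hδ, map_mul, map_mul, incl_e, incl_e, h1, h1]
      congr 1
      refine withLp_ext ?_ ?_ <;> simp [block_apply]
    refine ⟨fun g hg x => ?_, fun g hg x => ?_, fun k x => ?_, fun k x => ?_, fun x => ?_,
      fun x => ?_⟩
    · rw [hp, h4 g (spinGroup.mem_even hg), hδ, hφa]; simp [block_apply]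
    · rw [hq, h4 g (spinGroup.mem_even hg), hδ, hφa]; simp [block_apply]
    · rw [hp, h3, h1, hφa]; simp [block_apply]
    · rw [hq, h3, h1, hφa]; simp [block_apply]
    · rw [hp, h3, h2, hφa]; simp [block_apply]
    · rw [hq, h3, h2, hφa]; simp [block_apply]

/-- ω_n is the product of an even element, which acts diagonally, and a vector, which swaps. As ω_n
= 1 on Σ_n, it acts as the plain swap; composing with e_{n+1} gives diag(1, -1). -/
theorem double_swap_vol (S : SpinorModule n V) (hn : n % 4 = 3)
    {ρ' : Cl (n + 1) →ₐ[ℝ] End ℝ (WithLp 2 (V × V))}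
    (h1 : ∀ k, ρ' (e (Fin.castSucc k)) = block 0 (S.ρ (e k)) (S.ρ (e k)) 0)
    (h2 : ρ' (e (Fin.last n)) = block 0 (-1) 1 0) (x : WithLp 2 (V × V)) :
    ρ' (vol (n + 1)) x = block 1 0 0 (-1) x := by
  have ho : Odd n := by rw [Nat.odd_iff]; omega
  obtain ⟨m, rfl⟩ : ∃ m, n = m + 1 := ⟨n - 1, by omega⟩
  obtain ⟨δ, hδ⟩ := exists_diagonal S.ρ
  have hz : vol (m + 1) = -(e 0 * vol (m + 1)) * e 0 := by
    rw [neg_mul, mul_assoc, vol_mul_e_odd ho, ← mul_assoc, e_mul_self]; simp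
  have h4 : ∀ a ∈ CliffordAlgebra.even (cliffordForm (m + 1)), ∀ x,
      ρ' (incl (m + 1) a) x = δ a x := fun a ha x => by
    refine even_apply (ρ := δ) (ρ' := ρ'.comp (incl (m + 1))) (φ := LinearMap.id)
      (fun k l x => ?_) ha x
    rw [AlgHom.comp_apply, hδ, map_mul, map_mul, incl_e, incl_e, h1, h1]
    refine withLp_ext ?_ ?_ <;> simp [block_apply]
  have hv : ∀ x, S.ρ (vol (m + 1)) x = x := fun x => by rw [S.positive hn]; rfl
  rw [vol_succ, rho_mul_apply, h2, hz, map_mul, rho_mul_apply, map_neg, map_neg,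
    LinearMap.neg_apply, h4 _ (e_mul_vol_mem_even ho 0), incl_e, h1, hδ]
  refine withLp_ext ?_ ?_ <;> simp [block_apply, hv, rho_e_sq]

theorem double_swap_norm (S : SpinorModule n V) (T : SpinorModule (n + 1) W)
    {ρ' : Cl (n + 1) →ₐ[ℝ] End ℝ (WithLp 2 (V × V))}
    (h1 : ∀ k, ρ' (e (Fin.castSucc k)) = block 0 (S.ρ (e k)) (S.ρ (e k)) 0)
    (h2 : ρ' (e (Fin.last n)) = block 0 (-1) 1 0)
    (hd : finrank ℝ (WithLp 2 (V × V)) ^ 2 = finrank ℝ W ^ 2)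
    (φ : WithLp 2 (V × V) →ₗ[ℝ] W) (hφ : φ ∈ clHom ρ' T.ρ) (h0 : φ ≠ 0) :
    Function.Surjective φ ∧ ∃ r : ℝ, 0 < r ∧ ∀ x, ‖φ x‖ = r * ‖x‖ := by
  have := S.finiteDimensional
  have := T.finiteDimensional
  have := T.nontrivial
  have : FiniteDimensional ℝ (WithLp 2 (V × V)) :=
    (WithLp.linearEquiv 2 ℝ (V × V)).symm.finiteDimensional
  have hs := T.isIrr.surjective hφ h0
  have hinj := (LinearMap.injective_iff_surjective_of_finrank_eq_finrank
    (Nat.pow_left_injective two_ne_zero hd)).2 hs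
  refine ⟨hs, exists_norm_eq_mul (f := fun k => ρ' (e k)) (fun k => ?_) T.inner_e T.isIrr φ
    (mem_clHom.1 hφ) hinj hs⟩
  refine Fin.lastCases ?_ (fun j => ?_) k
  · rw [h2]
    exact inner_block_skew (by simp) (by simp) (by simp)
  · rw [h1]
    exact inner_block_skew (by simp) (S.inner_e j) (by simp)

/-- The n + 1 Clifford conditions exhaust the squared dimension 4 · 2^(n-1) of the double. -/
theorem orthogonalUniquePair_intertwines7 (S : SpinorModule n V) (T : SpinorModule (n + 1) W)
    (hn : n % 8 = 7) : OrthogonalUniquePair (Intertwines7 S T) := by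
  have := S.finiteDimensional
  have := T.finiteDimensional
  have : FiniteDimensional ℝ (WithLp 2 (V × V)) :=
    (WithLp.linearEquiv 2 ℝ (V × V)).symm.finiteDimensional
  obtain ⟨ρ', h1, h2⟩ := exists_double_swap_block S.ρ
  have hc := finrank_clHom_of_source ρ' T.ρ (IsTwist.of_vol (by rw [Nat.even_iff]; omega) ρ')
  have hd : finrank ℝ (WithLp 2 (V × V)) ^ 2 = 2 ^ (n + 1) := by
    rw [finrank_withLp_sq, pow_succ 2 n, ← S.two_mul_finrank_sq_realVol hn]; ring
  have hd' : finrank ℝ (WithLp 2 (V × V)) ^ 2 = finrank ℝ W ^ 2 := by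
    rw [hd, T.finrank_sq_real (by omega)]
  refine orthogonalUniquePair_of_finrank T _ (clHom ρ' T.ρ) (intertwines7_iff S T h1 h2)
    (fun φ hφ x => ?_) (finrank_eq_one_of hc hd hd') (double_swap_norm S T h1 h2 hd')
  rw [SpinorModule.om, clHom_apply hφ, double_swap_vol S (by omega) h1 h2]

/-- As for n ≡ 7, with two further halvings for I, J acting diagonally on the double. -/
theorem orthogonalUniquePair_intertwines3 (S : SpinorModule n V) (T : SpinorModule (n + 1) W)
    (hn : n % 8 = 3) {I J : End ℝ V} (hS : S.IsQuaternionic I J) {I' J' : End ℝ W}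
    (hT : T.IsQuaternionic I' J') : OrthogonalUniquePair (Intertwines3 S T I J I' J') := by
  have := S.finiteDimensional
  have := T.finiteDimensional
  have : FiniteDimensional ℝ (WithLp 2 (V × V)) :=
    (WithLp.linearEquiv 2 ℝ (V × V)).symm.finiteDimensional
  rw [isQuaternionic_iff] at hS hT
  obtain ⟨ρ', h1, h2⟩ := exists_double_swap_block S.ρ
  have hq : IsQuat ρ' (block I 0 0 I) (block J 0 0 J) := by
    refine ⟨fun x => withLp_ext ?_ ?_, fun x => withLp_ext ?_ ?_, fun x => withLp_ext ?_ ?_,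
      fun k x => Fin.lastCases (withLp_ext ?_ ?_) (fun j => withLp_ext ?_ ?_) k,
      fun k x => Fin.lastCases (withLp_ext ?_ ?_) (fun j => withLp_ext ?_ ?_) k⟩
    all_goals simp [h1, h2, hS.I_sq, hS.J_sq, hS.anti, hS.I_comm, hS.J_comm, block_apply]
  have hc := finrank_clHom_quat (by rw [Nat.even_iff]; omega) ρ' T.ρ hq hT
  have hd : finrank ℝ (WithLp 2 (V × V)) ^ 2 = 2 ^ (n + 1 + 2) := by
    rw [finrank_withLp_sq, S.finrank_sq_complex (by omega)]; ring
  have hd' : finrank ℝ (WithLp 2 (V × V)) ^ 2 = finrank ℝ W ^ 2 := by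
    rw [hd, T.finrank_sq_quat (by omega)]
  refine orthogonalUniquePair_of_finrank T _ _ (fun p q => ?_)
    (fun φ hφ x => ?_) (finrank_eq_one_of hc hd hd')
    (fun φ hφ => double_swap_norm S T h1 h2 hd' φ hφ.1.1)
  · set φ := (LinearMap.coprod (T.pos.subtype ∘ₗ p) (T.neg.subtype ∘ₗ q)) ∘ₗ
      (WithLp.linearEquiv 2 ℝ (V × V)).toLinearMap with hφ
    have hφa : ∀ x, φ x = (p x.fst : W) + (q x.snd : W) := fun x => rfl
    have hp : ∀ x, (p x : W) = φ (WithLp.toLp 2 (x, 0)) := fun x => by simp [hφa]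
    have hq : ∀ x, (q x : W) = φ (WithLp.toLp 2 (0, x)) := fun x => by simp [hφa]
    constructor
    · intro h
      refine ⟨⟨(intertwines7_iff S T h1 h2 p q).1 h.toIntertwines7, fun x => ?_⟩, fun x => ?_⟩
      · rw [hφa, map_add, h.linear_I_pos, h.linear_I_neg, hφa]; simp [block_apply]
      · rw [hφa, map_add, h.linear_J_pos, h.linear_J_neg, hφa]; simp [block_apply]
    · rintro ⟨⟨h7, hI⟩, hJ⟩
      replace hI := mem_inter.1 hI
      replace hJ := mem_inter.1 hJ
      refine ⟨(intertwines7_iff S T h1 h2 p q).2 h7, fun x => ?_, fun x => ?_, fun x => ?_,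
        fun x => ?_⟩
      · rw [hp, hI, hφa]; simp [block_apply]
      · rw [hp, hJ, hφa]; simp [block_apply]
      · rw [hq, hI, hφa]; simp [block_apply]
      · rw [hq, hJ, hφa]; simp [block_apply]
  · rw [SpinorModule.om, clHom_apply hφ.1.1, double_swap_vol S (by omega) h1 h2]

end Doubling

/-! ## The geometry of the cylinder -/

open VectorField Set

section Bracket

/-- Invertibility is essential: `inverse` is zero on maps that are not invertible, and the second
component would be lost. -/
theorem inverse_prodMap_id {E F : Type*} [NormedAddCommGroup E] [NormedSpace ℝ E]
    [NormedAddCommGroup F] [NormedSpace ℝ F] {A : E →L[ℝ] F} (hA : A.IsInvertible) (v : F) (c : ℝ) :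
    (A.prodMap (ContinuousLinearMap.id ℝ ℝ)).inverse (v, c) = (A.inverse v, c) := by
  obtain ⟨A, rfl⟩ := hA
  have h : (A : E →L[ℝ] F).prodMap (ContinuousLinearMap.id ℝ ℝ) =
      (A.prodCongr (ContinuousLinearEquiv.refl ℝ ℝ) : E × ℝ →L[ℝ] F × ℝ) := by
    ext <;> simp
  rw [h, ContinuousLinearMap.inverse_equiv, ContinuousLinearMap.inverse_equiv]
  rfl

theorem hasFDerivWithinAt_prodMap_id {E F : Type*} [NormedAddCommGroup E] [NormedSpace ℝ E]
    [NormedAddCommGroup F] [NormedSpace ℝ F] {f : E → F} {D : E →L[ℝ] F} {s : Set E} {y : E}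
    (h : HasFDerivWithinAt f D s y) (t : ℝ) :
    HasFDerivWithinAt (fun q : E × ℝ => (f q.1, q.2)) (D.prodMap (ContinuousLinearMap.id ℝ ℝ))
      (s ×ˢ univ) (y, t) := by
  have h1 : HasFDerivWithinAt (fun q : E × ℝ => f q.1) (D.comp (ContinuousLinearMap.fst ℝ E ℝ))
      (s ×ˢ univ) (y, t) :=
    HasFDerivWithinAt.comp (y, t) (t := s) h hasFDerivWithinAt_fst (fun q hq => hq.1)
  exact h1.prodMk hasFDerivWithinAt_snd

/-- Neither field depends on t and their t-components are constant, so derivatives in the direction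
of t and of the t-components vanish. -/
theorem lieBracketWithin_prod_const {E : Type*} [NormedAddCommGroup E] [NormedSpace ℝ E]
    {A B : E → E} {s : Set E} {y : E} (hA : DifferentiableWithinAt ℝ A s y)
    (hB : DifferentiableWithinAt ℝ B s y) (hs : UniqueDiffWithinAt ℝ s y) (c d t : ℝ) :
    lieBracketWithin ℝ (fun q : E × ℝ => (A q.1, c)) (fun q => (B q.1, d)) (s ×ˢ univ) (y, t) =
      (lieBracketWithin ℝ A B s y, 0) := by
  have hu : UniqueDiffWithinAt ℝ (s ×ˢ (univ : Set ℝ)) (y, t) := hs.prod uniqueDiffWithinAt_univ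
  have key : ∀ {A : E → E} (c : ℝ), DifferentiableWithinAt ℝ A s y → ∀ v : E × ℝ,
      fderivWithin ℝ (fun q : E × ℝ => (A q.1, c)) (s ×ˢ univ) (y, t) v =
        (fderivWithin ℝ A s y v.1, 0) := by
    intro A c hA v
    have h1 : HasFDerivWithinAt (fun q : E × ℝ => A q.1)
        ((fderivWithin ℝ A s y).comp (ContinuousLinearMap.fst ℝ E ℝ)) (s ×ˢ univ) (y, t) :=
      HasFDerivWithinAt.comp (y, t) (t := s) hA.hasFDerivWithinAt hasFDerivWithinAt_fst
        (fun q hq => hq.1)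
    have h2 := h1.prodMk (hasFDerivWithinAt_const c (y, t) (s ×ˢ univ))
    rw [h2.fderivWithin hu]
    rfl
  rw [lieBracketWithin_eq]
  simp only [key c hA, key d hB]
  simp [lieBracketWithin_eq]

theorem hasMFDerivWithinAt_modelSpace_iff {F E H X : Type*} [NormedAddCommGroup F] [NormedSpace ℝ F]
    [NormedAddCommGroup E] [NormedSpace ℝ E] [TopologicalSpace H] {I : ModelWithCorners ℝ E H}
    [TopologicalSpace X] [ChartedSpace H X] {f : F → X} {s : Set F} {y : F} {D : F →L[ℝ] E} :
    HasMFDerivWithinAt 𝓘(ℝ, F) I f s y D ↔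
      ContinuousWithinAt f s y ∧ HasFDerivWithinAt (fun z => extChartAt I (f y) (f z)) D s y := by
  have h : (extChartAt 𝓘(ℝ, F) y).symm ⁻¹' s ∩ range 𝓘(ℝ, F) = s := by
    rw [extChartAt_model_space_eq_id, modelWithCornersSelf_coe, range_id, inter_univ]
    rfl
  refine and_congr_right fun _ => ?_
  change HasFDerivWithinAt (fun z : F => extChartAt I (f y) (f z)) D
    ((extChartAt 𝓘(ℝ, F) y).symm ⁻¹' s ∩ range 𝓘(ℝ, F)) y ↔ _
  rw [h]

theorem hasMFDerivAt_modelSpace_iff {F E H X : Type*} [NormedAddCommGroup F] [NormedSpace ℝ F]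
    [NormedAddCommGroup E] [NormedSpace ℝ E] [TopologicalSpace H] {I : ModelWithCorners ℝ E H}
    [TopologicalSpace X] [ChartedSpace H X] {f : X → F} {x : X} {D : E →L[ℝ] F} :
    HasMFDerivAt I 𝓘(ℝ, F) f x D ↔
      ContinuousAt f x ∧ HasFDerivWithinAt (fun z => f ((extChartAt I x).symm z)) D (range I)
        (extChartAt I x x) :=
  Iff.rfl

variable {E : Type u} [NormedAddCommGroup E] [NormedSpace ℝ E]
  {H : Type u} [TopologicalSpace H] {I : ModelWithCorners ℝ E H}
  {X : Type u} [TopologicalSpace X] [ChartedSpace H X]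

theorem extChartAt_prod_real_apply (p q : X × ℝ) :
    extChartAt (I.prod 𝓘(ℝ, ℝ)) p q = (extChartAt I p.1 q.1, q.2) := by
  rw [extChartAt_prod]
  rfl

theorem extChartAt_prod_real_symm_apply (p : X × ℝ) (z : E × ℝ) :
    (extChartAt (I.prod 𝓘(ℝ, ℝ)) p).symm z = ((extChartAt I p.1).symm z.1, z.2) := by
  rw [extChartAt_prod]
  rfl

theorem range_prod_real : range (I.prod 𝓘(ℝ, ℝ)) = range I ×ˢ (univ : Set ℝ) := by
  rw [ModelWithCorners.range_prod, modelWithCornersSelf_coe, range_id]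

theorem hasMFDerivWithinAt_prod_real {f : E → X} {s : Set E} {y : E} {D : E →L[ℝ] E}
    (h : HasMFDerivWithinAt 𝓘(ℝ, E) I f s y D) (t : ℝ) :
    HasMFDerivWithinAt 𝓘(ℝ, E × ℝ) (I.prod 𝓘(ℝ, ℝ)) (fun q : E × ℝ => (f q.1, q.2))
      (s ×ˢ univ) (y, t) (D.prodMap (ContinuousLinearMap.id ℝ ℝ)) := by
  rw [hasMFDerivWithinAt_modelSpace_iff] at h ⊢
  refine ⟨(h.1.comp continuousWithinAt_fst (fun q hq => hq.1)).prodMk continuousWithinAt_snd, ?_⟩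
  simp only [extChartAt_prod_real_apply]
  exact hasFDerivWithinAt_prodMap_id h.2 t

theorem hasMFDerivAt_extChartAt_prod_real {x : X} {D : E →L[ℝ] E}
    (h : HasMFDerivAt I 𝓘(ℝ, E) (extChartAt I x) x D) (t : ℝ) :
    HasMFDerivAt (I.prod 𝓘(ℝ, ℝ)) 𝓘(ℝ, E × ℝ) (extChartAt (I.prod 𝓘(ℝ, ℝ)) (x, t)) (x, t)
      (D.prodMap (ContinuousLinearMap.id ℝ ℝ)) := by
  rw [hasMFDerivAt_modelSpace_iff] at h ⊢
  refine ⟨continuousAt_extChartAt _, ?_⟩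
  simp only [extChartAt_prod_real_apply, extChartAt_prod_real_symm_apply, range_prod_real]
  exact hasFDerivWithinAt_prodMap_id h.2 t

/-- The bracket in a chart, with all ingredients as free variables, so that those of the product
chart can be replaced by explicit ones despite the dependent types. -/
theorem mlieBracket_apply_eq {V W : (x : X) → TangentSpace I x} {x : X} {A : E →L[ℝ] E}
    {V' W' : E → E} {y : E} (hA : mfderiv I 𝓘(ℝ, E) (extChartAt I x) x = A)
    (hV : mpullbackWithin 𝓘(ℝ, E) I (extChartAt I x).symm V (range I) = V')
    (hW : mpullbackWithin 𝓘(ℝ, E) I (extChartAt I x).symm W (range I) = W')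
    (hy : extChartAt I x x = y) {s : Set E} (hs : range I = s) :
    mlieBracket I V W x = A.inverse (lieBracketWithin ℝ V' W' s y) := by
  subst hA hV hW hy hs
  have h : (extChartAt I x).symm ⁻¹' univ ∩ range I = range I := by simp
  rw [← mlieBracketWithin_univ, mlieBracketWithin_apply, h]
  rfl

variable [IsManifold I 2 X]

theorem mpullbackWithin_extChartAt_prod (V : (x : X) → TangentSpace I x) (c : ℝ) (x : X) (t s : ℝ)
    {y : E} (hy : y ∈ (extChartAt I x).target) :
    mpullbackWithin 𝓘(ℝ, E × ℝ) (I.prod 𝓘(ℝ, ℝ)) (extChartAt (I.prod 𝓘(ℝ, ℝ)) (x, t)).symm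
      (fun p : X × ℝ => ((V p.1, c) : E × ℝ)) (range (I.prod 𝓘(ℝ, ℝ))) (y, s) =
    ((mpullbackWithin 𝓘(ℝ, E) I (extChartAt I x).symm V (range I) y, c) : E × ℝ) := by
  -- The inverse chart is replaced by a variable before it is rewritten as a product map; otherwise
  -- the dependent types obstruct the rewriting.
  suffices h : ∀ F : E × ℝ → X × ℝ, F = (fun q => ((extChartAt I x).symm q.1, q.2)) →
      mpullbackWithin 𝓘(ℝ, E × ℝ) (I.prod 𝓘(ℝ, ℝ)) F (fun p : X × ℝ => ((V p.1, c) : E × ℝ))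
        (range (I.prod 𝓘(ℝ, ℝ))) (y, s) =
      ((mpullbackWithin 𝓘(ℝ, E) I (extChartAt I x).symm V (range I) y, c) : E × ℝ) from
    h _ (funext fun z => extChartAt_prod_real_symm_apply _ z)
  rintro _ rfl
  have hinv : (mfderivWithin 𝓘(ℝ, E) I (extChartAt I x).symm (range I) y).IsInvertible :=
    isInvertible_mfderivWithin_extChartAt_symm hy
  have h3 := hasMFDerivWithinAt_prod_real
    (mdifferentiableWithinAt_extChartAt_symm hy).hasMFDerivWithinAt s
  have hu : UniqueMDiffWithinAt 𝓘(ℝ, E × ℝ) (range (I.prod 𝓘(ℝ, ℝ))) (y, s) := by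
    refine UniqueDiffWithinAt.uniqueMDiffWithinAt ((I.prod 𝓘(ℝ, ℝ)).uniqueDiffOn _ ?_)
    rw [range_prod_real]
    exact ⟨extChartAt_target_subset_range x hy, trivial⟩
  rw [← range_prod_real] at h3
  exact (congrArg (fun L : E × ℝ →L[ℝ] E × ℝ => L.inverse (V ((extChartAt I x).symm y), c))
    (h3.mfderivWithin hu)).trans (inverse_prodMap_id (E := E) (F := E) hinv _ c)

theorem mpullbackWithin_extChartAt_prod_eventuallyEq (V : (x : X) → TangentSpace I x) (c : ℝ)
    (x : X) (t : ℝ) :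
    (mpullbackWithin 𝓘(ℝ, E × ℝ) (I.prod 𝓘(ℝ, ℝ)) (extChartAt (I.prod 𝓘(ℝ, ℝ)) (x, t)).symm
      (fun p : X × ℝ => ((V p.1, c) : E × ℝ)) (range (I.prod 𝓘(ℝ, ℝ))) : E × ℝ → E × ℝ)
    =ᶠ[nhdsWithin (extChartAt I x x, t) (range I ×ˢ univ)] fun q : E × ℝ =>
      ((mpullbackWithin 𝓘(ℝ, E) I (extChartAt I x).symm V (range I) q.1, c) : E × ℝ) := by
  have h : (extChartAt I x).target ×ˢ (univ : Set ℝ) ∈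
      nhdsWithin (extChartAt I x x, t) (range I ×ˢ univ) := by
    rw [nhdsWithin_prod_eq]
    exact Filter.prod_mem_prod (extChartAt_target_mem_nhdsWithin x) Filter.univ_mem
  filter_upwards [h] with q hq
  exact mpullbackWithin_extChartAt_prod V c x t q.2 hq.1

/-- Constant t-components are enough: c = 0 gives the lifted frame fields, and the zero field with c
= 1 gives ∂/∂t. -/
theorem mlieBracket_prod_const [CompleteSpace E] {V W : (x : X) → TangentSpace I x} {x : X}
    (hV : MDifferentiableAt I I.tangent (fun x => (⟨x, V x⟩ : TangentBundle I X)) x)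
    (hW : MDifferentiableAt I I.tangent (fun x => (⟨x, W x⟩ : TangentBundle I X)) x) (c d t : ℝ) :
    mlieBracket (I.prod 𝓘(ℝ, ℝ)) (fun p : X × ℝ => ((V p.1, c) : E × ℝ))
      (fun p : X × ℝ => ((W p.1, d) : E × ℝ)) (x, t) = ((mlieBracket I V W x, 0) : E × ℝ) := by
  have hdiff : ∀ {V : (x : X) → TangentSpace I x},
      MDifferentiableAt I I.tangent (fun x => (⟨x, V x⟩ : TangentBundle I X)) x →
      DifferentiableWithinAt ℝ (mpullbackWithin 𝓘(ℝ, E) I (extChartAt I x).symm V (range I) : E → E)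
        (range I) (extChartAt I x x) := by
    intro V hV
    have := (hV.mdifferentiableWithinAt (s := univ)).differentiableWithinAt_mpullbackWithin_vectorField
    rwa [preimage_univ, univ_inter] at this
  have hx : extChartAt I x x ∈ range I := extChartAt_target_subset_range x (mem_extChartAt_target x)
  have hL := (Filter.EventuallyEq.lieBracketWithin_vectorField_eq_of_mem (𝕜 := ℝ)
    (mpullbackWithin_extChartAt_prod_eventuallyEq V c x t)
    (mpullbackWithin_extChartAt_prod_eventuallyEq W d x t) ⟨hx, trivial⟩).trans
    (lieBracketWithin_prod_const (hdiff hV) (hdiff hW) (I.uniqueDiffOn _ hx) c d t)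
  have hinv : (mfderiv I 𝓘(ℝ, E) (extChartAt I x) x).IsInvertible :=
    isInvertible_mfderiv_extChartAt (mem_extChartAt_source x)
  have h3 := hasMFDerivAt_extChartAt_prod_real
    (mdifferentiableAt_extChartAt (I := I) (mem_chart_source H x)).hasMFDerivAt t
  exact (mlieBracket_apply_eq h3.mfderiv rfl rfl (extChartAt_prod_real_apply _ _) range_prod_real).trans (by
    refine (congrArg _ hL).trans ((inverse_prodMap_id (E := E) (F := E) hinv _ 0).trans ?_)
    exact congrArg (fun v : E => (v, (0 : ℝ))) (mlieBracket_apply_eq rfl rfl rfl rfl rfl).symm)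

end Bracket

namespace SpinManifold

variable {n : ℕ} (M : SpinManifold.{u} n)

theorem exists_eq_sum_frame {α : M.A} {x : M.X} (hx : x ∈ M.U α) (z : TangentSpace M.I x) :
    ∃ w : Fin n → ℝ, z = ∑ k, w k • M.frame α k x := by
  obtain ⟨w, hw⟩ := (Submodule.mem_span_range_iff_exists_fun ℝ).1
    (M.frame_span α x hx (Submodule.mem_top (x := z)))
  exact ⟨w, hw.symm⟩

theorem coeff_sum {α : M.A} {x : M.X} (hx : x ∈ M.U α) (w : Fin n → ℝ) (b : Fin n) :
    M.coeff α b x (∑ k, w k • M.frame α k x) = w b := by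
  rw [coeff, dif_pos hx]
  have h := (Module.Basis.mk (M.frame_li α x hx) (M.frame_span α x hx)).repr_sum_self w
  simp only [Module.Basis.mk_apply] at h
  exact congrFun h b

theorem coeff_cylinder_castSucc {α : M.A} {p : M.X × ℝ} (hp : p.1 ∈ M.U α) (b : Fin n) (v : M.E)
    (c : ℝ) : M.cylinder.coeff α b.castSucc p ((v, c) : M.E × ℝ) = M.coeff α b p.1 v := by
  obtain ⟨w, hw⟩ := M.exists_eq_sum_frame hp v
  have h1 : ((v, c) : M.E × ℝ) = ∑ k, (Fin.snoc (α := fun _ => ℝ) w c : Fin (n + 1) → ℝ) k •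
      M.cylFrame α k p := by
    rw [cylFrame_sum]
    simp only [Fin.snoc_castSucc, Fin.snoc_last]
    exact congrArg (fun v : M.E => (v, c)) hw
  have h2 := M.cylinder.coeff_sum (α := α) (x := p) ⟨hp, trivial⟩
    (Fin.snoc (α := fun _ => ℝ) w c) b.castSucc
  rw [Fin.snoc_castSucc] at h2
  refine (congrArg (M.cylinder.coeff α b.castSucc p) h1).trans (h2.trans ?_)
  exact ((congrArg (M.coeff α b p.1) hw).trans (M.coeff_sum hp w b)).symm

theorem coeff_cylinder_last {α : M.A} {p : M.X × ℝ} (hp : p.1 ∈ M.U α) (v : M.E)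
    (c : ℝ) : M.cylinder.coeff α (Fin.last n) p ((v, c) : M.E × ℝ) = c := by
  obtain ⟨w, hw⟩ := M.exists_eq_sum_frame hp v
  have h1 : ((v, c) : M.E × ℝ) = ∑ k, (Fin.snoc (α := fun _ => ℝ) w c : Fin (n + 1) → ℝ) k •
      M.cylFrame α k p := by
    rw [cylFrame_sum]
    simp only [Fin.snoc_castSucc, Fin.snoc_last]
    exact congrArg (fun v : M.E => (v, c)) hw
  have h2 := M.cylinder.coeff_sum (α := α) (x := p) ⟨hp, trivial⟩
    (Fin.snoc (α := fun _ => ℝ) w c) (Fin.last n)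
  rw [Fin.snoc_last] at h2
  exact (congrArg (M.cylinder.coeff α (Fin.last n) p) h1).trans h2

theorem mdifferentiableAt_frame {α : M.A} {x : M.X} (hx : x ∈ M.U α) (k : Fin n) :
    MDifferentiableAt M.I M.I.tangent (fun x => (⟨x, M.frame α k x⟩ : TangentBundle M.I M.X)) x :=
  ((M.frame_smooth α k).contMDiffAt ((M.isOpen_U α).mem_nhds hx)).mdifferentiableAt (by simp)

theorem mdifferentiableAt_zero (x : M.X) :
    MDifferentiableAt M.I M.I.tangent (fun x => (⟨x, 0⟩ : TangentBundle M.I M.X)) x :=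
  (Bundle.contMDiff_zeroSection ℝ _ (n := ∞)).contMDiffAt.mdifferentiableAt (by simp)

theorem isManifold_two : IsManifold M.I 2 M.X := inferInstance

theorem cylFrame_castSucc_eq (α : M.A) (k : Fin n) :
    M.cylFrame α k.castSucc = fun p : M.X × ℝ => ((M.frame α k p.1, 0) : M.E × ℝ) :=
  funext fun p => M.cylFrame_castSucc α k p

theorem cylFrame_last_eq (α : M.A) : M.cylFrame α (Fin.last n) = fun p : M.X × ℝ =>
    (((0 : (x : M.X) → TangentSpace M.I x) p.1, 1) : M.E × ℝ) :=
  funext fun p => M.cylFrame_last α p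

theorem mlieBracket_cylFrame_castSucc {α : M.A} {p : M.X × ℝ} (hp : p.1 ∈ M.U α) (k a : Fin n) :
    mlieBracket (M.I.prod 𝓘(ℝ, ℝ)) (M.cylFrame α k.castSucc) (M.cylFrame α a.castSucc) p =
      ((mlieBracket M.I (M.frame α k) (M.frame α a) p.1, 0) : M.E × ℝ) := by
  have := M.isManifold_two
  have : CompleteSpace M.E := FiniteDimensional.complete ℝ M.E
  rw [cylFrame_castSucc_eq, cylFrame_castSucc_eq]
  exact mlieBracket_prod_const (M.mdifferentiableAt_frame hp k) (M.mdifferentiableAt_frame hp a) 0 0 p.2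

/-- The lifted frame is invariant under translation in t. -/
theorem mlieBracket_cylFrame_last_right {α : M.A} {p : M.X × ℝ} (hp : p.1 ∈ M.U α)
    (k : Fin (n + 1)) :
    mlieBracket (M.I.prod 𝓘(ℝ, ℝ)) (M.cylFrame α k) (M.cylFrame α (Fin.last n)) p = 0 := by
  have := M.isManifold_two
  have : CompleteSpace M.E := FiniteDimensional.complete ℝ M.E
  refine Fin.lastCases ?_ (fun k => ?_) k
  · rw [mlieBracket_self]
    rfl
  · rw [cylFrame_castSucc_eq, cylFrame_last_eq]
    refine (mlieBracket_prod_const (M.mdifferentiableAt_frame hp k) (M.mdifferentiableAt_zero p.1)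
      0 1 p.2).trans ?_
    exact congrArg (fun v : M.E => (v, (0 : ℝ))) (congrFun mlieBracket_zero_right p.1)

theorem coeff_zero (α : M.A) (b : Fin n) (x : M.X) : M.coeff α b x 0 = 0 := by
  rw [coeff]
  split_ifs
  · exact DFunLike.congr_fun (LinearEquiv.map_zero _) b
  · rfl

theorem bracketCoeff_cylinder_castSucc {α : M.A} {p : M.X × ℝ} (hp : p.1 ∈ M.U α)
    (k a b : Fin n) : M.cylinder.bracketCoeff α k.castSucc a.castSucc b.castSucc p =
      M.bracketCoeff α k a b p.1 :=
  (congrArg (M.cylinder.coeff α b.castSucc p) (M.mlieBracket_cylFrame_castSucc hp k a)).trans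
    (M.coeff_cylinder_castSucc hp b _ _)

theorem bracketCoeff_cylinder_last₁ {α : M.A} {p : M.X × ℝ} (hp : p.1 ∈ M.U α)
    (a b : Fin (n + 1)) : M.cylinder.bracketCoeff α (Fin.last n) a b p = 0 := by
  refine (congrArg (M.cylinder.coeff α b p) ?_).trans (M.cylinder.coeff_zero α b p)
  refine mlieBracket_swap_apply.trans ?_
  exact (congrArg Neg.neg (M.mlieBracket_cylFrame_last_right hp a)).trans neg_zero

theorem bracketCoeff_cylinder_last₂ {α : M.A} {p : M.X × ℝ} (hp : p.1 ∈ M.U α)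
    (k b : Fin (n + 1)) : M.cylinder.bracketCoeff α k (Fin.last n) b p = 0 :=
  (congrArg (M.cylinder.coeff α b p) (M.mlieBracket_cylFrame_last_right hp k)).trans
    (M.cylinder.coeff_zero α b p)

theorem bracketCoeff_cylinder_last₃ {α : M.A} {p : M.X × ℝ} (hp : p.1 ∈ M.U α)
    (k a : Fin (n + 1)) : M.cylinder.bracketCoeff α k a (Fin.last n) p = 0 := by
  refine Fin.lastCases (M.bracketCoeff_cylinder_last₁ hp a _) (fun k => ?_) k
  refine Fin.lastCases (M.bracketCoeff_cylinder_last₂ hp _ _) (fun a => ?_) a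
  exact (congrArg (M.cylinder.coeff α (Fin.last n) p)
    (M.mlieBracket_cylFrame_castSucc hp k a)).trans (M.coeff_cylinder_last hp _ _)

theorem christoffel_cylinder_castSucc {α : M.A} {p : M.X × ℝ} (hp : p.1 ∈ M.U α)
    (k a b : Fin n) : M.cylinder.christoffel α k.castSucc a.castSucc b.castSucc p =
      M.christoffel α k a b p.1 := by
  simp only [christoffel, M.bracketCoeff_cylinder_castSucc hp]

/-- The Koszul formula permutes three indices, and bracket coefficients vanish as soon as one index,
in any position, is the last. -/
theorem christoffel_cylinder_last₁ {α : M.A} {p : M.X × ℝ} (hp : p.1 ∈ M.U α)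
    (a b : Fin (n + 1)) : M.cylinder.christoffel α (Fin.last n) a b p = 0 := by
  simp only [christoffel, M.bracketCoeff_cylinder_last₁ hp, M.bracketCoeff_cylinder_last₂ hp,
    M.bracketCoeff_cylinder_last₃ hp, sub_zero, add_zero, mul_zero]

theorem christoffel_cylinder_last₂ {α : M.A} {p : M.X × ℝ} (hp : p.1 ∈ M.U α)
    (k b : Fin (n + 1)) : M.cylinder.christoffel α k (Fin.last n) b p = 0 := by
  simp only [christoffel, M.bracketCoeff_cylinder_last₁ hp, M.bracketCoeff_cylinder_last₂ hp,
    M.bracketCoeff_cylinder_last₃ hp, sub_zero, add_zero, mul_zero]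

theorem christoffel_cylinder_last₃ {α : M.A} {p : M.X × ℝ} (hp : p.1 ∈ M.U α)
    (k a : Fin (n + 1)) : M.cylinder.christoffel α k a (Fin.last n) p = 0 := by
  simp only [christoffel, M.bracketCoeff_cylinder_last₁ hp, M.bracketCoeff_cylinder_last₂ hp,
    M.bracketCoeff_cylinder_last₃ hp, sub_zero, add_zero, mul_zero]

end SpinManifold

/-! ## Dirac operators of cylinders -/

namespace SpinManifold

variable {n : ℕ} {V : Type v} {W : Type w} [NormedAddCommGroup V] [InnerProductSpace ℝ V]
  [NormedAddCommGroup W] [InnerProductSpace ℝ W] (M : SpinManifold.{u} n) (S : SpinorModule n V)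
  (T : SpinorModule (n + 1) W)

theorem dirDeriv_add {ψ ψ' : M.Local V} {α : M.A} {x : M.X}
    (h : MDifferentiableAt M.I 𝓘(ℝ, V) (ψ α) x) (h' : MDifferentiableAt M.I 𝓘(ℝ, V) (ψ' α) x)
    (k : Fin n) :
    M.dirDeriv (fun β y => ψ β y + ψ' β y) α k x = M.dirDeriv ψ α k x + M.dirDeriv ψ' α k x :=
  congrArg (fun L : M.E →L[ℝ] V => L (M.frame α k x)) (h.hasMFDerivAt.add h'.hasMFDerivAt).mfderiv

theorem dirDeriv_clm {V' : Type w} [NormedAddCommGroup V'] [InnerProductSpace ℝ V'] {ψ : M.Local V}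
    {α : M.A} {x : M.X} (h : MDifferentiableAt M.I 𝓘(ℝ, V) (ψ α) x) (A : V →L[ℝ] V') (k : Fin n) :
    M.dirDeriv (fun β y => A (ψ β y)) α k x = A (M.dirDeriv ψ α k x) :=
  congrArg (fun L : M.E →L[ℝ] V' => L (M.frame α k x))
    (HasMFDerivAt.comp x A.hasMFDerivAt h.hasMFDerivAt).mfderiv

theorem dirac_add {ψ ψ' : M.Local V} {α : M.A} {x : M.X}
    (h : MDifferentiableAt M.I 𝓘(ℝ, V) (ψ α) x) (h' : MDifferentiableAt M.I 𝓘(ℝ, V) (ψ' α) x) :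
    M.dirac S (fun β y => ψ β y + ψ' β y) α x = M.dirac S ψ α x + M.dirac S ψ' α x := by
  simp only [dirac, covDeriv, ← Finset.sum_add_distrib, M.dirDeriv_add h h', ← map_add]
  refine Finset.sum_congr rfl fun k _ => congrArg _ ?_
  simp only [map_add, smul_add, Finset.sum_add_distrib]
  abel

/-- ε = ±1 treats maps that commute or anticommute with vectors together. The connection term
contains two vectors, so ε disappears from it and survives only from the outer e_k. -/
theorem dirac_map [FiniteDimensional ℝ V] {ψ : M.Local V} {α : M.A} {x : M.X}
    (h : MDifferentiableAt M.I 𝓘(ℝ, V) (ψ α) x) {A : Module.End ℝ V} {ε : ℝ} (hε : ε * ε = 1)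
    (hA : ∀ k v, S.ρ (e k) (A v) = ε • A (S.ρ (e k) v)) :
    M.dirac S (fun β y => A (ψ β y)) α x = ε • A (M.dirac S ψ α x) := by
  have hd : ∀ k, M.dirDeriv (fun β y => A (ψ β y)) α k x = A (M.dirDeriv ψ α k x) :=
    M.dirDeriv_clm h (LinearMap.toContinuousLinearMap A)
  have h2 : ∀ a b v, S.ρ (e a * e b) (A v) = A (S.ρ (e a * e b) v) := by
    intro a b v
    rw [rho_mul_apply, hA, map_smul, hA, smul_smul, hε, one_smul, ← rho_mul_apply]
  simp only [dirac, covDeriv, hd, h2, ← map_smul A, ← map_sum A, ← map_add A, hA,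
    ← Finset.smul_sum]

/-- Representatives matter only over the open set `U α`, where the operator is local. -/
theorem dirac_congr {ψ ψ' : M.Local V} {α : M.A} {x : M.X} (hx : x ∈ M.U α)
    (h : ∀ y ∈ M.U α, ψ α y = ψ' α y) : M.dirac S ψ α x = M.dirac S ψ' α x := by
  have he : ψ α =ᶠ[nhds x] ψ' α := by
    filter_upwards [(M.isOpen_U α).mem_nhds hx] with y hy using h y hy
  have hd : ∀ k, M.dirDeriv ψ α k x = M.dirDeriv ψ' α k x := fun k =>
    congrArg (fun L : M.E →L[ℝ] V => L (M.frame α k x)) he.mfderiv_eq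
  simp only [dirac, covDeriv, hd, h x hx]

variable {φ : M.CylLocal V} {α : M.A} {p : M.X × ℝ}

theorem mdifferentiableAt_slice (h : MDifferentiableAt (M.I.prod 𝓘(ℝ, ℝ)) 𝓘(ℝ, V) (φ α) p) :
    MDifferentiableAt M.I 𝓘(ℝ, V) (fun y => φ α (y, p.2)) p.1 :=
  MDifferentiableAt.comp (g := φ α) p.1 h (mdifferentiableAt_id.prodMk mdifferentiableAt_const)

theorem dirDeriv_slice (h : MDifferentiableAt (M.I.prod 𝓘(ℝ, ℝ)) 𝓘(ℝ, V) (φ α) p) (k : Fin n) :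
    M.cylinder.dirDeriv φ α k.castSucc p = M.dirDeriv (fun β y => φ β (y, p.2)) α k p.1 := by
  have h1 : HasMFDerivAt M.I (M.I.prod 𝓘(ℝ, ℝ)) (fun y : M.X => (y, p.2)) p.1
      (ContinuousLinearMap.inl ℝ M.E ℝ) :=
    (hasMFDerivAt_id p.1).prodMk (hasMFDerivAt_const p.2 p.1)
  have h2 := (HasMFDerivAt.comp (g := φ α) p.1 h.hasMFDerivAt h1).mfderiv
  refine Eq.trans ?_ (congrArg (fun L : M.E →L[ℝ] V => L (M.frame α k p.1)) h2).symm
  exact congrArg (mfderiv (M.I.prod 𝓘(ℝ, ℝ)) 𝓘(ℝ, V) (φ α) p) (M.cylFrame_castSucc α k p)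

theorem hasDerivAt_slice (h : MDifferentiableAt (M.I.prod 𝓘(ℝ, ℝ)) 𝓘(ℝ, V) (φ α) p) :
    HasDerivAt (fun t => φ α (p.1, t)) (M.cylinder.dirDeriv φ α (Fin.last n) p) p.2 := by
  have h1 : HasMFDerivAt 𝓘(ℝ, ℝ) (M.I.prod 𝓘(ℝ, ℝ)) (fun t : ℝ => (p.1, t)) p.2
      (ContinuousLinearMap.inr ℝ M.E ℝ) :=
    (hasMFDerivAt_const p.1 p.2).prodMk (hasMFDerivAt_id p.2)
  have h2 := HasMFDerivAt.comp (g := φ α) p.2 h.hasMFDerivAt h1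
  -- Naming the derivative fixes its type as a map between vector spaces instead of tangent spaces.
  obtain ⟨L, hL⟩ : ∃ L : M.E × ℝ →L[ℝ] V, L = mfderiv (M.I.prod 𝓘(ℝ, ℝ)) 𝓘(ℝ, V) (φ α) p :=
    ⟨_, rfl⟩
  have h3 : HasFDerivAt (fun t => φ α (p.1, t)) (L.comp (ContinuousLinearMap.inr ℝ M.E ℝ)) p.2 := by
    subst hL
    exact h2.hasFDerivAt
  have h4 : M.cylinder.dirDeriv φ α (Fin.last n) p = L (0, 1) := by
    subst hL
    exact congrArg (mfderiv (M.I.prod 𝓘(ℝ, ℝ)) 𝓘(ℝ, V) (φ α) p) (M.cylFrame_last α p)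
  rw [h4]
  exact h3.hasDerivAt

/-- The geometric core. `Spin n`-equivariance of θ lets the connection terms e_a e_b pass through θ,
and all terms with an index n + 1 vanish. Then θ' and θl record how e_1, …, e_n and e_{n+1} act on
the image of θ. -/
theorem dirac_cylinder [FiniteDimensional ℝ V] (hp : p.1 ∈ M.U α)
    (h : MDifferentiableAt (M.I.prod 𝓘(ℝ, ℝ)) 𝓘(ℝ, V) (φ α) p) {θ θ' θl : V →ₗ[ℝ] W}
    (hspin : ∀ g ∈ Spin n, ∀ v, T.ρ (incl n g) (θ v) = θ (S.ρ g v))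
    (hθ : ∀ k v, T.ρ (e k.castSucc) (θ v) = θ' (S.ρ (e k) v))
    (hl : ∀ v, T.ρ (e (Fin.last n)) (θ v) = θl v) :
    M.cylinder.dirac T (fun β q => θ (φ β q)) α p =
      θ' (M.slice (M.dirac S) φ α p) + θl (M.dt φ α p) := by
  have h1 : ∀ k, M.cylinder.dirDeriv (fun β q => θ (φ β q)) α k p =
      θ (M.cylinder.dirDeriv φ α k p) := M.cylinder.dirDeriv_clm h (LinearMap.toContinuousLinearMap θ)
  have h2 : ∀ (a b : Fin n) v, T.ρ (e a.castSucc * e b.castSucc) (θ v) = θ (S.ρ (e a * e b) v) := by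
    intro a b v
    have := hspin _ (e_mul_e_mem_spin a b) v
    rwa [map_mul, incl_e, incl_e] at this
  have h3 : M.dt φ α p = M.cylinder.dirDeriv φ α (Fin.last n) p := (M.hasDerivAt_slice h).deriv
  change ∑ k, T.ρ (e k) (M.cylinder.covDeriv T (fun β q => θ (φ β q)) α k p) = _
  rw [Fin.sum_univ_castSucc]
  simp only [covDeriv, h1, M.christoffel_cylinder_last₁ hp, zero_smul, Finset.sum_const_zero,
    smul_zero, add_zero, h3, slice, dirac, Fin.sum_univ_castSucc,
    M.christoffel_cylinder_last₂ hp, M.christoffel_cylinder_last₃ hp,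
    M.christoffel_cylinder_castSucc hp, h2, ← map_smul θ, ← map_sum θ, ← map_add θ,
    hθ, ← map_sum θ', hl,
    M.dirDeriv_slice h]

theorem dt_add {φ' : M.CylLocal V} (h : MDifferentiableAt (M.I.prod 𝓘(ℝ, ℝ)) 𝓘(ℝ, V) (φ α) p)
    (h' : MDifferentiableAt (M.I.prod 𝓘(ℝ, ℝ)) 𝓘(ℝ, V) (φ' α) p) :
    M.dt (fun β q => φ β q + φ' β q) α p = M.dt φ α p + M.dt φ' α p :=
  deriv_add (M.hasDerivAt_slice h).differentiableAt (M.hasDerivAt_slice h').differentiableAt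

theorem dt_map [FiniteDimensional ℝ V]
    (h : MDifferentiableAt (M.I.prod 𝓘(ℝ, ℝ)) 𝓘(ℝ, V) (φ α) p) (A : Module.End ℝ V) :
    M.dt (fun β q => A (φ β q)) α p = A (M.dt φ α p) :=
  ((LinearMap.toContinuousLinearMap A).hasFDerivAt.comp_hasDerivAt p.2
    (M.hasDerivAt_slice h).differentiableAt.hasDerivAt).deriv

theorem dt_congr {φ' : M.CylLocal V} (hp : p.1 ∈ M.U α)
    (h : ∀ q : M.X × ℝ, q.1 ∈ M.U α → φ α q = φ' α q) : M.dt φ α p = M.dt φ' α p :=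
  congrArg (fun f => deriv f p.2) (funext fun t => h (p.1, t) hp)

end SpinManifold

open Module Set

/-! ### Reduction to linear algebra; the cases n ≡ 3, 5, 6, 7 -/

section CylinderCases

variable {n : ℕ} {V : Type v} {W : Type w} [NormedAddCommGroup V] [InnerProductSpace ℝ V]
  [NormedAddCommGroup W] [InnerProductSpace ℝ W]

namespace SpinManifold

variable (M : SpinManifold.{u} n) (S : SpinorModule n V)

theorem IsCylSection.mdifferentiableAt {M : SpinManifold.{u} n} {K : Type v} [NormedAddCommGroup K]
    [NormedSpace ℝ K] {r : Cl n → End ℝ K} {φ : M.CylLocal K} (h : M.IsCylSection r φ) {α : M.A}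
    {p : M.X × ℝ} (hp : p.1 ∈ M.U α) :
    MDifferentiableAt (M.I.prod 𝓘(ℝ, ℝ)) 𝓘(ℝ, K) (φ α) p :=
  ((h.1 α).contMDiffAt (((M.isOpen_U α).prod isOpen_univ).mem_nhds ⟨hp, trivial⟩)).mdifferentiableAt
    (by simp)

variable {φ φ' : M.CylLocal V} {α : M.A} {p : M.X × ℝ}

theorem slice_dirac_add (h : MDifferentiableAt (M.I.prod 𝓘(ℝ, ℝ)) 𝓘(ℝ, V) (φ α) p)
    (h' : MDifferentiableAt (M.I.prod 𝓘(ℝ, ℝ)) 𝓘(ℝ, V) (φ' α) p) :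
    M.slice (M.dirac S) (fun β q => φ β q + φ' β q) α p =
      M.slice (M.dirac S) φ α p + M.slice (M.dirac S) φ' α p :=
  M.dirac_add S (ψ := fun β y => φ β (y, p.2)) (ψ' := fun β y => φ' β (y, p.2))
    (M.mdifferentiableAt_slice h) (M.mdifferentiableAt_slice h')

variable [FiniteDimensional ℝ V]

theorem slice_dirac_map (h : MDifferentiableAt (M.I.prod 𝓘(ℝ, ℝ)) 𝓘(ℝ, V) (φ α) p)
    {A : End ℝ V} {ε : ℝ} (hε : ε * ε = 1) (hA : ∀ k v, S.ρ (e k) (A v) = ε • A (S.ρ (e k) v)) :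
    M.slice (M.dirac S) (fun β q => A (φ β q)) α p = ε • A (M.slice (M.dirac S) φ α p) :=
  M.dirac_map S (ψ := fun β y => φ β (y, p.2)) (M.mdifferentiableAt_slice h) hε hA

/-- A linear equation Aφ = Bφ on the values of φ passes to Dφ with signs. It is how D acts on
half-spinors and on fixed spaces of real structures. -/
theorem slice_dirac_mem (hp : p.1 ∈ M.U α)
    (h : MDifferentiableAt (M.I.prod 𝓘(ℝ, ℝ)) 𝓘(ℝ, V) (φ α) p)
    {A B : End ℝ V} {ε δ : ℝ} (hε : ε * ε = 1) (hδ : δ * δ = 1)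
    (hA : ∀ k v, S.ρ (e k) (A v) = ε • A (S.ρ (e k) v))
    (hB : ∀ k v, S.ρ (e k) (B v) = δ • B (S.ρ (e k) v))
    (hφ : ∀ q : M.X × ℝ, q.1 ∈ M.U α → A (φ α q) = B (φ α q)) :
    ε • A (M.slice (M.dirac S) φ α p) = δ • B (M.slice (M.dirac S) φ α p) := by
  rw [← M.slice_dirac_map S h hε hA, ← M.slice_dirac_map S h hδ hB]
  exact M.dirac_congr S hp fun y hy => hφ (y, p.2) hy

theorem dt_mem (hp : p.1 ∈ M.U α)
    (h : MDifferentiableAt (M.I.prod 𝓘(ℝ, ℝ)) 𝓘(ℝ, V) (φ α) p) {A B : End ℝ V}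
    (hφ : ∀ q : M.X × ℝ, q.1 ∈ M.U α → A (φ α q) = B (φ α q)) :
    A (M.dt φ α p) = B (M.dt φ α p) := by
  rw [← M.dt_map h A, ← M.dt_map h B]
  exact M.dt_congr hp hφ

end SpinManifold

/-- What remains after `dirac_cylinder` is a pointwise identity. The map q assembles a spinor on X
from the components in `K`, and Θ = θ ∘ q. -/
theorem isCylinderOf_of {K : Type v} [NormedAddCommGroup K] [NormedSpace ℝ K]
    [FiniteDimensional ℝ K] [FiniteDimensional ℝ V] {S : SpinorModule n V}
    {T : SpinorModule (n + 1) W} {r : Cl n → End ℝ K} {q : K →ₗ[ℝ] V}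
    (hq : ∀ g ∈ Spin n, ∀ x, q (r g x) = S.ρ g (q x)) {θ θ' θl : V →ₗ[ℝ] W}
    (hspin : ∀ g ∈ Spin n, ∀ v, T.ρ (incl n g) (θ v) = θ (S.ρ g v))
    (hθ : ∀ k v, T.ρ (e k.castSucc) (θ v) = θ' (S.ρ (e k) v))
    (hl : ∀ v, T.ρ (e (Fin.last n)) (θ v) = θl v)
    {F F' : Set K} {G G' : Set W} {Θ Θ' : K →ₗ[ℝ] W} {L : End ℝ W}
    {C : (M : SpinManifold.{u} n) → M.CylLocal K → M.CylLocal K}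
    (hΘ : ∀ x, Θ x = θ (q x)) (hF : BijOn Θ F G) (hF' : BijOn Θ' F' G')
    (hC : ∀ (M : SpinManifold.{u} n) (φ : M.CylLocal K) (α : M.A) (p : M.X × ℝ),
      p.1 ∈ M.U α → MDifferentiableAt (M.I.prod 𝓘(ℝ, ℝ)) 𝓘(ℝ, K) (φ α) p →
      (∀ q : M.X × ℝ, q.1 ∈ M.U α → φ α q ∈ F) →
      C M φ α p ∈ F' ∧ L (θ' (M.slice (M.dirac S) (fun β y => q (φ β y)) α p) +
        θl (M.dt (fun β y => q (φ β y)) α p)) = Θ' (C M φ α p)) :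
    IsCylinderOf.{u} r T F F' G G' Θ Θ' L C := by
  refine ⟨hF, hF', fun M φ hφ hφF => ⟨⟨fun α => ?_, fun α β p hp => ?_⟩, fun α p hp => ?_⟩⟩
  · exact (LinearMap.toContinuousLinearMap Θ).contMDiff.comp_contMDiffOn (hφ.1 α)
  · change Θ (φ α p) = T.ρ (incl n (M.g α β p.1)) (Θ (φ β p))
    have hx : p.1 ∈ M.U α ∩ M.U β := ⟨hp.1.1, hp.2.1⟩
    have hg := M.g_spin α β p.1 hx
    rw [hφ.2 α β p hx, hΘ, hΘ, hq _ hg, hspin _ hg]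
  · have hd := hφ.mdifferentiableAt hp
    have hdq : MDifferentiableAt (M.I.prod 𝓘(ℝ, ℝ)) 𝓘(ℝ, V) (fun y => q (φ α y)) p :=
      MDifferentiableAt.comp p (LinearMap.toContinuousLinearMap q).mdifferentiableAt hd
    obtain ⟨h1, h2⟩ := hC M φ α p hp hd (fun q => hφF α q)
    refine ⟨h1, ?_⟩
    simp only [hΘ]
    rw [M.dirac_cylinder S T (φ := fun β y => q (φ β y)) hp hdq hspin hθ hl]
    exact h2

/-- The case of two components with q(x, y) = x + Ay, where A is 1, J or ω_n; ε records whether A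
commutes or anticommutes with vectors. -/
theorem isCylinderOf_double [FiniteDimensional ℝ V] {S : SpinorModule n V}
    {T : SpinorModule (n + 1) W} {A : End ℝ V} {ε : ℝ} (hε : ε * ε = 1)
    (hA : ∀ k v, S.ρ (e k) (A v) = ε • A (S.ρ (e k) v)) {θ θ' θl : V →ₗ[ℝ] W}
    (hspin : ∀ g ∈ Spin n, ∀ v, T.ρ (incl n g) (θ v) = θ (S.ρ g v))
    (hθ : ∀ k v, T.ρ (e k.castSucc) (θ v) = θ' (S.ρ (e k) v))
    (hl : ∀ v, T.ρ (e (Fin.last n)) (θ v) = θl v)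
    {F₁ F₂ : Set V} {G : Set W} {Θ : V × V →ₗ[ℝ] W} {L : End ℝ W}
    {C : (M : SpinManifold.{u} n) → M.CylLocal (V × V) → M.CylLocal (V × V)}
    (hΘ : ∀ x, Θ x = θ (x.1 + A x.2)) (hF : BijOn Θ (F₁ ×ˢ F₂) G)
    (hC : ∀ (M : SpinManifold.{u} n) (φ : M.CylLocal (V × V)) (φ₁ φ₂ : M.CylLocal V),
      φ₁ = (fun β y => (φ β y).1) → φ₂ = (fun β y => (φ β y).2) → ∀ (α : M.A) (p : M.X × ℝ),
      p.1 ∈ M.U α → MDifferentiableAt (M.I.prod 𝓘(ℝ, ℝ)) 𝓘(ℝ, V) (φ₁ α) p →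
      MDifferentiableAt (M.I.prod 𝓘(ℝ, ℝ)) 𝓘(ℝ, V) (φ₂ α) p →
      (∀ q : M.X × ℝ, q.1 ∈ M.U α → φ₁ α q ∈ F₁) → (∀ q : M.X × ℝ, q.1 ∈ M.U α → φ₂ α q ∈ F₂) →
      ((C M φ α p).1 ∈ F₁ ∧ (C M φ α p).2 ∈ F₂) ∧
      L (θ' (M.slice (M.dirac S) φ₁ α p + ε • A (M.slice (M.dirac S) φ₂ α p)) +
        θl (M.dt φ₁ α p + A (M.dt φ₂ α p))) = θ ((C M φ α p).1 + A (C M φ α p).2)) :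
    IsCylinderOf.{u} (double S) T (F₁ ×ˢ F₂) (F₁ ×ˢ F₂) G G Θ Θ L C := by
  have hAe : ∀ g ∈ Spin n, ∀ x, A (S.ρ g x) = S.ρ g (A x) := fun g hg x => by
    refine (even_apply (fun k l x => ?_) (spinGroup.mem_even hg) x).symm
    rw [rho_mul_apply, hA, map_smul, hA, smul_smul, hε, one_smul, rho_mul_apply]
  refine isCylinderOf_of (q := LinearMap.coprod LinearMap.id A) (fun g hg x => ?_) hspin hθ hl
    hΘ hF hF fun M φ α p hp hd hφ => ?_
  · simp [double, hAe g hg]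
  · have h1 : MDifferentiableAt (M.I.prod 𝓘(ℝ, ℝ)) 𝓘(ℝ, V) (fun y => (φ α y).1) p :=
      MDifferentiableAt.comp p (ContinuousLinearMap.fst ℝ V V).mdifferentiableAt hd
    have h2 : MDifferentiableAt (M.I.prod 𝓘(ℝ, ℝ)) 𝓘(ℝ, V) (fun y => (φ α y).2) p :=
      MDifferentiableAt.comp p (ContinuousLinearMap.snd ℝ V V).mdifferentiableAt hd
    have h3 : MDifferentiableAt (M.I.prod 𝓘(ℝ, ℝ)) 𝓘(ℝ, V) (fun y => A (φ α y).2) p :=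
      MDifferentiableAt.comp p (LinearMap.toContinuousLinearMap A).mdifferentiableAt h2
    obtain ⟨h4, h5⟩ := hC M φ _ _ rfl rfl α p hp h1 h2 (fun q hq => (hφ q hq).1)
      (fun q hq => (hφ q hq).2)
    refine ⟨h4, ?_⟩
    rw [hΘ, ← h5, ← M.slice_dirac_map S (φ := fun β y => (φ β y).2) h2 hε hA,
      ← M.dt_map (φ := fun β y => (φ β y).2) h2 A,
      ← M.slice_dirac_add S (φ := fun β y => (φ β y).1) (φ' := fun β y => A (φ β y).2) h1 h3,
      ← M.dt_add (φ := fun β y => (φ β y).1) (φ' := fun β y => A (φ β y).2) h1 h3]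
    rfl

/-- The involution B splits the space: F₁ is its (+1)-eigenspace, and A carries F₂ onto the
(-1)-eigenspace. -/
theorem bijOn_add_map {V W : Type*} [AddCommGroup V] [Module ℝ V] [AddCommGroup W] [Module ℝ W]
    {A B : End ℝ V} (hB : ∀ v, B (B v) = v) (hA : Function.Bijective A) {F₁ F₂ : Set V}
    (h₁ : ∀ v, v ∈ F₁ ↔ B v = v) (h₂ : ∀ v, v ∈ F₂ ↔ B (A v) = -A v) {θ : V →ₗ[ℝ] W} {G : Set W}
    (hθ : BijOn θ univ G) {Θ : V × V →ₗ[ℝ] W} (hΘ : ∀ x, Θ x = θ (x.1 + A x.2)) :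
    BijOn Θ (F₁ ×ˢ F₂) G := by
  have h : BijOn (fun x : V × V => x.1 + A x.2) (F₁ ×ˢ F₂) univ := by
    refine ⟨mapsTo_univ _ _, fun x hx y hy hxy => ?_, fun v _ => ?_⟩
    · have h1 := (h₁ _).1 hx.1
      have h2 := (h₂ _).1 hx.2
      have h3 := (h₁ _).1 hy.1
      have h4 := (h₂ _).1 hy.2
      have h5 : x.1 + A x.2 = y.1 + A y.2 := hxy
      have h6 := congrArg B h5
      rw [map_add, map_add, h1, h2, h3, h4] at h6
      have h7 : (2 : ℝ) • x.1 = (2 : ℝ) • y.1 := by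
        calc (2 : ℝ) • x.1 = (x.1 + A x.2) + (x.1 + -A x.2) := by module
          _ = (y.1 + A y.2) + (y.1 + -A y.2) := by rw [h5, h6]
          _ = (2 : ℝ) • y.1 := by module
      have h8 := smul_right_injective V (two_ne_zero (α := ℝ)) h7
      refine Prod.ext h8 (hA.1 ?_)
      rwa [h8, add_right_inj] at h5
    · obtain ⟨w, hw⟩ := hA.2 ((1 / 2 : ℝ) • (v - B v))
      refine ⟨((1 / 2 : ℝ) • (v + B v), w), ⟨(h₁ _).2 ?_, (h₂ _).2 ?_⟩, ?_⟩
      · rw [map_smul, map_add, hB, add_comm]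
      · rw [hw, map_smul, map_sub, hB, ← smul_neg, neg_sub]
      · change (1 / 2 : ℝ) • (v + B v) + A w = v
        rw [hw]
        module
  exact (hθ.comp h).congr fun x _ => (hΘ x).symm

theorem cylinder6 {S : SpinorModule n V} {T : SpinorModule (n + 1) W} {I : End ℝ V} {Φ : V ≃ₗᵢ[ℝ] W}
    (h : Intertwines6 S T I Φ.toLinearEquiv.toLinearMap) :
    Cylinder6.{u} S T I Φ.toLinearEquiv.toLinearMap := by
  have := S.finiteDimensional
  have hb : BijOn Φ.toLinearEquiv.toLinearMap univ univ := bijOn_univ.2 Φ.bijective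
  refine isCylinderOf_of (q := LinearMap.id) (fun _ _ _ => rfl) (fun g hg => LinearMap.congr_fun (h.spin g hg))
    (fun k => LinearMap.congr_fun (h.clifford k)) (LinearMap.congr_fun h.clifford_last)
    (fun _ => rfl) hb hb fun M φ α p hp hd hφ => ⟨trivial, ?_⟩
  simp [SpinManifold.cyl6, add_comm]

theorem cylinder5 {S : SpinorModule n V} {T : SpinorModule (n + 1) W} (hn : n % 8 = 5) {J : End ℝ V}
    (hJ : S.IsSpinQuaternionic S.om J) {Φ : V ≃ₗᵢ[ℝ] W}
    (h : Intertwines5 S T S.om J Φ.toLinearEquiv.toLinearMap) :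
    Cylinder5.{u} S T J Φ.toLinearEquiv.toLinearMap := by
  have := S.finiteDimensional
  have hb : BijOn Φ.toLinearEquiv.toLinearMap univ univ := bijOn_univ.2 Φ.bijective
  have hs : ∀ x, J (J x) = -x := fun x => LinearMap.congr_fun hJ.J_sq x
  have hl : ∀ v, T.ρ (e (Fin.last n)) (Φ v) = Φ (J v) := LinearMap.congr_fun h.clifford_last
  -- On the image of Φ a single e_k acts as Je_k, by the formula for e_k e_{n+1} at Jv. Hence both
  -- θ' and θl are Φ ∘ J.
  have hc : ∀ k v, T.ρ (e k.castSucc) (Φ v) = Φ (J (S.ρ (e k) v)) := by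
    intro k v
    have h1 : T.ρ (e k.castSucc * e (Fin.last n)) (Φ (J v)) = Φ (S.ρ (e k) (J v)) :=
      LinearMap.congr_fun (h.clifford k) (J v)
    rw [rho_mul_apply, hl, hs, map_neg, map_neg] at h1
    rw [(hJ.isTwist hn).anti, map_neg, ← h1, neg_neg]
  refine isCylinderOf_of (q := LinearMap.id) (θ' := Φ.toLinearEquiv.toLinearMap ∘ₗ J)
    (θl := Φ.toLinearEquiv.toLinearMap ∘ₗ J)
    (fun _ _ _ => rfl) (fun g hg => LinearMap.congr_fun (h.spin g hg)) hc hl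
    (fun _ => rfl) hb hb fun M φ α p hp hd hφ => ⟨trivial, ?_⟩
  simp [SpinManifold.cyl5, add_comm]

theorem cylinder3 {S : SpinorModule n V} {T : SpinorModule (n + 1) W} {Φp : V ≃ₗᵢ[ℝ] T.pos}
    {Φm : V ≃ₗᵢ[ℝ] T.neg}
    (h : Intertwines7 S T Φp.toLinearEquiv.toLinearMap Φm.toLinearEquiv.toLinearMap) :
    Cylinder3.{u} S T Φp.toLinearEquiv.toLinearMap Φm.toLinearEquiv.toLinearMap := by
  have := S.finiteDimensional
  have hb : ∀ {U : Submodule ℝ W} (Φ : V ≃ₗᵢ[ℝ] U),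
      BijOn (U.subtype ∘ₗ Φ.toLinearEquiv.toLinearMap) univ U := by
    intro U Φ
    refine ⟨fun v _ => (Φ v).2, fun v _ w _ hvw => Φ.injective (Subtype.ext hvw), fun w hw => ?_⟩
    exact ⟨Φ.symm ⟨w, hw⟩, trivial, congrArg Subtype.val (Φ.apply_symm_apply ⟨w, hw⟩)⟩
  refine isCylinderOf_of (q := LinearMap.id) (fun _ _ _ => rfl) h.spin_pos
    (θ' := T.neg.subtype ∘ₗ Φm.toLinearEquiv.toLinearMap) h.clifford_pos
    (θl := T.neg.subtype ∘ₗ Φm.toLinearEquiv.toLinearMap) h.clifford_last_pos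
    (fun _ => rfl) (hb Φp) (hb Φm) fun M φ α p hp hd hφ => ⟨trivial, ?_⟩
  simp [SpinManifold.cyl3, add_comm]

end CylinderCases

open Module Set

/-! ### Half-spinors in even dimension; the case n ≡ 4 -/

section HalfSpinorCases

variable {n : ℕ} {V : Type v} {W : Type w} [NormedAddCommGroup V] [InnerProductSpace ℝ V]
  [NormedAddCommGroup W] [InnerProductSpace ℝ W]

theorem SpinorModule.mem_pos_iff {S : SpinorModule n V} {v : V} : v ∈ S.pos ↔ S.om v = v := by
  simp [SpinorModule.pos, sub_eq_zero]

theorem SpinorModule.mem_neg_iff {S : SpinorModule n V} {v : V} : v ∈ S.neg ↔ S.om v = -v := by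
  simp [SpinorModule.neg, eq_neg_iff_add_eq_zero]

theorem SpinorModule.rho_e_om_even (S : SpinorModule n V) (hn : Even n) (k : Fin n) (v : V) :
    S.ρ (e k) (S.om v) = (-1 : ℝ) • S.om (S.ρ (e k) v) := by
  rw [SpinorModule.om, rho_vol_e_even hn, neg_one_smul, neg_neg]

theorem SpinorModule.rho_e_om_odd (S : SpinorModule n V) (hn : Odd n) (k : Fin n) (v : V) :
    S.ρ (e k) (S.om v) = (1 : ℝ) • S.om (S.ρ (e k) v) := by
  rw [SpinorModule.om, rho_vol_e_odd hn, one_smul]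

theorem IsQuat.I_om {S : SpinorModule n V} {I J : End ℝ V} (h : IsQuat S.ρ I J) (v : V) :
    S.om (I v) = I (S.om v) :=
  clHom_apply (mem_clHom.2 fun k x => (h.I_comm k x).symm) _ v

theorem IsQuat.J_om {S : SpinorModule n V} {I J : End ℝ V} (h : IsQuat S.ρ I J) (v : V) :
    S.om (J v) = J (S.om v) :=
  clHom_apply (mem_clHom.2 fun k x => (h.J_comm k x).symm) _ v

namespace SpinManifold

variable (M : SpinManifold.{u} n) (S : SpinorModule n V) [FiniteDimensional ℝ V]
  {φ : M.CylLocal V} {α : M.A} {p : M.X × ℝ}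

theorem om_slice_dirac_of_mem_pos (hn : Even n) (hp : p.1 ∈ M.U α)
    (h : MDifferentiableAt (M.I.prod 𝓘(ℝ, ℝ)) 𝓘(ℝ, V) (φ α) p)
    (hφ : ∀ q : M.X × ℝ, q.1 ∈ M.U α → φ α q ∈ S.pos) :
    S.om (M.slice (M.dirac S) φ α p) = -M.slice (M.dirac S) φ α p := by
  have h1 := M.slice_dirac_mem S (A := S.om) (B := 1) (ε := -1) (δ := 1) hp h (by norm_num)
    (by norm_num) (S.rho_e_om_even hn) (fun _ _ => by simp)
    (fun q hq => SpinorModule.mem_pos_iff.1 (hφ q hq))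
  rw [neg_one_smul, one_smul, End.one_apply] at h1
  exact neg_eq_iff_eq_neg.1 h1

theorem om_slice_dirac_of_mem_neg (hn : Even n) (hp : p.1 ∈ M.U α)
    (h : MDifferentiableAt (M.I.prod 𝓘(ℝ, ℝ)) 𝓘(ℝ, V) (φ α) p)
    (hφ : ∀ q : M.X × ℝ, q.1 ∈ M.U α → φ α q ∈ S.neg) :
    S.om (M.slice (M.dirac S) φ α p) = M.slice (M.dirac S) φ α p := by
  have h1 := M.slice_dirac_mem S (A := S.om) (B := -1) (ε := -1) (δ := 1) hp h (by norm_num)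
    (by norm_num) (S.rho_e_om_even hn) (fun _ _ => by simp)
    (fun q hq => SpinorModule.mem_neg_iff.1 (hφ q hq))
  simpa using h1

theorem om_dt_of_mem_pos (hp : p.1 ∈ M.U α)
    (h : MDifferentiableAt (M.I.prod 𝓘(ℝ, ℝ)) 𝓘(ℝ, V) (φ α) p)
    (hφ : ∀ q : M.X × ℝ, q.1 ∈ M.U α → φ α q ∈ S.pos) :
    S.om (M.dt φ α p) = M.dt φ α p :=
  M.dt_mem (A := S.om) (B := 1) hp h fun q hq => SpinorModule.mem_pos_iff.1 (hφ q hq)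

theorem om_dt_of_mem_neg (hp : p.1 ∈ M.U α)
    (h : MDifferentiableAt (M.I.prod 𝓘(ℝ, ℝ)) 𝓘(ℝ, V) (φ α) p)
    (hφ : ∀ q : M.X × ℝ, q.1 ∈ M.U α → φ α q ∈ S.neg) :
    S.om (M.dt φ α p) = -M.dt φ α p :=
  M.dt_mem (A := S.om) (B := -1) hp h fun q hq => SpinorModule.mem_neg_iff.1 (hφ q hq)

end SpinManifold

theorem bijOn_add_pos_neg {S : SpinorModule n V} (hn : n % 4 = 0) {θ : V →ₗ[ℝ] W} {G : Set W}
    (hθ : BijOn θ univ G) {Θ : V × V →ₗ[ℝ] W} (hΘ : ∀ x, Θ x = θ (x.1 + x.2)) :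
    BijOn Θ (S.pos ×ˢ S.neg) G :=
  bijOn_add_map (A := 1) (rho_vol_sq_pos (Or.inl hn) S.ρ) Function.bijective_id
    (fun _ => SpinorModule.mem_pos_iff) (fun _ => SpinorModule.mem_neg_iff) hθ hΘ

theorem cylinder4 {S : SpinorModule n V} {T : SpinorModule (n + 1) W} (hn : n % 8 = 4)
    {I J : End ℝ V} (hS : S.IsQuaternionic I J) {J' : End ℝ W} {Φ : V ≃ₗᵢ[ℝ] W}
    (h : Intertwines4 S T I J T.om J' Φ.toLinearEquiv.toLinearMap) :
    Cylinder4.{u} S T I Φ.toLinearEquiv.toLinearMap := by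
  have := S.finiteDimensional
  have he : Even n := by rw [Nat.even_iff]; omega
  have hQ := (isQuaternionic_iff S I J).1 hS
  have hb : BijOn Φ.toLinearEquiv.toLinearMap univ univ := bijOn_univ.2 Φ.bijective
  refine isCylinderOf_double (A := 1) (ε := 1) (by norm_num) (fun _ _ => by simp)
    (fun g hg => LinearMap.congr_fun (h.spin g hg)) (fun k => LinearMap.congr_fun (h.clifford k))
    -- e_{n+1} acts as Iω_n, hence as I on Σ^+ and -I on Σ^-; these are the diagonal entries ±i∂_t.
    (θl := Φ.toLinearEquiv.toLinearMap ∘ₗ I ∘ₗ S.om)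
    (fun v => ?_) (fun _ => rfl) (bijOn_add_pos_neg (by omega) hb fun _ => rfl) ?_
  · exact (LinearMap.congr_fun h.clifford_last v).trans (LinearMap.congr_fun h.linear_I (S.om v))
  · intro M φ φ₁ φ₂ e₁ e₂ α p hp h₁ h₂ hF₁ hF₂
    have hD₁ := M.om_slice_dirac_of_mem_pos S he hp h₁ hF₁
    have hD₂ := M.om_slice_dirac_of_mem_neg S he hp h₂ hF₂
    have ht₁ := M.om_dt_of_mem_pos S hp h₁ hF₁
    have ht₂ := M.om_dt_of_mem_neg S hp h₂ hF₂
    simp only [SpinManifold.cyl4, ← e₁, ← e₂]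
    refine ⟨⟨SpinorModule.mem_pos_iff.2 ?_, SpinorModule.mem_neg_iff.2 ?_⟩, ?_⟩
    · rw [map_add, hQ.I_om, ht₁, hD₂]
    · rw [map_sub, hQ.I_om, ht₂, hD₁, map_neg]
      abel
    · simp only [LinearMap.comp_apply, End.one_apply, one_smul, ← map_add]
      congr 1
      rw [map_add S.om, ht₁, ht₂, map_add I, map_neg]
      abel

end HalfSpinorCases

open Module Set

/-! ### Skew-adjoint operators; the cases n ≡ 0, 1, 2 -/

section SkewCases

variable {n : ℕ} {V : Type v} {W : Type w} [NormedAddCommGroup V] [InnerProductSpace ℝ V]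
  [NormedAddCommGroup W] [InnerProductSpace ℝ W]

theorem SpinManifold.slice_diracSkew1 (M : SpinManifold.{u} n) (S : SpinorModule n V)
    (φ : M.CylLocal V) (α : M.A) (p : M.X × ℝ) :
    M.slice (M.diracSkew1 S) φ α p = -S.om (M.slice (M.dirac S) φ α p) := rfl

theorem SpinManifold.slice_diracSkew2 (M : SpinManifold.{u} n) (S : SpinorModule n V)
    (J : End ℝ V) (φ : M.CylLocal V) (α : M.A) (p : M.X × ℝ) :
    M.slice (M.diracSkew2 S J) φ α p = -J (M.slice (M.dirac S) φ α p) := rfl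

theorem cylinder2 {S : SpinorModule n V} {T : SpinorModule (n + 1) W} (hn : n % 8 = 2)
    {I J : End ℝ V} (hS : S.IsQuaternionic I J) {I' J' : End ℝ W} {Φ : V ≃ₗᵢ[ℝ] W}
    (h : Intertwines2 S T I J I' J' Φ.toLinearEquiv.toLinearMap) :
    Cylinder2.{u} S T I J Φ.toLinearEquiv.toLinearMap := by
  have := S.finiteDimensional
  have he : Even n := by rw [Nat.even_iff]; omega
  have hQ := (isQuaternionic_iff S I J).1 hS
  have hω : ∀ v, S.om (S.om v) = -v := rho_vol_sq_neg (Or.inr (by omega)) S.ρ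
  have hJ : Function.Injective J := injective_of_sq_neg hQ.J_sq
  have hI : Function.Injective I := injective_of_sq_neg hQ.I_sq
  have hb : BijOn Φ.toLinearEquiv.toLinearMap univ univ := bijOn_univ.2 Φ.bijective
  have hF : BijOn (Φ.toLinearEquiv.toLinearMap ∘ₗ LinearMap.coprod LinearMap.id J)
      ({v | S.om v = I v} ×ˢ {v | S.om v = I v}) univ := by
    -- I and ω_n are commuting complex structures, so -Iω_n is an involution with fixed space {ω_n =
    -- I}. J commutes with ω_n and anticommutes with I, so it exchanges the eigenspaces.
    refine bijOn_add_map (A := J) (B := -(I * S.om)) (fun v => ?_)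
      ⟨hJ, fun v => ⟨-J v, by rw [map_neg, hQ.J_sq, neg_neg]⟩⟩ (fun v => ?_) (fun v => ?_) hb
      fun x => rfl
    · simp [hQ.I_om, hω, hQ.I_sq]
    · simp only [mem_ofPred_eq, LinearMap.neg_apply, End.mul_apply]
      refine ⟨fun hv => by rw [hv, hQ.I_sq, neg_neg], fun hv => hI ?_⟩
      rw [hQ.I_sq, ← neg_eq_iff_eq_neg, hv]
    · simp only [mem_ofPred_eq, LinearMap.neg_apply, End.mul_apply, hQ.J_om, hQ.anti, neg_neg]
      refine ⟨fun hv => by rw [hv, hQ.I_sq, map_neg], fun hv => hI (hJ ?_)⟩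
      rw [hv, hQ.I_sq, map_neg]
  refine isCylinderOf_double (A := J) (ε := 1) (by norm_num)
    (fun k v => by rw [one_smul, hQ.J_comm])
    (fun g hg => LinearMap.congr_fun (h.spin g hg)) (fun k => LinearMap.congr_fun (h.clifford k))
    (LinearMap.congr_fun h.clifford_last) (fun _ => rfl) hF ?_
  intro M φ φ₁ φ₂ e₁ e₂ α p hp h₁ h₂ hF₁ hF₂
  -- D leads from {ω_n = I} to {ω_n = -I}, because ω_n anticommutes with vectors while I commutes; J
  -- in the skew operator leads back.
  have hD : ∀ {φ : M.CylLocal V}, MDifferentiableAt (M.I.prod 𝓘(ℝ, ℝ)) 𝓘(ℝ, V) (φ α) p →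
      (∀ q : M.X × ℝ, q.1 ∈ M.U α → φ α q ∈ {v | S.om v = I v}) →
      S.om (M.slice (M.dirac S) φ α p) = -I (M.slice (M.dirac S) φ α p) := by
    intro φ hd hφ
    have h1 := M.slice_dirac_mem S (A := S.om) (B := I) (ε := -1) (δ := 1) hp hd (by norm_num)
      (by norm_num) (S.rho_e_om_even he) (fun k v => by rw [one_smul, hQ.I_comm]) hφ
    rw [neg_one_smul, one_smul] at h1
    exact neg_eq_iff_eq_neg.1 h1
  have hD₁ := hD h₁ hF₁
  have hD₂ := hD h₂ hF₂
  have ht₁ := M.dt_mem hp h₁ hF₁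
  have ht₂ := M.dt_mem hp h₂ hF₂
  simp only [SpinManifold.cyl2, SpinManifold.slice_diracSkew2, ← e₁, ← e₂, mem_ofPred_eq]
  refine ⟨⟨?_, ?_⟩, ?_⟩
  · simp only [map_sub, map_neg, hQ.I_om, hQ.J_om, hD₂, ht₁, hQ.anti]
  · simp only [map_add, map_neg, LinearMap.neg_apply, hQ.I_om, hQ.J_om, hD₁, ht₂, hQ.anti]
  · simp only [LinearMap.neg_apply, LinearMap.comp_apply, End.one_apply, one_smul, ← map_neg Φ.toLinearEquiv.toLinearMap,
      ← map_add Φ.toLinearEquiv.toLinearMap]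
    congr 1
    simp only [map_add, map_neg, hQ.J_om, hQ.J_sq, ht₁, ht₂]
    abel

theorem cylinder1 {S : SpinorModule n V} {T : SpinorModule (n + 1) W} (hn : n % 8 = 1)
    {σ : End ℝ V} (hσ : S.IsRealStructure σ) {I J : End ℝ W} {Φ : WithLp 2 (V × V) ≃ₗᵢ[ℝ] W}
    (h : Intertwines1 S T σ I J Φ.toLinearEquiv.toLinearMap) :
    Cylinder1.{u} S T σ I J Φ.toLinearEquiv.toLinearMap := by
  have := S.finiteDimensional
  have ho : Odd n := by rw [Nat.odd_iff]; omega
  have hω : ∀ v, S.om (S.om v) = -v := rho_vol_sq_neg (Or.inl (by omega)) S.ρ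
  have hω' : Function.Injective S.om := injective_of_sq_neg hω
  have hs : ∀ v, σ (σ v) = v := fun v => LinearMap.congr_fun hσ.involutive v
  have hsω : ∀ v, σ (S.om v) = -S.om (σ v) := fun v => LinearMap.congr_fun hσ.antilinear v
  have htw := hσ.isTwist hn
  have hk : ∀ k u v, T.ρ (e k.castSucc) (Φ (WithLp.toLp 2 (u, v))) =
      Φ (WithLp.toLp 2 (S.ρ (e k) u, -S.ρ (e k) v)) := fun k u v => by
    refine (LinearMap.congr_fun (h.clifford k) _).trans ?_
    simp [block_apply]
  have hlast : ∀ u v, T.ρ (e (Fin.last n)) (Φ (WithLp.toLp 2 (u, v))) =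
      Φ (WithLp.toLp 2 (v, -u)) := fun u v => by
    refine (LinearMap.congr_fun h.clifford_last _).trans ?_
    simp [block_apply]
  have hJ : ∀ u v, J (Φ (WithLp.toLp 2 (u, v))) = Φ (WithLp.toLp 2 (σ v, -σ u)) := fun u v => by
    refine (LinearMap.congr_fun h.quaternionic _).trans ?_
    simp [block_apply]
  have hI : ∀ u v, I (Φ (WithLp.toLp 2 (u, v))) = Φ (WithLp.toLp 2 (S.om u, S.om v)) := fun u v => by
    refine (LinearMap.congr_fun h.complex _).trans ?_
    simp [block_apply]
  have hspin : ∀ g ∈ Spin n, ∀ u v, T.ρ (incl n g) (Φ (WithLp.toLp 2 (u, v))) =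
      Φ (WithLp.toLp 2 (S.ρ g u, S.ρ g v)) := fun g hg u v => by
    refine (LinearMap.congr_fun (h.spin g hg) _).trans ?_
    simp [block_apply]
  have heven : ∀ a ∈ CliffordAlgebra.even (cliffordForm n), ∀ u v,
      T.ρ (incl n a) (Φ (WithLp.toLp 2 (u, v))) = Φ (WithLp.toLp 2 (S.ρ a u, S.ρ a v)) := by
    obtain ⟨D, hD⟩ := exists_diagonal S.ρ
    intro a ha u v
    refine (even_apply (ρ := D) (ρ' := T.ρ.comp (incl n)) (φ := Φ.toLinearEquiv.toLinearMap)
      (fun k l x => ?_) ha _).trans ?_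
    · rw [hD]
      exact LinearMap.congr_fun (h.spin _ (e_mul_e_mem_spin k l)) x
    · rw [hD]
      simp [block_apply]
  -- ω_n is odd: its even factor acts diagonally and the remaining vector with opposite signs on the
  -- two summands.
  have hvol : ∀ u v, T.ρ (incl n (vol n)) (Φ (WithLp.toLp 2 (u, v))) =
      Φ (WithLp.toLp 2 (S.om u, -S.om v)) := by
    intro u v
    let k : Fin n := ⟨0, ho.pos⟩
    have h1 : vol n = -(e k * (e k * vol n)) := by
      rw [← mul_assoc, e_mul_self]; simp
    have h2 := heven _ (e_mul_vol_mem_even ho k) u v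
    rw [h1, map_neg, map_neg, map_mul, incl_e, LinearMap.neg_apply, rho_mul_apply, h2, hk,
      ← map_neg]
    congr 1
    simp [rho_e_sq, SpinorModule.om, ← WithLp.toLp_neg]
  have hom : ∀ u v, T.om (Φ (WithLp.toLp 2 (u, v))) = Φ (WithLp.toLp 2 (S.om v, S.om u)) := by
    intro u v
    rw [SpinorModule.om, vol_succ, rho_mul_apply, hlast, hvol, map_neg, neg_neg]
  let θ : V →ₗ[ℝ] W := Φ.toLinearEquiv.toLinearMap ∘ₗ
    (WithLp.linearEquiv 2 ℝ (V × V)).symm.toLinearMap ∘ₗ LinearMap.prod LinearMap.id LinearMap.id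
  -- Σ_Y^+ = {ω_{n+1} = I} is the diagonal. Every e_k, including e_{n+1}, carries it to the
  -- antidiagonal, which is parametrised by θ'; -J carries that back.
  let θ' : V →ₗ[ℝ] W := Φ.toLinearEquiv.toLinearMap ∘ₗ
    (WithLp.linearEquiv 2 ℝ (V × V)).symm.toLinearMap ∘ₗ LinearMap.prod LinearMap.id (-LinearMap.id)
  have hθ : ∀ v, θ v = Φ (WithLp.toLp 2 (v, v)) := fun _ => rfl
  have hθ' : ∀ v, θ' v = Φ (WithLp.toLp 2 (v, -v)) := fun _ => rfl
  have hb : BijOn θ univ {w | T.om w = I w} := by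
    refine ⟨fun v _ => ?_, fun u _ v _ huv => ?_, fun w hw => ?_⟩
    · rw [mem_ofPred_eq, hθ, hom, hI]
    · exact congrArg (fun x : WithLp 2 (V × V) => x.fst) (Φ.injective huv)
    · obtain ⟨⟨⟨u, v⟩⟩, rfl⟩ := Φ.surjective w
      rw [mem_ofPred_eq, hom, hI] at hw
      have h1 : v = u := hω' (congrArg (fun x : WithLp 2 (V × V) => x.fst) (Φ.injective hw))
      exact ⟨u, trivial, by rw [hθ, h1]⟩
  have hF := bijOn_add_map (A := S.om) (B := σ) (F₁ := {v | σ v = v}) (F₂ := {v | σ v = v}) hs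
    -- The real structure splits the diagonal: ω_n exchanges the ±1-eigenspaces of σ, and F₁, F₂ are
    -- the real and imaginary parts.
    ⟨hω', fun v => ⟨-S.om v, by rw [map_neg, hω, neg_neg]⟩⟩ (fun v => Iff.rfl)
    (fun v => by rw [hsω, neg_inj, mem_ofPred_eq, hω'.eq_iff]) hb
    (Θ := Φ.toLinearEquiv.toLinearMap ∘ₗ (WithLp.linearEquiv 2 ℝ (V × V)).symm.toLinearMap ∘ₗ
      (LinearMap.prod LinearMap.id LinearMap.id) ∘ₗ LinearMap.coprod LinearMap.id S.om)
    (fun _ => rfl)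
  refine isCylinderOf_double (A := S.om) (ε := 1) (by norm_num) (S.rho_e_om_odd ho) (θ := θ)
    (θ' := θ') (θl := θ') (fun g hg v => hspin g hg v v) (fun k v => hk k v v)
    (fun v => hlast v v) (fun _ => rfl) hF ?_
  intro M φ φ₁ φ₂ e₁ e₂ α p hp h₁ h₂ hF₁ hF₂
  have hD : ∀ {φ : M.CylLocal V}, MDifferentiableAt (M.I.prod 𝓘(ℝ, ℝ)) 𝓘(ℝ, V) (φ α) p →
      (∀ q : M.X × ℝ, q.1 ∈ M.U α → φ α q ∈ {v | σ v = v}) →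
      σ (M.slice (M.dirac S) φ α p) = -M.slice (M.dirac S) φ α p := by
    intro φ hd hφ
    have h1 := M.slice_dirac_mem S (A := σ) (B := 1) (ε := -1) (δ := 1) hp hd (by norm_num)
      (by norm_num) (fun k v => by rw [htw.anti, neg_one_smul, neg_neg]) (fun k v => by simp) hφ
    rw [neg_one_smul, one_smul, End.one_apply] at h1
    exact neg_eq_iff_eq_neg.1 h1
  have hD₁ := hD h₁ hF₁
  have hD₂ := hD h₂ hF₂
  have ht₁ : σ (M.dt φ₁ α p) = M.dt φ₁ α p := M.dt_mem (B := 1) hp h₁ hF₁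
  have ht₂ : σ (M.dt φ₂ α p) = M.dt φ₂ α p := M.dt_mem (B := 1) hp h₂ hF₂
  have hJθ : ∀ v, J (θ' v) = -θ (σ v) := fun v => by
    rw [hθ', hJ, map_neg, hθ, ← map_neg Φ]
    rfl
  simp only [SpinManifold.cyl1, SpinManifold.slice_diracSkew1, ← e₁, ← e₂, mem_ofPred_eq]
  refine ⟨⟨?_, ?_⟩, ?_⟩
  · simp only [map_sub, map_neg, hsω, ht₁, hD₂, neg_neg]
  · simp only [map_add, map_neg, hsω, ht₂, hD₁, neg_neg]
  · rw [← map_add, LinearMap.neg_apply, hJθ, neg_neg]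
    congr 1
    simp only [map_add, map_neg, one_smul, hsω, hD₁, hD₂, ht₁, ht₂, hω]
    abel

theorem bijOn_tmul_one {V : Type*} [AddCommGroup V] [Module ℝ V] :
    BijOn (fun v : V => v ⊗ₜ[ℝ] (1 : ℂ)) univ {x | TensorProduct.map LinearMap.id conjC x = x} := by
  let r : V ⊗[ℝ] ℂ →ₗ[ℝ] V :=
    (TensorProduct.rid ℝ V).toLinearMap ∘ₗ TensorProduct.map LinearMap.id Complex.reLm
  -- r is the real part, and x plus its conjugate is twice the real part.
  have hr : ∀ x, TensorProduct.map LinearMap.id conjC x + x = (2 : ℝ) • (r x ⊗ₜ[ℝ] (1 : ℂ)) := by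
    intro x
    induction x with
    | zero => simp
    | tmul v z =>
      have hz : conjC z + z = (2 : ℝ) • z.re • (1 : ℂ) := by
        apply Complex.ext <;> simp [conjC]; ring
      simp only [r, TensorProduct.map_tmul, LinearMap.id_apply, ← TensorProduct.tmul_add, hz,
        LinearMap.comp_apply, LinearEquiv.coe_coe, TensorProduct.rid_tmul, TensorProduct.tmul_smul,
        TensorProduct.smul_tmul', Complex.reLm_coe]
    | add x y hx hy =>
      rw [map_add, map_add, TensorProduct.add_tmul, smul_add, ← hx, ← hy]
      abel
  refine ⟨fun v _ => ?_, fun u _ v _ huv => ?_, fun x hx => ⟨r x, trivial, ?_⟩⟩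
  · simp [conjC]
  · simpa [r] using congrArg r huv
  · have h1 := hr x
    rw [show TensorProduct.map LinearMap.id conjC x = x from hx, ← two_smul ℝ x] at h1
    exact (smul_right_injective _ (two_ne_zero (α := ℝ)) h1).symm

theorem cylinder0 {S : SpinorModule n V} {T : SpinorModule (n + 1) W} (hn : n % 8 = 0)
    {σ : End ℝ W} {Φ : V ⊗[ℝ] ℂ ≃ₗᵢ[ℝ] W} (h : Intertwines0 S T σ Φ.toLinearEquiv.toLinearMap) :
    Cylinder0.{u} S T σ Φ.toLinearEquiv.toLinearMap := by
  have := S.finiteDimensional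
  have he : Even n := by rw [Nat.even_iff]; omega
  have hω : ∀ v, S.om (S.om v) = v := rho_vol_sq_pos (Or.inl (by omega)) S.ρ
  have hσ : ∀ x, σ (Φ x) = Φ (TensorProduct.map LinearMap.id conjC x) := LinearMap.congr_fun h.real
  have hom : ∀ v z, T.om (Φ (v ⊗ₜ z)) = Φ (v ⊗ₜ mulI z) := fun v z =>
    LinearMap.congr_fun h.complex (v ⊗ₜ z)
  let θ : V →ₗ[ℝ] W := Φ.toLinearEquiv.toLinearMap ∘ₗ (TensorProduct.mk ℝ V ℂ).flip 1
  -- Vectors carry real spinors v ⊗ 1 to imaginary ones, parametrised by θ'(v) = Φ(ω_n v ⊗ i);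
  -- -ω_{n+1}, which is -i, makes them real again.
  let θ' : V →ₗ[ℝ] W :=
    Φ.toLinearEquiv.toLinearMap ∘ₗ (TensorProduct.mk ℝ V ℂ).flip (mulI 1) ∘ₗ S.om
  have hθ' : ∀ v, T.om (θ' v) = -θ (S.om v) := fun v => by
    refine (hom _ _).trans ?_
    rw [show mulI (mulI 1) = -1 from LinearMap.congr_fun mulI_mul_mulI 1, TensorProduct.tmul_neg,
      map_neg]
    rfl
  have hb : BijOn θ univ {w | σ w = w} := by
    refine BijOn.comp (t := {x | TensorProduct.map LinearMap.id conjC x = x}) ?_ bijOn_tmul_one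
    refine ⟨fun x hx => ?_, Φ.injective.injOn, fun w hw => ?_⟩
    · exact (hσ x).trans (congrArg Φ hx)
    · obtain ⟨x, rfl⟩ := Φ.surjective w
      exact ⟨x, Φ.injective ((hσ x).symm.trans hw), rfl⟩
  refine isCylinderOf_double (A := 1) (ε := 1) (by norm_num) (fun _ _ => by simp) (θ := θ)
    (θ' := θ') (θl := θ')
    (fun g hg v => (LinearMap.congr_fun (h.spin g hg) (v ⊗ₜ 1)).trans rfl) (fun k v => ?_)
    (fun v => LinearMap.congr_fun h.clifford_last (v ⊗ₜ 1))
    (fun _ => rfl) (bijOn_add_pos_neg (by omega) hb fun _ => rfl) ?_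
  · refine (LinearMap.congr_fun (h.clifford k) (v ⊗ₜ 1)).trans ?_
    rw [map_mul]
    rfl
  · intro M φ φ₁ φ₂ e₁ e₂ α p hp h₁ h₂ hF₁ hF₂
    have hD₁ := M.om_slice_dirac_of_mem_pos S he hp h₁ hF₁
    have hD₂ := M.om_slice_dirac_of_mem_neg S he hp h₂ hF₂
    have ht₁ := M.om_dt_of_mem_pos S hp h₁ hF₁
    have ht₂ := M.om_dt_of_mem_neg S hp h₂ hF₂
    simp only [SpinManifold.cyl0, ← e₁, ← e₂]
    refine ⟨⟨SpinorModule.mem_pos_iff.2 ?_, SpinorModule.mem_neg_iff.2 ?_⟩, ?_⟩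
    · rw [map_add, ht₁, hD₂]
    · rw [map_sub, map_neg, ht₂, hD₁]
      abel
    · rw [← map_add, LinearMap.neg_apply, hθ', neg_neg]
      congr 1
      simp only [map_add, End.one_apply, one_smul, hD₁, hD₂, ht₁, ht₂]
      abel

end SkewCases

end RealDirac

/-! ### Assembly of the eight cases -/

theorem propositionB1 (n : ℕ) {V : Type v} {W : Type w}
    [NormedAddCommGroup V] [InnerProductSpace ℝ V] [NormedAddCommGroup W] [InnerProductSpace ℝ W]
    (S : RealDirac.SpinorModule n V) (T : RealDirac.SpinorModule (n + 1) W) :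
    (S.HasStructures ∧ T.HasStructures) ∧
    (n % 8 = 0 → ∀ σ, T.IsRealStructure σ →
      RealDirac.OrthogonalUnique (RealDirac.Intertwines0 S T σ) ∧
      ∀ Φ : V ⊗[ℝ] ℂ ≃ₗᵢ[ℝ] W, RealDirac.Intertwines0 S T σ Φ.toLinearEquiv.toLinearMap →
        RealDirac.Cylinder0.{u} S T σ Φ.toLinearEquiv.toLinearMap) ∧
    (n % 8 = 1 → ∀ σ, S.IsRealStructure σ → ∀ I J, T.IsQuaternionic I J →
      RealDirac.OrthogonalUnique (RealDirac.Intertwines1 S T σ I J) ∧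
      ∀ Φ : WithLp 2 (V × V) ≃ₗᵢ[ℝ] W,
        RealDirac.Intertwines1 S T σ I J Φ.toLinearEquiv.toLinearMap →
        RealDirac.Cylinder1.{u} S T σ I J Φ.toLinearEquiv.toLinearMap) ∧
    (n % 8 = 2 → ∀ I J, S.IsQuaternionic I J → ∀ I' J', T.IsQuaternionic I' J' →
      RealDirac.OrthogonalUnique (RealDirac.Intertwines2 S T I J I' J') ∧
      ∀ Φ : V ≃ₗᵢ[ℝ] W, RealDirac.Intertwines2 S T I J I' J' Φ.toLinearEquiv.toLinearMap →
        RealDirac.Cylinder2.{u} S T I J Φ.toLinearEquiv.toLinearMap) ∧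
    (n % 8 = 3 → ∀ I J, S.IsQuaternionic I J → ∀ I' J', T.IsQuaternionic I' J' →
      RealDirac.OrthogonalUniquePair (RealDirac.Intertwines3 S T I J I' J') ∧
      ∀ (Φp : V ≃ₗᵢ[ℝ] T.pos) (Φm : V ≃ₗᵢ[ℝ] T.neg),
        RealDirac.Intertwines3 S T I J I' J' Φp.toLinearEquiv.toLinearMap
          Φm.toLinearEquiv.toLinearMap →
        RealDirac.Cylinder3.{u} S T Φp.toLinearEquiv.toLinearMap Φm.toLinearEquiv.toLinearMap) ∧
    (n % 8 = 4 → ∀ I J, S.IsQuaternionic I J → ∀ J', T.IsSpinQuaternionic T.om J' →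
      RealDirac.OrthogonalUnique (RealDirac.Intertwines4 S T I J T.om J') ∧
      ∀ Φ : V ≃ₗᵢ[ℝ] W, RealDirac.Intertwines4 S T I J T.om J' Φ.toLinearEquiv.toLinearMap →
        RealDirac.Cylinder4.{u} S T I Φ.toLinearEquiv.toLinearMap) ∧
    (n % 8 = 5 → ∀ J, S.IsSpinQuaternionic S.om J →
      RealDirac.OrthogonalUnique (RealDirac.Intertwines5 S T S.om J) ∧
      ∀ Φ : V ≃ₗᵢ[ℝ] W, RealDirac.Intertwines5 S T S.om J Φ.toLinearEquiv.toLinearMap →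
        RealDirac.Cylinder5.{u} S T J Φ.toLinearEquiv.toLinearMap) ∧
    (n % 8 = 6 →
      RealDirac.OrthogonalUnique (RealDirac.Intertwines6 S T (-S.om)) ∧
      ∀ Φ : V ≃ₗᵢ[ℝ] W, RealDirac.Intertwines6 S T (-S.om) Φ.toLinearEquiv.toLinearMap →
        RealDirac.Cylinder6.{u} S T (-S.om) Φ.toLinearEquiv.toLinearMap) ∧
    (n % 8 = 7 →
      RealDirac.OrthogonalUniquePair (RealDirac.Intertwines7 S T) ∧
      ∀ (Φp : V ≃ₗᵢ[ℝ] T.pos) (Φm : V ≃ₗᵢ[ℝ] T.neg),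
        RealDirac.Intertwines7 S T Φp.toLinearEquiv.toLinearMap Φm.toLinearEquiv.toLinearMap →
        RealDirac.Cylinder3.{u} S T Φp.toLinearEquiv.toLinearMap Φm.toLinearEquiv.toLinearMap) := by
  refine ⟨⟨S.hasStructures, T.hasStructures⟩, fun hn σ hσ => ⟨?_, fun Φ hΦ => ?_⟩,
    fun hn σ hσ I J hT => ⟨?_, fun Φ hΦ => ?_⟩, fun hn I J hS I' J' hT => ⟨?_, fun Φ hΦ => ?_⟩,
    fun hn I J hS I' J' hT => ⟨?_, fun Φp Φm hΦ => ?_⟩,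
    fun hn I J hS J' hT => ⟨?_, fun Φ hΦ => ?_⟩, fun hn J hS => ⟨?_, fun Φ hΦ => ?_⟩,
    fun hn => ⟨?_, fun Φ hΦ => ?_⟩, fun hn => ⟨?_, fun Φp Φm hΦ => ?_⟩⟩
  · exact RealDirac.orthogonalUnique_intertwines0 S T hn hσ
  · exact RealDirac.cylinder0 hn hΦ
  · exact RealDirac.orthogonalUnique_intertwines1 S T hn hσ hT
  · exact RealDirac.cylinder1 hn hσ hΦ
  · exact RealDirac.orthogonalUnique_intertwines2 S T hn hS hT
  · exact RealDirac.cylinder2 hn hS hΦ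
  · exact RealDirac.orthogonalUniquePair_intertwines3 S T hn hS hT
  · exact RealDirac.cylinder3 hΦ.toIntertwines7
  · exact RealDirac.orthogonalUnique_intertwines4 S T hn hS hT
  · exact RealDirac.cylinder4 hn hS hΦ
  · exact RealDirac.orthogonalUnique_intertwines5 S T hn hS
  · exact RealDirac.cylinder5 hn hS hΦ
  · exact RealDirac.orthogonalUnique_intertwines6 S T hn
  · exact RealDirac.cylinder6 hΦ
  · exact RealDirac.orthogonalUniquePair_intertwines7 S T hn
  · exact RealDirac.cylinder3 hΦ
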